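/- \textbf{Conventions.} $\lambda\in\mathbb N$ is the security parameter. A \emph{QPT algorithm} is a uniform quantum polynomial-time algorithm: a single program of a classical machine that controls a quantum register (Hadamard, $\pi/8$ and CNOT gates, measurements, fresh qubits), which receives $1^\lambda$ and the input and always halts within $p(\lambda)$ steps, for some polynomial $p$. Length functions such as $m=m(\lambda)$ are \emph{polynomial}, meaning that $1^\lambda\mapsto 1^{m(\lambda)}$ is computable in quantum polynomial time with zero error. $\mathrm{negl}$ denotes functions that are asymptotically smaller than every inverse polynomial. $\mathsf{Is}\text{-}\bot(a,b)$ is $\bot$ if $a=\bot$ and $b$ otherwise. A QPT algorithm $G$ mapping $\{0,1\}^\lambda$ to $\{0,1\}^m\cup\{\bot\}$ is a \emph{$(\mu,m)$-$\bot$-PRG} if $m$ is polynomial and (1) $m(\lambda)>\lambda$ for all $\lambda$; (2) $\mu(\lambda)=O(\lambda^{-c})$ for some constant $c>0$, and for all sufficiently large $\lambda$ there is a set $\mathcal G_\lambda\subseteq\{0,1\}^\lambda$ such that (a) $\Pr_{x\leftarrow\{0,1\}^\lambda}[x\in\mathcal G_\lambda]\ge 1-\mu(\lambda)$; (b) for every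 $x\in\mathcal G_\lambda$ there is $y\in\{0,1\}^m$ with $\Pr[G(x)=y]\ge 1-\mathrm{negl}(\lambda)$; (c) for every $x\in\{0,1\}^\lambda$ there is $y\in\{0,1\}^m$ with $\Pr[G(x)\in\{y,\bot\}]\ge 1-\mathrm{negl}(\lambda)$, where $\mathrm{negl}$ does not depend on $x$; (3) for every polynomial $q$ and every QPT distinguisher $\mathcal A$, the probabilities that $\mathcal A(y_1,\dots,y_q)=1$ in the following two experiments differ by at most $\mathrm{negl}(\lambda)$: (i) $k\leftarrow\{0,1\}^\lambda$ and $y_i\leftarrow G(k)$ independently for $i\le q$; (ii) $k\leftarrow\{0,1\}^\lambda$, $y\leftarrow\{0,1\}^m$, and $y_i\leftarrow\mathsf{Is}\text{-}\bot(G(k),y)$ with independent runs of $G(k)$ for $i\le q$. For polynomial $\ell,m$, a pair of QPT algorithms $(\mathsf{QSamp},E)$, where $\mathsf{QSamp}(1^\lambda)$ outputs a string in $\{0,1\}^{\ell}$ and $E$ maps $\{0,1\}^{\ell}$ to $\{0,1\}^{m}$, is an \emph{$(\ell,m)$-$\mathsf{PRG}^{qs}$} (with strong security) if $\ell(\lambda)<m(\lambda)$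 for all $\lambda$; there are strings $y_k\in\{0,1\}^m$ with $\Pr_{k\leftarrow\mathsf{QSamp}(1^\lambda)}[E(k)=y_k]\ge 1-\mathrm{negl}(\lambda)$; and for every QPT distinguisher $\mathcal A$ the advantage $$\Bigl|\Pr_{k\leftarrow\mathsf{QSamp}(1^\lambda)}[\mathcal A(E(k))=1]-\Pr_{y\leftarrow\{0,1\}^m}[\mathcal A(y)=1]\Bigr|$$ is negligible. It is a \emph{weak} $(\ell,m)$-$\mathsf{PRG}^{qs}$ if, instead of the last condition, there is a non-constant polynomial $p$ such that the advantage of every QPT distinguisher is at most $1/p(\lambda)$ for all sufficiently large $\lambda$. \textbf{Theorem.} Let $\mu:\mathbb N\to\mathbb R$ and $m:\mathbb N\to\mathbb N$. (A) Let $G$ be a $(\mu,m)$-$\bot$-PRG. Then the following pair $(\mathsf{QSamp},\mathsf{PRG})$ is a weak $(\lambda,m)$-$\mathsf{PRG}^{qs}$. $\mathsf{QSamp}(1^\lambda)$: at most $\lambda$ times, draw $k\leftarrow\{0,1\}^\lambda$ and compute $y_1,\dots,y_\lambda$ by $\lambda$ independent evaluations of $G(k)$; if the first most common element of $(y_1,\dots,y_\lambda)$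 is not $\bot$, output $k$ and stop. If all attempts fail, output $0^\lambda$. $\mathsf{PRG}(k)$: compute $y_1,\dots,y_\lambda$ by $\lambda$ independent evaluations of $G(k)$ and output the first most common value among those different from $\bot$, or $0^m$ if all of them are $\bot$. (B) If $m(\lambda)>\lambda^2$ for all $\lambda$ and a $(\mu,m)$-$\bot$-PRG exists (so that, by definition, $\mu=O(\lambda^{-c})$ for some constant $c>0$), then a $(\lambda^2,m)$-$\mathsf{PRG}^{qs}$ with strong security exists. -/

import Mathlib

open scoped NNReal ENNReal

noncomputable section

namespace BotPRG

/-! ### Machine model: classical control with a quantum register -/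

/-- Tape alphabet. -/
inductive Sym
  | zero
  | one
  | bot
  | sep
  deriving DecidableEq

/-- A (possibly unnormalised) pure state of countably many qubits: a finite linear combination of
basis states. The basis state `S` is the one in which exactly the qubits in `S` are in state 1. -/
abbrev QState := Finset ℕ →₀ ℂ

/-- All qubits in state 0. -/
def QState.init : QState := Finsupp.single ∅ 1

/-- Hadamard gate on qubit `q`. -/
def QState.hadamard (q : ℕ) (ψ : QState) : QState :=
  Finsupp.linearCombination ℂ
    (fun S : Finset ℕ =>
      if q ∈ S then
        ((√2 : ℝ) : ℂ)⁻¹ • (Finsupp.single (S.erase q) (1 : ℂ) - Finsupp.single S 1)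
      else
        ((√2 : ℝ) : ℂ)⁻¹ • (Finsupp.single S (1 : ℂ) + Finsupp.single (insert q S) 1)) ψ

/-- The gate `diag(1, exp(iπ/4))` on qubit `q`. -/
def QState.tgate (q : ℕ) (ψ : QState) : QState :=
  Finsupp.linearCombination ℂ
    (fun S : Finset ℕ =>
      Finsupp.single S (if q ∈ S then Complex.exp (Complex.I * (Real.pi / 4)) else 1)) ψ

/-- Controlled NOT with control `c` and target `t` (the identity if `c = t`). -/
def QState.cnot (c t : ℕ) (ψ : QState) : QState :=
  Finsupp.linearCombination ℂ
    (fun S : Finset ℕ =>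
      Finsupp.single (if c ∈ S ∧ c ≠ t then symmDiff S {t} else S) (1 : ℂ)) ψ

/-- Squared norm. -/
def QState.normSq (ψ : QState) : ℝ≥0 := ∑ S ∈ ψ.support, ‖ψ S‖₊ ^ 2

/-- Projection onto the subspace in which qubit `q` has value `b`. -/
def QState.proj (q : ℕ) (b : Bool) (ψ : QState) : QState :=
  ψ.filter (fun S => decide (q ∈ S) = b)

/-- Born probability of the outcome 1 when qubit `q` is measured. -/
def QState.probOne (q : ℕ) (ψ : QState) : ℝ≥0 := (ψ.proj q true).normSq / ψ.normSq

theorem QState.normSq_proj_le (q : ℕ) (b : Bool) (ψ : QState) :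
    (ψ.proj q b).normSq ≤ ψ.normSq := by
  unfold QState.normSq QState.proj
  rw [Finsupp.support_filter]
  calc
    _ = ∑ S ∈ ψ.support.filter (fun S => decide (q ∈ S) = b), ‖ψ S‖₊ ^ 2 := by
      refine Finset.sum_congr rfl fun S hS => ?_
      rw [Finsupp.filter_apply, if_pos (Finset.mem_filter.1 hS).2]
    _ ≤ _ := Finset.sum_le_sum_of_subset (Finset.filter_subset _ _)

theorem QState.probOne_le_one (q : ℕ) (ψ : QState) : ψ.probOne q ≤ 1 :=
  div_le_one_of_le₀ (QState.normSq_proj_le q true ψ) zero_le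

/-- A biased coin: `true` with probability `p`. -/
def coin (p : ℝ≥0) (h : p ≤ 1) : PMF Bool :=
  PMF.ofFintype (fun b => ((if b then p else 1 - p : ℝ≥0) : ℝ≥0∞)) (by
    rw [Fintype.sum_bool, ← ENNReal.coe_add]
    simp [add_tsub_cancel_of_le h])

/-- Configuration of the machine: classical registers holding strings, the quantum register, and
the number of time steps spent so far. -/
structure Config where
  reg : ℕ → List Sym
  qreg : QState
  time : ℕ

/-- Programs. Qubits are addressed in unary: a classical register of length `i` points to qubit
number `i`. -/
inductive Prog
  /-- do nothing -/
  | skip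
  /-- empty the register `r` -/
  | clear (r : ℕ)
  /-- put the symbol `a` in front of the register `r` -/
  | push (r : ℕ) (a : Sym)
  /-- remove the first symbol of the register `r` -/
  | pop (r : ℕ)
  /-- overwrite the register `dst` by the contents of `src` -/
  | copy (dst src : ℕ)
  /-- Hadamard gate on the qubit addressed by `r` -/
  | hadamard (r : ℕ)
  /-- the `π/8`-gate on the qubit addressed by `r` -/
  | tgate (r : ℕ)
  /-- controlled NOT on the qubits addressed by `r` (control) and `r'` (target) -/
  | cnot (r r' : ℕ)
  /-- measure the qubit addressed by `r` and put the outcome in front of the register `dst` -/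
  | measure (r dst : ℕ)
  /-- discard the quantum register and take a fresh one, with all qubits in state 0 -/
  | fresh
  /-- sequential composition -/
  | seq (P Q : Prog)
  /-- branch on the first symbol of the register `r` (`none` if `r` is empty) -/
  | cases (r : ℕ) (P : Option Sym → Prog)
  /-- run `P` as many times as the length that `r` has when the loop is entered -/
  | loop (r : ℕ) (P : Prog)

/-- The symbol of a bit. -/
def bitSym (b : Bool) : Sym := if b then Sym.one else Sym.zero

/-- Spend `t` time steps. -/
def Config.tick (t : ℕ) (s : Config) : Config := { s with time := s.time + t }

/-- Overwrite the register `r` by `w`. -/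
def Config.setReg (r : ℕ) (w : List Sym) (s : Config) : Config :=
  { s with reg := Function.update s.reg r w }

/-- Replace the quantum state. -/
def Config.setQ (ψ : QState) (s : Config) : Config := { s with qreg := ψ }

/-- Iterate a random step `k` times. -/
def iter {X : Type} (f : X → PMF X) : ℕ → X → PMF X
  | 0, x => PMF.pure x
  | k + 1, x => (f x).bind (iter f k)

/-- Execution of a program: the distribution of the final configuration. Every instruction costs
one time step, except that copying a string also costs its length. -/
def exec : Prog → Config → PMF Config
  | .skip, s => PMF.pure (s.tick 1)
  | .clear r, s => PMF.pure ((s.setReg r []).tick 1)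
  | .push r a, s => PMF.pure ((s.setReg r (a :: s.reg r)).tick 1)
  | .pop r, s => PMF.pure ((s.setReg r (s.reg r).tail).tick 1)
  | .copy dst src, s => PMF.pure ((s.setReg dst (s.reg src)).tick (1 + (s.reg src).length))
  | .hadamard r, s => PMF.pure ((s.setQ (s.qreg.hadamard (s.reg r).length)).tick 1)
  | .tgate r, s => PMF.pure ((s.setQ (s.qreg.tgate (s.reg r).length)).tick 1)
  | .cnot r r', s =>
      PMF.pure ((s.setQ (s.qreg.cnot (s.reg r).length (s.reg r').length)).tick 1)
  | .measure r dst, s =>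
      (coin (s.qreg.probOne (s.reg r).length) (QState.probOne_le_one _ _)).map fun b =>
        ((s.setQ (s.qreg.proj (s.reg r).length b)).setReg dst (bitSym b :: s.reg dst)).tick 1
  | .fresh, s => PMF.pure ((s.setQ QState.init).tick 1)
  | .seq P Q, s => (exec P s).bind (exec Q)
  | .cases r P, s => exec (P (s.reg r).head?) (s.tick 1)
  | .loop r P, s => iter (exec P) (s.reg r).length (s.tick 1)

/-- Initial configuration: the security parameter `1ⁿ` in register 0, the input in register 1,
all other registers empty and all qubits in state 0. -/
def Config.init (n : ℕ) (w : List Sym) : Config where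
  reg r := if r = 0 then List.replicate n Sym.one else if r = 1 then w else []
  qreg := QState.init
  time := 0

/-! ### Encodings and quantum polynomial time -/

/-- Bit strings of length `n`. -/
abbrev Bits (n : ℕ) := Fin n → Bool

/-- Encoding of data by strings. -/
class Enc (X : Type) where
  enc : X → List Sym

open Enc

instance : Enc Unit := ⟨fun _ => []⟩

instance : Enc Bool := ⟨fun b => [bitSym b]⟩

/-- Natural numbers are encoded in unary. -/
instance : Enc ℕ := ⟨fun k => List.replicate k Sym.one⟩

instance (n : ℕ) : Enc (Bits n) := ⟨fun x => (List.ofFn x).map bitSym⟩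

/-- `none` plays the role of `⊥`. -/
instance (n : ℕ) : Enc (Option (Bits n)) := ⟨fun y => y.elim [Sym.bot] enc⟩

/-- Tuples: each entry is followed by a separator. -/
instance (q n : ℕ) : Enc (Fin q → Option (Bits n)) :=
  ⟨fun y => (List.ofFn y).flatMap fun a => enc a ++ [Sym.sep]⟩

/-- A family of randomised maps is quantum polynomial time if one program, given the security
parameter in unary and the input, leaves in register 2 a sample from exactly the prescribed output
distribution, and always stops within a number of steps polynomial in the security parameter. -/
def IsQPT {X Y : ℕ → Type} [∀ n, Enc (X n)] [∀ n, Enc (Y n)]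
    (f : ∀ n, X n → PMF (Y n)) : Prop :=
  ∃ (P : Prog) (p : Polynomial ℕ), ∀ (n : ℕ) (x : X n),
    (exec P (Config.init n (enc x))).map (fun s => s.reg 2) = (f n x).map enc ∧
    ∀ s ∈ (exec P (Config.init n (enc x))).support, s.time ≤ p.eval n

/-- Polynomial length functions: `1ⁿ ↦ 1^ℓ(n)` can be computed in polynomial time
(hence `ℓ` is bounded by a polynomial). -/
def IsPolyLength (ℓ : ℕ → ℕ) : Prop :=
  IsQPT (X := fun _ => Unit) (Y := fun _ => ℕ) (fun n _ => PMF.pure (ℓ n))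

/-! ### Probabilities -/

/-- Probability that a random bit equals 1. -/
def pr (p : PMF Bool) : ℝ := (p true).toReal

/-- The uniform distribution on bit strings. -/
def uniform (n : ℕ) : PMF (Bits n) := PMF.uniformOfFintype (Bits n)

/-- `q` independent samples. -/
def iid {X : Type} (p : PMF X) : (q : ℕ) → PMF (Fin q → X)
  | 0 => PMF.pure Fin.elim0
  | q + 1 => p.bind fun x => (iid p q).map fun xs => Fin.cons x xs

/-- Negligible functions: asymptotically smaller than every inverse polynomial. -/
def Negligible (ε : ℕ → ℝ) : Prop :=
  Asymptotics.SuperpolynomialDecay Filter.atTop (fun n : ℕ => (n : ℝ)) ε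

/-! ### Pseudorandom generators with `⊥` -/

/-- `⊥` if the first argument is `⊥`, the second argument otherwise. -/
def isBot {X : Type} (a : Option X) (b : X) : Option X := a.map fun _ => b

/-- `(μ, m)`-`⊥`-pseudodeterministic pseudorandom generators. -/
structure IsBotPRG (μ : ℕ → ℝ) (m : ℕ → ℕ) (G : ∀ n, Bits n → PMF (Option (Bits (m n)))) :
    Prop where
  length : IsPolyLength m
  qpt : IsQPT (X := fun n => Bits n) (Y := fun n => Option (Bits (m n))) G
  expansion : ∀ n, n < m n
  error : ∃ c : ℝ, 0 < c ∧ μ =O[Filter.atTop] fun n : ℕ => (n : ℝ) ^ (-c)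
  pseudodeterminism : ∃ ε : ℕ → ℝ, Negligible ε ∧ ∀ᶠ n in Filter.atTop,
    ∃ good : Finset (Bits n),
      1 - μ n ≤ (good.card : ℝ) / 2 ^ n ∧
      (∀ x ∈ good, ∃ y : Bits (m n), 1 - ε n ≤ (G n x (some y)).toReal) ∧
      ∀ x, ∃ y : Bits (m n), 1 - ε n ≤ (G n x (some y)).toReal + (G n x none).toReal
  security : ∀ (q : Polynomial ℕ) (A : ∀ n, (Fin (q.eval n) → Option (Bits (m n))) → PMF Bool),
    IsQPT (X := fun n => Fin (q.eval n) → Option (Bits (m n))) (Y := fun _ => Bool) A →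
    ∃ ε : ℕ → ℝ, Negligible ε ∧ ∀ n,
      |pr ((uniform n).bind fun k => (iid (G n k) (q.eval n)).bind (A n)) -
        pr ((uniform n).bind fun k => (uniform (m n)).bind fun y =>
          (iid ((G n k).map fun a => isBot a y) (q.eval n)).bind (A n))| ≤ ε n

/-! ### Pseudorandom generators with quantum input sampling -/

/-- The advantage of the distinguisher `A` against the sampler `S` and the evaluator `E`. -/
def advantage {ℓ m : ℕ → ℕ} (S : ∀ n, PMF (Bits (ℓ n))) (E : ∀ n, Bits (ℓ n) → PMF (Bits (m n)))
    (A : ∀ n, Bits (m n) → PMF Bool) (n : ℕ) : ℝ :=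
  |pr ((S n).bind fun k => (E n k).bind (A n)) - pr ((uniform (m n)).bind (A n))|

/-- All requirements on an `(ℓ, m)`-pseudorandom generator with quantum input sampling except
security: efficiency, expansion and determinism. -/
structure IsQSGenerator (ℓ m : ℕ → ℕ) (S : ∀ n, PMF (Bits (ℓ n)))
    (E : ∀ n, Bits (ℓ n) → PMF (Bits (m n))) : Prop where
  length_in : IsPolyLength ℓ
  length_out : IsPolyLength m
  qpt_sample : IsQPT (X := fun _ => Unit) (Y := fun n => Bits (ℓ n)) fun n _ => S n
  qpt_eval : IsQPT (X := fun n => Bits (ℓ n)) (Y := fun n => Bits (m n)) E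
  expansion : ∀ n, ℓ n < m n
  determinism : ∃ Y : ∀ n, Bits (ℓ n) → Bits (m n), ∃ ε : ℕ → ℝ, Negligible ε ∧ ∀ n,
    1 - ε n ≤ pr ((S n).bind fun k => (E n k).map fun y => decide (y = Y n k))

/-- Pseudorandom generators with quantum input sampling (strong security). -/
structure IsPRGqs (ℓ m : ℕ → ℕ) (S : ∀ n, PMF (Bits (ℓ n)))
    (E : ∀ n, Bits (ℓ n) → PMF (Bits (m n))) : Prop extends IsQSGenerator ℓ m S E where
  security : ∀ A : ∀ n, Bits (m n) → PMF Bool,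
    IsQPT (X := fun n => Bits (m n)) (Y := fun _ => Bool) A →
    ∃ ε : ℕ → ℝ, Negligible ε ∧ ∀ n, advantage S E A n ≤ ε n

/-- Weak pseudorandom generators with quantum input sampling: the advantage of every distinguisher
is eventually at most `1 / p`, for a non-constant polynomial `p`. -/
structure IsWeakPRGqs (ℓ m : ℕ → ℕ) (S : ∀ n, PMF (Bits (ℓ n)))
    (E : ∀ n, Bits (ℓ n) → PMF (Bits (m n))) : Prop extends IsQSGenerator ℓ m S E where
  security : ∃ p : Polynomial ℕ, 0 < p.natDegree ∧ ∀ A : ∀ n, Bits (m n) → PMF Bool,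
    IsQPT (X := fun n => Bits (m n)) (Y := fun _ => Bool) A →
    ∀ᶠ n in Filter.atTop, advantage S E A n ≤ 1 / ((p.eval n : ℕ) : ℝ)

/-! ### The construction -/

/-- The first most common element of a list (`none` if the list is empty). -/
def vote {X : Type} [DecidableEq X] (l : List X) : Option X := l.argmax fun a => l.count a

/-- `t` attempts: draw a seed, evaluate the generator `n` times on it, and output the seed if the
first most common value is not `⊥`. The failure symbol is represented by the zero string. -/
def sampleLoop {m : ℕ → ℕ} (G : ∀ n, Bits n → PMF (Option (Bits (m n)))) (n : ℕ) :
    ℕ → PMF (Bits n)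
  | 0 => PMF.pure fun _ => false
  | t + 1 => (uniform n).bind fun k => (iid (G n k) n).bind fun y =>
      if vote (List.ofFn y) = some none then sampleLoop G n t else PMF.pure k

/-- The quantum input sampler: `n` attempts. -/
def botSample {m : ℕ → ℕ} (G : ∀ n, Bits n → PMF (Option (Bits (m n)))) (n : ℕ) : PMF (Bits n) :=
  sampleLoop G n n

/-- The evaluator: evaluate the generator `n` times and output the first most common value other
than `⊥` (the zero string if there is none). -/
def botEval {m : ℕ → ℕ} (G : ∀ n, Bits n → PMF (Option (Bits (m n)))) (n : ℕ) (k : Bits n) :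
    PMF (Bits (m n)) :=
  (iid (G n k) n).map fun y => (vote (List.ofFn y).reduceOption).getD fun _ => false

end BotPRG

end

noncomputable section

namespace BotPRG

/-! ### Preliminaries on probability mass functions -/

/-! Both parts follow from one fact: the sampler and evaluator of (A) already have negligible
advantage (`IsBotPRG.negligible_advantage`). For (A) this is below 1/n eventually; for (B) seeds are
padded with zeros to length n², which changes neither outputs nor advantage, so no amplification
takes place.

For a seed k let a(k) be the probability that n evaluations of G(k) do not vote for ⊥, and v(k) the
probability that the distinguisher accepts the evaluator's output on k. Put s = E a(k), and let u be
the acceptance probability on a uniform string. Up to an error (1 - s)^n the sampler draws k with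
weight proportional to a(k), so the claim is E[a(k)v(k)] ≈ s·u. The left side is the outcome of an
experiment with 2n samples: the first n decide acceptance, the other n feed the evaluator. By
multi-sample security G(k) may be replaced by Is-⊥(G(k), y) with y uniform. There acceptance depends
only on the pattern of ⊥, hence not on y, and the evaluator returns y unless all its samples are ⊥;
the result is κ'·u, with κ' the ideal acceptance probability. The same experiment with the
distinguisher that always accepts gives s ≈ κ'. Together E[a v] ≈ s·u, and
`abs_ex_sampleLoop_sub_le` passes from one attempt to the whole loop. The decay of μ enters through
μ → 0, which makes an attempt succeed with probability at least 1/2 for large n.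

The quantitative point is that an accepted seed might later yield only ⊥. For every seed
a(k)·Pr[⊥]^n ≤ (15/16)^n (`acceptProb_mul_le`): either Pr[⊥] is bounded away from 1, or a Chernoff
bound makes acceptance exponentially unlikely. Seeds with many ⊥ thus need not be rare; acceptance
itself filters them. The same estimate gives determinism, because every seed has outputs in {y, ⊥}
up to negligible error.

Efficiency is shown by explicit programs. `Spec` describes runs that begin and end with all qubits
in state 0, so specifications compose without tracking quantum states. `exists_call` makes any
program a subroutine: its registers are renamed, and cleaning up is possible because it writes into
finitely many registers and its output is bounded by its running time. Voting, filtering and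
splitting are scans of lists of words. -/

theorem PMF.bind_congr {α β : Type} {p : PMF α} {f g : α → PMF β}
    (h : ∀ a ∈ p.support, f a = g a) : p.bind f = p.bind g := by
  ext b
  rw [PMF.bind_apply, PMF.bind_apply]
  refine tsum_congr fun a => ?_
  by_cases ha : p a = 0
  · simp [ha]
  · rw [h a ((PMF.mem_support_iff _ _).2 ha)]

theorem PMF.map_congr {α β : Type} {p : PMF α} {f g : α → β}
    (h : ∀ a ∈ p.support, f a = g a) : p.map f = p.map g :=
  PMF.bind_congr fun a ha => by simp [h a ha]

/-! ### Specifications of programs -/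

/-- Contents of the classical registers. -/
abbrev Regs := ℕ → List Sym

/-- Started with classical registers `σ` and all qubits in state 0, the random step `f` ends with
classical registers distributed according to `D` and all qubits in state 0, within `T` time
steps. -/
def Spec (f : Config → PMF Config) (σ : Regs) (D : PMF Regs) (T : ℕ) : Prop :=
  ∀ t, (f ⟨σ, QState.init, t⟩).map (fun s => (s.reg, s.qreg)) =
      D.map (fun τ => (τ, QState.init)) ∧
    ∀ s ∈ (f ⟨σ, QState.init, t⟩).support, s.time ≤ t + T

/-- Deterministic specifications. -/
abbrev Runs (f : Config → PMF Config) (σ τ : Regs) (T : ℕ) : Prop := Spec f σ (PMF.pure τ) T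

theorem Spec.mono {f : Config → PMF Config} {σ : Regs} {D : PMF Regs} {T T' : ℕ}
    (h : Spec f σ D T) (hT : T ≤ T') : Spec f σ D T' :=
  fun t => ⟨(h t).1, fun s hs => ((h t).2 s hs).trans (by omega)⟩

theorem Spec.mem {f : Config → PMF Config} {σ : Regs} {D : PMF Regs} {T t : ℕ}
    (h : Spec f σ D T) {s : Config} (hs : s ∈ (f ⟨σ, QState.init, t⟩).support) :
    s.reg ∈ D.support ∧ s.qreg = QState.init := by
  have h1 : (s.reg, s.qreg) ∈ ((f ⟨σ, QState.init, t⟩).map (fun s => (s.reg, s.qreg))).support :=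
    (PMF.mem_support_map_iff _ _ _).2 ⟨s, hs, rfl⟩
  rw [(h t).1, PMF.mem_support_map_iff] at h1
  obtain ⟨τ, hτ, h2⟩ := h1
  rw [Prod.mk.injEq] at h2
  exact ⟨h2.1 ▸ hτ, h2.2.symm⟩

/-- The qubits are clean again after `f`, so the specification of `g`, which speaks only of that
situation, applies at every intermediate configuration, whatever time it carries. -/
theorem Spec.bind {f g : Config → PMF Config} {σ : Regs} {D : PMF Regs} {F : Regs → PMF Regs}
    {T T' : ℕ} (hf : Spec f σ D T) (hg : ∀ τ ∈ D.support, Spec g τ (F τ) T') :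
    Spec (fun s => (f s).bind g) σ (D.bind F) (T + T') := by
  intro t
  constructor
  · rw [PMF.map_bind, PMF.map_bind]
    have h1 : ∀ s ∈ (f ⟨σ, QState.init, t⟩).support,
        (g s).map (fun s => (s.reg, s.qreg)) =
          (fun x : Regs × QState => (F x.1).map (fun τ => (τ, QState.init))) (s.reg, s.qreg) := by
      intro s hs
      obtain ⟨h2, h3⟩ := hf.mem hs
      have := (hg _ h2 s.time).1
      rw [← h3] at this
      rw [← h3]
      exact this
    rw [PMF.bind_congr h1]
    have h4 := congrArg (fun p => PMF.bind p
      (fun x : Regs × QState => (F x.1).map (fun τ => (τ, QState.init)))) (hf t).1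
    simp only [PMF.bind_map] at h4
    exact h4
  · intro s hs
    rw [PMF.mem_support_bind_iff] at hs
    obtain ⟨s1, hs1, hs2⟩ := hs
    obtain ⟨h2, h3⟩ := hf.mem hs1
    have h5 := (hg _ h2 s1.time).2 s
    rw [← h3] at h5
    have := h5 hs2
    have := (hf t).2 s1 hs1
    omega

theorem Spec.seq {P Q : Prog} {σ : Regs} {D : PMF Regs} {F : Regs → PMF Regs}
    {T T' : ℕ} (hP : Spec (exec P) σ D T) (hQ : ∀ τ ∈ D.support, Spec (exec Q) τ (F τ) T') :
    Spec (exec (.seq P Q)) σ (D.bind F) (T + T') := by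
  have := Spec.bind hP hQ
  intro t
  simpa only [exec] using this t

theorem Runs.bind {f g : Config → PMF Config} {σ τ : Regs} {D : PMF Regs}
    {T T' : ℕ} (hf : Runs f σ τ T) (hg : Spec g τ D T') :
    Spec (fun s => (f s).bind g) σ D (T + T') := by
  have := Spec.bind (F := fun _ => D) hf (g := g) (T' := T') (by simpa using hg)
  simpa using this

theorem Runs.seq {P Q : Prog} {σ τ : Regs} {D : PMF Regs}
    {T T' : ℕ} (hP : Runs (exec P) σ τ T) (hQ : Spec (exec Q) τ D T') :
    Spec (exec (.seq P Q)) σ D (T + T') := by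
  have := Spec.seq (F := fun _ => D) hP (Q := Q) (T' := T') (by simpa using hQ)
  simpa using this

theorem Runs.conv {f : Config → PMF Config} {σ τ τ' : Regs} {T T' : ℕ} (h : Runs f σ τ T)
    (hT : T ≤ T') (hτ : τ = τ') : Runs f σ τ' T' := hτ ▸ h.mono hT

theorem Runs.skip (σ : Regs) : Runs (exec .skip) σ σ 1 := by
  intro t; simp [exec, Config.tick, PMF.pure_map]

theorem Runs.clear (r : ℕ) (σ : Regs) :
    Runs (exec (.clear r)) σ (Function.update σ r []) 1 := by
  intro t; simp [exec, Config.tick, Config.setReg, PMF.pure_map]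

theorem Runs.push (r : ℕ) (a : Sym) (σ : Regs) :
    Runs (exec (.push r a)) σ (Function.update σ r (a :: σ r)) 1 := by
  intro t; simp [exec, Config.tick, Config.setReg, PMF.pure_map]

theorem Runs.pop (r : ℕ) (σ : Regs) :
    Runs (exec (.pop r)) σ (Function.update σ r (σ r).tail) 1 := by
  intro t; simp [exec, Config.tick, Config.setReg, PMF.pure_map]

theorem Runs.copy (dst src : ℕ) (σ : Regs) :
    Runs (exec (.copy dst src)) σ (Function.update σ dst (σ src)) (1 + (σ src).length) := by
  intro t; simp [exec, Config.tick, Config.setReg, PMF.pure_map]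

theorem Spec.of_tick {f g : Config → PMF Config} {σ : Regs} {D : PMF Regs} {T : ℕ}
    (h : Spec f σ D T)
    (hg : ∀ t, g ⟨σ, QState.init, t⟩ = f ⟨σ, QState.init, t + 1⟩) : Spec g σ D (1 + T) := by
  intro t
  rw [hg]
  exact ⟨(h (t + 1)).1, fun s hs => ((h (t + 1)).2 s hs).trans (by omega)⟩

theorem Spec.cases {r : ℕ} {P : Option Sym → Prog} {σ : Regs} {D : PMF Regs} {T : ℕ}
    (h : Spec (exec (P (σ r).head?)) σ D T) : Spec (exec (.cases r P)) σ D (1 + T) :=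
  h.of_tick fun t => by simp [exec, Config.tick]

theorem Spec.loop {r : ℕ} {P : Prog} {σ : Regs} {D : PMF Regs} {T : ℕ}
    (h : Spec (iter (exec P) (σ r).length) σ D T) : Spec (exec (.loop r P)) σ D (1 + T) :=
  h.of_tick fun t => by simp [exec, Config.tick]

theorem Runs.iter_zero (f : Config → PMF Config) (σ : Regs) : Runs (iter f 0) σ σ 0 := by
  intro t; simp [iter, PMF.pure_map]

theorem Runs.iter_succ {f : Config → PMF Config} {k : ℕ} {σ τ : Regs} {D : PMF Regs} {T T' : ℕ}
    (h : Runs f σ τ T) (h' : Spec (iter f k) τ D T') : Spec (iter f (k + 1)) σ D (T + T') :=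
  Runs.bind h h'

/-- Iteration of a step that is deterministic on a family of states. -/
theorem Runs.iterate {f : Config → PMF Config} {α : Type} (β : α → Regs) (g : α → α) {T : ℕ}
    (I : α → Prop) (hI : ∀ a, I a → I (g a)) (h : ∀ a, I a → Runs f (β a) (β (g a)) T) (k : ℕ)
    (a : α) (ha : I a) : Runs (iter f k) (β a) (β (g^[k] a)) (k * T) := by
  induction k generalizing a with
  | zero => simpa using Runs.iter_zero f (β a)
  | succ k ih =>
    refine (Runs.iter_succ (h a ha) (ih (g a) (hI a ha))).mono (le_of_eq (by ring))

theorem Spec.unique {f : Config → PMF Config} {σ : Regs} {D D' : PMF Regs} {T T' : ℕ}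
    (h : Spec f σ D T) (h' : Spec f σ D' T') : D = D' := by
  have := congrArg (PMF.map Prod.fst) ((h 0).1.symm.trans (h' 0).1)
  rw [PMF.map_comp, PMF.map_comp] at this
  exact (PMF.map_id D).symm.trans (this.trans (PMF.map_id D'))

/-- Since `β` need not be injective, `F` is not directly a kernel on register contents. If `β a = β
b`, then `F a` and `F b` both describe `g` started in the same state and agree by `Spec.unique`;
choosing a preimage therefore gives a well-defined kernel `H`. -/
theorem Spec.bindMap {f g : Config → PMF Config} {σ : Regs} {α : Type} {β : α → Regs} {p : PMF α}
    {F : α → PMF Regs} {T T' : ℕ} (hf : Spec f σ (p.map β) T)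
    (hg : ∀ a ∈ p.support, Spec g (β a) (F a) T') :
    Spec (fun s => (f s).bind g) σ (p.bind F) (T + T') := by
  classical
  let H : Regs → PMF Regs := fun τ =>
    if h : ∃ a ∈ p.support, β a = τ then F h.choose else PMF.pure τ
  have hH : ∀ a ∈ p.support, H (β a) = F a ∧ Spec g (β a) (H (β a)) T' := by
    intro a ha
    have h : ∃ b ∈ p.support, β b = β a := ⟨a, ha, rfl⟩
    have h1 := hg _ h.choose_spec.1
    rw [h.choose_spec.2] at h1
    have h2 : H (β a) = F h.choose := dif_pos h
    rw [h2]
    exact ⟨h1.unique (hg a ha), h1⟩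
  have h := hf.bind (g := g) (F := H) (T' := T') (by
    intro τ hτ
    rw [PMF.mem_support_map_iff] at hτ
    obtain ⟨a, ha, rfl⟩ := hτ
    exact (hH a ha).2)
  rw [PMF.bind_map] at h
  rwa [PMF.bind_congr (f := H ∘ β) (g := F) fun a ha => (hH a ha).1] at h

theorem Spec.seqMap {P Q : Prog} {σ : Regs} {α : Type} {β : α → Regs} {p : PMF α}
    {F : α → PMF Regs} {T T' : ℕ} (hP : Spec (exec P) σ (p.map β) T)
    (hQ : ∀ a ∈ p.support, Spec (exec Q) (β a) (F a) T') :
    Spec (exec (.seq P Q)) σ (p.bind F) (T + T') := by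
  have := Spec.bindMap hP hQ
  intro t
  simpa only [exec] using this t

/-- Iteration of a random step on a family of states. -/
theorem Spec.iterate {f : Config → PMF Config} {α : Type} (β : α → Regs) (g : α → PMF α) {T : ℕ}
    (h : ∀ a, Spec f (β a) ((g a).map β) T) (k : ℕ) (a : α) :
    Spec (iter f k) (β a) ((iter g k a).map β) (k * T) := by
  induction k generalizing a with
  | zero => simpa [iter, PMF.pure_map] using Runs.iter_zero f (β a)
  | succ k ih =>
    have := Spec.bindMap (g := iter f k) (h a) (fun b _ => ih b)
    simp only [iter, PMF.map_bind]
    exact this.mono (le_of_eq (by ring))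

/-! ### States given by lists of words -/

/-- The registers `0, 1, …` hold the words in the list, all other registers are empty. -/
def St (L : List (List Sym)) : Regs := fun i => L.getD i []

@[simp] theorem St_apply (L : List (List Sym)) (i : ℕ) : St L i = L.getD i [] := rfl

theorem update_St (L : List (List Sym)) (i : ℕ) (w : List Sym) (h : i < L.length) :
    Function.update (St L) i w = St (L.set i w) := by
  funext j
  by_cases hj : j = i
  · subst hj; simp [h]
  · simp [hj, List.getD_eq_getElem?_getD, Ne.symm hj]

/-- All registers from 2 on are empty, so any number `j` of them can be listed as working space. -/
theorem Config.init_eq (n : ℕ) (w : List Sym) (j : ℕ) :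
    Config.init n w =
      ⟨St (List.replicate n Sym.one :: w :: List.replicate j []), QState.init, 0⟩ := by
  unfold Config.init
  congr 1
  funext i
  rcases i with _ | _ | i
  · simp
  · simp
  · simp [List.getD_eq_getElem?_getD, List.getElem?_replicate]
    split <;> rfl

/-- On security parameter `n` and input `w`, the program `P` leaves in register 2 a sample from
`D`, within `T` time steps. -/
def Impl (P : Prog) (n : ℕ) (w : List Sym) (D : PMF (List Sym)) (T : ℕ) : Prop :=
  (exec P (Config.init n w)).map (fun s => s.reg 2) = D ∧
    ∀ s ∈ (exec P (Config.init n w)).support, s.time ≤ T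

theorem Spec.impl {P : Prog} {n j : ℕ} {w : List Sym} {D : PMF Regs} {T : ℕ}
    (h : Spec (exec P) (St (List.replicate n Sym.one :: w :: List.replicate j [])) D T) :
    Impl P n w (D.map fun τ => τ 2) T := by
  have h0 := h 0
  rw [← Config.init_eq] at h0
  refine ⟨?_, fun s hs => by simpa using h0.2 s hs⟩
  have := congrArg (PMF.map fun x : Regs × QState => x.1 2) h0.1
  simpa only [PMF.map_comp, Function.comp_def] using this

/-! ### Calling a program as a subroutine -/

/-- Rename the register `r` to `K + r`. -/
def Prog.shift (K : ℕ) : Prog → Prog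
  | .skip => .skip
  | .clear r => .clear (K + r)
  | .push r a => .push (K + r) a
  | .pop r => .pop (K + r)
  | .copy dst src => .copy (K + dst) (K + src)
  | .hadamard r => .hadamard (K + r)
  | .tgate r => .tgate (K + r)
  | .cnot r r' => .cnot (K + r) (K + r')
  | .measure r dst => .measure (K + r) (K + dst)
  | .fresh => .fresh
  | .seq P Q => .seq (P.shift K) (Q.shift K)
  | .cases r P => .cases (K + r) fun o => (P o).shift K
  | .loop r P => .loop (K + r) (P.shift K)

/-- Put the registers of a configuration behind `K` registers with contents `ρ`. -/
def Config.embed (K : ℕ) (ρ : Regs) (d : ℕ) (s : Config) : Config where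
  reg i := if i < K then ρ i else s.reg (i - K)
  qreg := s.qreg
  time := s.time + d

theorem Config.embed_tick (K : ℕ) (ρ : Regs) (d t : ℕ) (s : Config) :
    (s.tick t).embed K ρ d = (s.embed K ρ d).tick t := by
  simp only [Config.embed, Config.tick, Config.mk.injEq, true_and]
  omega

theorem Config.embed_setReg (K : ℕ) (ρ : Regs) (d r : ℕ) (w : List Sym) (s : Config) :
    (s.setReg r w).embed K ρ d = (s.embed K ρ d).setReg (K + r) w := by
  simp only [Config.embed, Config.setReg, Config.mk.injEq, and_true]
  funext i
  by_cases h : i < K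
  · have : i ≠ K + r := by omega
    simp [h, this]
  · by_cases h' : i = K + r
    · subst h'; simp
    · have : i - K ≠ r := by omega
      simp [h, h', this]

theorem Config.embed_setQ (K : ℕ) (ρ : Regs) (d : ℕ) (ψ : QState) (s : Config) :
    (s.setQ ψ).embed K ρ d = (s.embed K ρ d).setQ ψ := rfl

theorem Config.embed_reg (K : ℕ) (ρ : Regs) (d r : ℕ) (s : Config) :
    (s.embed K ρ d).reg (K + r) = s.reg r := by
  simp [Config.embed]

theorem Config.embed_qreg (K : ℕ) (ρ : Regs) (d : ℕ) (s : Config) :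
    (s.embed K ρ d).qreg = s.qreg := rfl

theorem iter_map {X Y : Type} {f : X → PMF X} {g : Y → PMF Y} {e : X → Y}
    (h : ∀ x, g (e x) = (f x).map e) (k : ℕ) (x : X) :
    iter g k (e x) = (iter f k x).map e := by
  induction k generalizing x with
  | zero => simp [iter, PMF.pure_map]
  | succ k ih =>
    simp only [iter, h, PMF.bind_map, PMF.map_bind]
    congr 1
    funext y
    exact ih y

/-- Instructions see registers only through their contents, qubits only through lengths of
registers, and never read the clock. Hence embedding commutes with each of them. -/
theorem exec_shift (K : ℕ) (ρ : Regs) (d : ℕ) (P : Prog) (s : Config) :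
    exec (P.shift K) (s.embed K ρ d) = (exec P s).map (Config.embed K ρ d) := by
  induction P generalizing s with
  | skip | clear | push | pop | copy | hadamard | tgate | cnot | fresh =>
    simp [Prog.shift, exec, PMF.pure_map, Config.embed_tick, Config.embed_setReg,
      Config.embed_setQ, Config.embed_reg, Config.embed_qreg]
  | measure =>
    simp [Prog.shift, exec, PMF.map_comp, Function.comp_def, Config.embed_tick,
      Config.embed_setReg, Config.embed_setQ, Config.embed_reg, Config.embed_qreg]
  | seq P Q ihP ihQ =>
    simp only [Prog.shift, exec, ihP, PMF.bind_map, PMF.map_bind]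
    congr 1
    funext t
    exact ihQ t
  | cases r P ih =>
    simp only [Prog.shift, exec, Config.embed_reg, ← Config.embed_tick, ih]
  | loop r P ih =>
    simp only [Prog.shift, exec, Config.embed_reg, ← Config.embed_tick]
    exact iter_map ih _ _

theorem iter_support {X : Type} {f : X → PMF X} {R : X → X → Prop} (hr : ∀ x, R x x)
    (ht : ∀ x y z, R x y → R y z → R x z) (h : ∀ x, ∀ y ∈ (f x).support, R x y) (k : ℕ) (x : X) :
    ∀ y ∈ (iter f k x).support, R x y := by
  induction k generalizing x with
  | zero => simp [iter, hr]
  | succ k ih =>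
    intro y hy
    simp only [iter, PMF.mem_support_bind_iff] at hy
    obtain ⟨z, hz, hy⟩ := hy
    exact ht _ _ _ (h _ _ hz) (ih z y hy)

/-- A program only writes into finitely many registers. -/
theorem exec_frame (P : Prog) :
    ∃ N, ∀ s, ∀ s' ∈ (exec P s).support, ∀ r, N ≤ r → s'.reg r = s.reg r := by
  induction P with
  | skip | hadamard | tgate | cnot | fresh =>
    exact ⟨0, by simp [exec, Config.tick, Config.setQ]⟩
  | clear r | push r | pop r | copy r =>
    refine ⟨r + 1, ?_⟩
    intro s s' hs r' hr
    have : r' ≠ r := by omega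
    simp only [exec, PMF.support_pure, Set.mem_singleton_iff] at hs
    simp [hs, Config.tick, Config.setReg, this]
  | measure r dst =>
    refine ⟨dst + 1, ?_⟩
    intro s s' hs r' hr
    have : r' ≠ dst := by omega
    simp only [exec, PMF.mem_support_map_iff] at hs
    obtain ⟨b, -, rfl⟩ := hs
    simp [Config.tick, Config.setReg, Config.setQ, this]
  | seq P Q ihP ihQ =>
    obtain ⟨N, hN⟩ := ihP
    obtain ⟨N', hN'⟩ := ihQ
    refine ⟨max N N', fun s s' hs r hr => ?_⟩
    simp only [exec, PMF.mem_support_bind_iff] at hs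
    obtain ⟨t, ht, hs⟩ := hs
    rw [hN' t s' hs r (le_of_max_le_right hr), hN s t ht r (le_of_max_le_left hr)]
  | cases r P ih =>
    choose N hN using ih
    -- A branching has five continuations, one for each element of `Option Sym`; the finite alphabet
    -- is what allows a common bound.
    refine ⟨max (N none) (max (max (N (some .zero)) (N (some .one)))
      (max (N (some .bot)) (N (some .sep)))), fun s s' hs r' hr => ?_⟩
    simp only [exec] at hs
    refine hN _ _ s' hs r' (le_trans ?_ hr)
    rcases (s.reg r).head? with _ | _ | _ | _ | _ <;> simp
  | loop r P ih =>
    obtain ⟨N, hN⟩ := ih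
    refine ⟨N, fun s s' hs r' hr => ?_⟩
    simp only [exec] at hs
    exact iter_support (R := fun s s' => s'.reg r' = s.reg r') (fun _ => rfl)
      (by intro _ _ _ h h'; exact h'.trans h) (fun x y hy => hN x y hy r' hr) _ _ s' hs

/-- Registers grow at most by the number of time steps. -/
theorem exec_length (P : Prog) (s : Config) : ∀ s' ∈ (exec P s).support,
    s.time ≤ s'.time ∧ ∀ M, (∀ r, (s.reg r).length ≤ M + s.time) →
      ∀ r, (s'.reg r).length ≤ M + s'.time := by
  induction P generalizing s with
  | skip | hadamard | tgate | cnot | fresh =>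
    simp only [exec, PMF.support_pure, Set.mem_singleton_iff, forall_eq, Config.tick, Config.setQ]
    exact ⟨by omega, fun M h r => by have := h r; omega⟩
  | clear r' | push r' | pop r' | copy r' =>
    simp only [exec, PMF.support_pure, Set.mem_singleton_iff, forall_eq, Config.tick,
      Config.setReg]
    refine ⟨by omega, fun M h r => ?_⟩
    have := h r
    have := h r'
    rw [Function.update_apply]
    split <;> simp <;> grind
  | measure r' dst =>
    simp only [exec, PMF.mem_support_map_iff]
    rintro s' ⟨b, -, rfl⟩
    simp only [Config.tick, Config.setReg, Config.setQ]
    refine ⟨by omega, fun M h r => ?_⟩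
    have := h r
    have := h dst
    rw [Function.update_apply]
    split <;> simp <;> omega
  | seq P Q ihP ihQ =>
    intro s' hs
    simp only [exec, PMF.mem_support_bind_iff] at hs
    obtain ⟨t, ht, hs⟩ := hs
    obtain ⟨h1, h2⟩ := ihP s t ht
    obtain ⟨h3, h4⟩ := ihQ t s' hs
    exact ⟨h1.trans h3, fun M h => h4 M (h2 M h)⟩
  | cases r P ih =>
    intro s' hs
    simp only [exec] at hs
    obtain ⟨h1, h2⟩ := ih _ _ s' hs
    simp only [Config.tick] at h1 h2
    exact ⟨by omega, fun M h => h2 M fun r => by have := h r; omega⟩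
  | loop r P ih =>
    intro s' hs
    simp only [exec] at hs
    obtain ⟨h1, h2⟩ := iter_support (R := fun s s' => s.time ≤ s'.time ∧
      ∀ M, (∀ r, (s.reg r).length ≤ M + s.time) → ∀ r, (s'.reg r).length ≤ M + s'.time)
      (fun _ => ⟨le_rfl, fun _ h => h⟩)
      (fun _ _ _ h h' => ⟨h.1.trans h'.1, fun M h'' => h'.2 M (h.2 M h'')⟩) ih _ _ s' hs
    simp only [Config.tick] at h1 h2
    exact ⟨by omega, fun M h => h2 M fun r => by have := h r; omega⟩

/-- Initially no register is longer than n + |w|, and afterwards growth is paid for by time steps.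
This bounds the cost of copying an output. -/
theorem Impl.length_le {P : Prog} {n : ℕ} {w : List Sym} {D : PMF (List Sym)} {T : ℕ}
    (h : Impl P n w D T) : ∀ y ∈ D.support, y.length ≤ n + w.length + T := by
  intro y hy
  rw [← h.1, PMF.mem_support_map_iff] at hy
  obtain ⟨s, hs, rfl⟩ := hy
  have h1 := (exec_length P _ s hs).2 (n + w.length) (fun r => by
    simp only [Config.init]
    split_ifs <;> simp) 2
  have := h.2 s hs
  omega

/-- Empty the registers `K, …, K + N - 1`. -/
def clearRange (K : ℕ) : ℕ → Prog
  | 0 => .skip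
  | N + 1 => .seq (clearRange K N) (.clear (K + N))

/-- Run `P` on the input in register `a` and put its output into register `b`, using the `N`
registers from `K` on as working space. -/
def call (K N : ℕ) (P : Prog) (a b : ℕ) : Prog :=
  .seq (.copy K 0) (.seq (.copy (K + 1) a)
    (.seq (P.shift K) (.seq (.copy b (K + 2)) (.seq (clearRange K N) .fresh))))

theorem exec_clearRange (K N : ℕ) (s : Config) : exec (clearRange K N) s =
    PMF.pure ⟨fun i => if K ≤ i ∧ i < K + N then [] else s.reg i, s.qreg, s.time + (1 + N)⟩ := by
  induction N with
  | zero =>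
    simp only [clearRange, exec, Config.tick]
    congr 2
    funext i
    rw [if_neg (by omega)]
  | succ N ih =>
    simp only [clearRange, exec, ih, PMF.pure_bind, Config.tick, Config.setReg]
    congr 2
    funext i
    rw [Function.update_apply]
    split_ifs <;> first | rfl | omega

/-- The work area is empty, so copying 1ⁿ and the input into it produces an embedded initial
configuration. Everything `P` wrote lies in the `N` registers that are cleared, and `fresh` resets
the qubits it used. The factor 2 in the time pays for copying the output, whose length is at most n
+ |w| + T. -/
theorem Spec.call {K N : ℕ} {P : Prog} (hN : 3 ≤ N)
    (hP : ∀ s, ∀ s' ∈ (exec P s).support, ∀ r, N ≤ r → s'.reg r = s.reg r)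
    {σ : Regs} {n : ℕ} (hn : σ 0 = List.replicate n Sym.one) (hσ : ∀ i, K ≤ i → σ i = [])
    {a b : ℕ} (ha : a < K) (hb : b < K) {D : PMF (List Sym)} {T : ℕ}
    (h : Impl P n (σ a) D T) :
    Spec (exec (call K N P a b)) σ (D.map fun y => Function.update σ b y)
      (5 + N + 2 * (n + (σ a).length + T)) := by
  intro t
  -- All randomness of the call comes from `P` itself: the call is one run of `P` from its own
  -- initial configuration followed by a deterministic map.
  have e1 : exec (BotPRG.call K N P a b) ⟨σ, QState.init, t⟩ =
      (exec P (Config.init n (σ a))).map fun s =>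
        ⟨Function.update σ b (s.reg 2), QState.init,
          s.time + t + 2 + n + (σ a).length + (1 + (s.reg 2).length) + (1 + N) + 1⟩ := by
    have e2 : ((Config.mk σ QState.init t).setReg K (σ 0)).tick (1 + (σ 0).length) =
        ⟨Function.update σ K (List.replicate n Sym.one), QState.init, t + (1 + n)⟩ := by
      simp [Config.setReg, Config.tick, hn]
    have e3 : Function.update σ K (List.replicate n Sym.one) a = σ a := by
      rw [Function.update_of_ne (by omega)]
    have e4 : ((Config.mk (Function.update σ K (List.replicate n Sym.one)) QState.init
        (t + (1 + n))).setReg (K + 1) (σ a)).tick (1 + (σ a).length) =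
        (Config.init n (σ a)).embed K σ (t + 2 + n + (σ a).length) := by
      simp only [Config.setReg, Config.tick, Config.embed, Config.init, Config.mk.injEq, true_and]
      constructor
      · funext i
        simp only [Function.update_apply]
        by_cases h1 : i < K
        · rw [if_neg (by omega), if_neg (by omega), if_pos h1]
        · rw [if_neg h1]
          split_ifs <;> first | rfl | omega | exact hσ i (by omega)
      · omega
    simp only [BotPRG.call, exec, PMF.pure_bind, e2, e3, e4, exec_shift, PMF.bind_map,
      exec_clearRange]
    refine PMF.map_congr fun s hs => ?_
    have h2 : (Config.embed K σ (t + 2 + n + (σ a).length) s).reg (K + 2) = s.reg 2 :=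
      Config.embed_reg ..
    simp only [h2]
    simp only [Config.embed, Config.tick, Config.setReg, Config.setQ, Config.mk.injEq, true_and]
    constructor
    · funext i
      simp only [Function.update_apply]
      by_cases h1 : i < K
      · rw [if_neg (by omega), if_pos h1]
      · rw [if_neg (show i ≠ b by omega), if_neg h1, if_neg (show i ≠ b by omega),
          hσ i (by omega)]
        split_ifs with h3
        · rfl
        · rw [hP _ s hs _ (by omega)]
          simp only [Config.init]
          rw [if_neg (by omega), if_neg (by omega)]
    · omega
  rw [e1]
  constructor
  · rw [← h.1, PMF.map_comp, PMF.map_comp, PMF.map_comp]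
    rfl
  · intro s hs
    rw [PMF.mem_support_map_iff] at hs
    obtain ⟨s1, hs1, rfl⟩ := hs
    have h1 := h.2 s1 hs1
    have h2 := h.length_le (s1.reg 2) (by
      rw [← h.1, PMF.mem_support_map_iff]
      exact ⟨s1, hs1, rfl⟩)
    simp only
    omega

/-- Every program can be called as a subroutine. -/
theorem exists_call (P : Prog) : ∃ N, ∀ (K a b : ℕ) (L : List (List Sym)) (n : ℕ)
    (D : PMF (List Sym)) (T : ℕ), L.length = K → L.getD 0 [] = List.replicate n Sym.one →
      a < K → b < K → Impl P n (L.getD a []) D T →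
      Spec (exec (call K N P a b)) (St L) (D.map fun y => St (L.set b y))
        (5 + N + 2 * (n + (L.getD a []).length + T)) := by
  obtain ⟨N, hN⟩ := exec_frame P
  refine ⟨max 3 N, fun K a b L n D T hL hn ha hb h => ?_⟩
  have := Spec.call (le_max_left 3 N) (fun s s' hs r hr => hN s s' hs r (le_of_max_le_right hr))
    (σ := St L) hn (K := K) (fun i hi => by simp [List.getD_eq_getElem?_getD, hL, hi])
    ha hb h
  simpa only [update_St L b _ (hL ▸ hb), St_apply] using this

/-! ### Random bits -/

/-- Put a uniformly random bit in front of the register `r`. -/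
def flip (r : ℕ) : Prog := .seq (.hadamard r) (.seq (.measure r r) .fresh)

theorem QState.normSq_single_add (q : ℕ) (c : ℂ) :
    (Finsupp.single ∅ c + Finsupp.single {q} c : QState).normSq = 2 * ‖c‖₊ ^ 2 := by
  have h : (∅ : Finset ℕ) ≠ {q} := (Finset.singleton_ne_empty q).symm
  unfold QState.normSq
  rw [Finset.sum_subset (s₂ := {∅, {q}}), Finset.sum_pair h]
  · simp [h, h.symm]; ring
  · refine Finsupp.support_add.trans ?_
    refine Finset.union_subset ?_ ?_ <;>
    exact Finsupp.support_single_subset.trans (by simp)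
  · intro S _ hS
    simp [Finsupp.notMem_support_iff.1 hS]

theorem QState.init_hadamard (q : ℕ) : QState.init.hadamard q =
    Finsupp.single ∅ (((√2 : ℝ) : ℂ)⁻¹) + Finsupp.single {q} (((√2 : ℝ) : ℂ)⁻¹) := by
  simp [QState.init, QState.hadamard, Finsupp.linearCombination_single]

theorem QState.probOne_init_hadamard (q : ℕ) : (QState.init.hadamard q).probOne q = 1 / 2 := by
  have h2 : ((Finsupp.single ∅ (((√2 : ℝ) : ℂ)⁻¹) + Finsupp.single {q} (((√2 : ℝ) : ℂ)⁻¹) :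
      QState).proj q true) = Finsupp.single {q} (((√2 : ℝ) : ℂ)⁻¹) := by
    unfold QState.proj
    rw [Finsupp.filter_add, Finsupp.filter_single_of_neg _ (by simp),
      Finsupp.filter_single_of_pos _ (by simp), zero_add]
  have h3 : ‖(((√2 : ℝ) : ℂ)⁻¹)‖₊ ≠ 0 := by simp
  rw [QState.probOne, QState.init_hadamard, QState.normSq_single_add, h2]
  rw [QState.normSq, Finsupp.support_single _ (inv_ne_zero (by simp))]
  rw [Finset.sum_singleton, Finsupp.single_eq_same]
  field_simp

theorem coin_half (p : ℝ≥0) (h : p ≤ 1) (hp : p = 1 / 2) :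
    coin p h = PMF.uniformOfFintype Bool := by
  subst hp
  ext b
  have : (1 : ℝ≥0) - 1 / 2 = 1 / 2 := by
    rw [tsub_eq_iff_eq_add_of_le h]; norm_num
  cases b <;> simp [coin]

/-- The qubit used is addressed by the current length of `r`, so it changes from flip to flip. This
is harmless: the outcome is fair for every qubit of the zero state, and `fresh` restores that state.
-/
theorem Spec.flip (r : ℕ) (σ : Regs) : Spec (exec (flip r)) σ
    ((PMF.uniformOfFintype Bool).map fun b => Function.update σ r (bitSym b :: σ r)) 3 := by
  intro t
  have h := fun q => coin_half _ (QState.probOne_le_one q _) (QState.probOne_init_hadamard q)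
  simp only [BotPRG.flip, exec, PMF.pure_bind, Config.setQ, Config.tick, Config.setReg, h,
    PMF.bind_map, PMF.map_comp]
  refine ⟨PMF.map_comp _ _ _, ?_⟩
  intro s hs
  erw [PMF.mem_support_map_iff] at hs
  obtain ⟨b, -, rfl⟩ := hs
  simp

/-! ### Programs on words and lists of words -/

theorem Runs.stClear (L : List (List Sym)) (r : ℕ) (hr : r < L.length) :
    Runs (exec (.clear r)) (St L) (St (L.set r [])) 1 :=
  (update_St L r _ hr) ▸ Runs.clear r (St L)

theorem Runs.stPush (L : List (List Sym)) (r : ℕ) (a : Sym) (hr : r < L.length) :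
    Runs (exec (.push r a)) (St L) (St (L.set r (a :: L.getD r []))) 1 :=
  (update_St L r _ hr) ▸ Runs.push r a (St L)

theorem Runs.stPop (L : List (List Sym)) (r : ℕ) (hr : r < L.length) :
    Runs (exec (.pop r)) (St L) (St (L.set r (L.getD r []).tail)) 1 :=
  (update_St L r _ hr) ▸ Runs.pop r (St L)

theorem Runs.stCopy (L : List (List Sym)) (dst src : ℕ) (hr : dst < L.length) :
    Runs (exec (.copy dst src)) (St L) (St (L.set dst (L.getD src [])))
      (1 + (L.getD src []).length) :=
  (update_St L dst _ hr) ▸ Runs.copy dst src (St L)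

theorem Runs.iter_add {f : Config → PMF Config} {j k : ℕ} {σ τ : Regs} {D : PMF Regs}
    {T T' : ℕ} (h : Runs (iter f j) σ τ T) (h' : Spec (iter f k) τ D T') :
    Spec (iter f (j + k)) σ D (T + T') := by
  have := Runs.bind h h'
  have e : ∀ s, (iter f j s).bind (iter f k) = iter f (j + k) s := by
    clear h h' this
    induction j with
    | zero => simp [iter]
    | succ j ih =>
      intro s
      rw [show j + 1 + k = (j + k) + 1 by ring]
      simp only [iter, PMF.bind_bind]
      congr 1
      funext x
      exact ih x
  simpa only [e] using this

/-- Move the contents of register `a` to the front of register `b`, reversing it. -/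
def moveRev (a b : ℕ) : Prog :=
  .loop a (.cases a fun o => match o with
    | some x => .seq (.push b x) (.pop a)
    | none => .skip)

theorem Runs.moveRev (L : List (List Sym)) (a b : ℕ) (hab : a ≠ b) (ha : a < L.length)
    (hb : b < L.length) :
    Runs (exec (moveRev a b)) (St L)
      (St ((L.set a []).set b ((L.getD a []).reverse ++ L.getD b [])))
      (1 + (L.getD a []).length * 3) := by
  -- The number of passes is fixed on entering the loop, so emptying `a` meanwhile is harmless. The
  -- induction is on the contents of `a`, with the other registers arbitrary.
  have key : ∀ (u : List Sym) (σ : Regs), σ a = u → Runs (iter (exec (.cases a fun o =>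
      match o with
      | some x => .seq (.push b x) (.pop a)
      | none => .skip)) u.length) σ
      (Function.update (Function.update σ a []) b (u.reverse ++ σ b)) (u.length * 3) := by
    intro u
    induction u with
    | nil =>
      intro σ hσ
      refine Runs.conv (Runs.iter_zero _ σ) (by simp) ?_
      funext i
      simp only [Function.update_apply]
      split_ifs <;> simp_all
    | cons x u ih =>
      intro σ hσ
      have h1 := (Runs.push b x σ).seq (Runs.pop a _)
      have h2 : Runs (exec (.cases a fun o => match o with
          | some x => .seq (.push b x) (.pop a)
          | none => .skip)) σ _ _ := Spec.cases (by rw [hσ]; exact h1)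
      refine Runs.conv (h2.iter_succ (ih _ ?_)) ?_ ?_
      · simp [hab, hσ]
      · simp; omega
      · funext i
        simp only [Function.update_apply]
        split_ifs <;> simp_all
  have h := key (L.getD a []) (St L) rfl
  rw [update_St _ _ _ ha, update_St _ _ _ (by simpa using hb)] at h
  exact Spec.loop h

/-- Lists of words are stored with a separator behind each word. -/
def encW (ws : List (List Sym)) : List Sym := ws.flatMap fun u => u ++ [Sym.sep]

@[simp] theorem encW_nil : encW [] = [] := rfl

@[simp] theorem encW_cons (u : List Sym) (ws : List (List Sym)) :
    encW (u :: ws) = u ++ Sym.sep :: encW ws := by simp [encW]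

@[simp] theorem encW_append (ws ws' : List (List Sym)) :
    encW (ws ++ ws') = encW ws ++ encW ws' := by simp [encW]

theorem length_le_encW (ws : List (List Sym)) : ws.length ≤ (encW ws).length := by
  induction ws with
  | nil => simp
  | cons u ws ih => simp; omega

theorem length_mem_le_encW {ws : List (List Sym)} {u : List Sym} (hu : u ∈ ws) :
    u.length ≤ (encW ws).length := by
  induction ws with
  | nil => simp at hu
  | cons v ws ih =>
    rw [encW_cons, List.length_append, List.length_cons]
    rcases List.mem_cons.1 hu with rfl | hu
    · omega
    · have := ih hu; omega

/-- Scan the list of words in register `a`, and run `body` for each word, with the reversed word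
in register `w`. -/
def foldWords (a w : ℕ) (body : Prog) : Prog :=
  .loop a (.cases a fun o => match o with
    | some Sym.sep => .seq (.pop a) (.seq body (.clear w))
    | some x => .seq (.push w x) (.pop a)
    | none => .skip)

/-- Each pass consumes one symbol: ordinary symbols go to `w`, a separator triggers `body` on the
word collected there. So the passes number the length of the encoding, and each costs at most T + 3
(branch, pop, `body`, clear). The entries of `β x` at `a` and `w` are overwritten in the statement,
and `body` may leave any `u'` in `w` because `w` is cleared next. -/
theorem Runs.foldWords {a w : ℕ} {body : Prog} {α : Type} (β : α → List (List Sym))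
    (g : α → List Sym → α) (I : α → Prop) {T : ℕ} (haw : a ≠ w)
    (hlen : ∀ x, a < (β x).length ∧ w < (β x).length) (ws : List (List Sym))
    (hI : ∀ x, I x → ∀ u ∈ ws, I (g x u)) (hws : ∀ u ∈ ws, Sym.sep ∉ u)
    (hbody : ∀ x, I x → ∀ u ∈ ws, ∀ rest, ∃ u', Runs (exec body)
      (St (((β x).set a rest).set w u.reverse)) (St (((β (g x u)).set a rest).set w u')) T)
    (x : α) (hx : I x) :
    Runs (exec (foldWords a w body)) (St (((β x).set a (encW ws)).set w []))
      (St (((β (ws.foldl g x)).set a []).set w [])) (1 + (encW ws).length * (T + 3)) := by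
  set step : Prog := .cases a fun o => match o with
    | some Sym.sep => .seq (.pop a) (.seq body (.clear w))
    | some x => .seq (.push w x) (.pop a)
    | none => .skip with hstep
  have hget : ∀ x (r v : List Sym), (((β x).set a r).set w v).getD a [] = r := by
    intro x r v
    simp [List.getD_eq_getElem?_getD, haw.symm, hlen x]
  have hget' : ∀ x (r v : List Sym), (((β x).set a r).set w v).getD w [] = v := by
    intro x r v
    simp [List.getD_eq_getElem?_getD, hlen x]
  have hset : ∀ x (r v r' : List Sym), (((β x).set a r).set w v).set a r' =
      ((β x).set a r').set w v := by
    intro x r v r'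
    rw [List.set_comm _ _ haw.symm, List.set_set]
  have key1 : ∀ (u v rest : List Sym) (x : α), Sym.sep ∉ u →
      Runs (iter (exec step) u.length) (St (((β x).set a (u ++ rest)).set w v))
        (St (((β x).set a rest).set w (u.reverse ++ v))) (u.length * (T + 3)) := by
    intro u
    induction u with
    | nil => intro v rest x _; simpa using Runs.iter_zero _ _
    | cons s u ih =>
      intro v rest x hs
      have hs' : s ≠ Sym.sep := fun h => hs (by simp [h])
      have h1 := (Runs.stPush (((β x).set a (s :: u ++ rest)).set w v) w s
        (by simp [hlen x])).seq (Runs.stPop _ a (by simp [hlen x]))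
      rw [List.set_set, hget', hget, hset, List.cons_append, List.tail_cons] at h1
      have h2 : Runs (exec step) (St (((β x).set a (s :: u ++ rest)).set w v))
          (St (((β x).set a (u ++ rest)).set w (s :: v))) 3 := by
        refine Spec.cases (T := 2) ?_
        rw [St_apply, hget]
        cases s <;> first | exact absurd rfl hs' | exact h1
      refine Runs.conv (h2.iter_succ (ih (s :: v) rest x (fun h => hs (by simp [h])))) ?_ ?_
      · simp; nlinarith
      · simp
  have key2 : ∀ ws', (∀ u ∈ ws', u ∈ ws) → ∀ x, I x →
      Runs (iter (exec step) (encW ws').length) (St (((β x).set a (encW ws')).set w []))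
        (St (((β (ws'.foldl g x)).set a []).set w [])) ((encW ws').length * (T + 3)) := by
    intro ws'
    induction ws' with
    | nil => intro _ x _; simpa using Runs.iter_zero _ _
    | cons u ws' ih =>
      intro hsub x hx
      have hu := hsub u (by simp)
      have h1 := key1 u [] (Sym.sep :: encW ws') x (hws u hu)
      obtain ⟨u', h2⟩ := hbody x hx u hu (encW ws')
      have h3 := (Runs.stPop (((β x).set a (Sym.sep :: encW ws')).set w (u.reverse ++ [])) a
        (by simp [hlen x]))
      rw [hset, hget, List.tail_cons, List.append_nil] at h3
      have h4 := h3.seq (h2.seq (Runs.stClear _ w (by simp [hlen])))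
      rw [List.set_set] at h4
      have h5 : Runs (exec step) (St (((β x).set a (Sym.sep :: encW ws')).set w u.reverse)) _ _ :=
        Spec.cases (by rw [St_apply, hget]; exact h4)
      have h6 := h5.iter_succ (ih (fun v hv => hsub v (by simp [hv])) (g x u) (hI x hx u hu))
      rw [List.append_nil] at h1
      have h7 := h1.iter_add h6
      rw [show u.length + ((encW ws').length + 1) = (encW (u :: ws')).length by simp] at h7
      rw [encW_cons] at *
      refine h7.mono ?_
      simp
      nlinarith
  refine Spec.loop ?_
  rw [St_apply, hget]
  exact key2 ws (fun _ h => h) x hx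

/-! ### The vote -/

/-- Compare the first symbols of registers 9 and 10, and record a difference in register 11. -/
def compareStep : Prog :=
  .seq (.cases 9 fun o => .cases 10 fun o' =>
    if o = o' then .skip else .seq (.clear 11) (.push 11 .one)) (.seq (.pop 9) (.pop 10))

/-- Increment register 6 if registers 9 and 10 agree. -/
def countIfEq : Prog :=
  .seq (.loop 9 compareStep) (.seq (.cases 10 fun o => match o with
      | none => .skip
      | some _ => .push 11 .one)
    (.seq (.clear 10) (.seq (.cases 11 fun o => match o with
      | none => .push 6 .one
      | some _ => .skip) (.clear 11))))

/-- The flag in register 11 stays empty as long as the symbols read agree; if `y` runs out early,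
its head `none` differs from every symbol. After |x| passes the flag therefore decides whether `x`
is a prefix of `y`, and the rest of `y` remains to be tested. -/
theorem Runs.compareStep (n l b c l1 w k l2 v d : List Sym) :
    ∀ x y f : List Sym, (f = [] ∨ ∃ f', f = Sym.one :: f') →
    ∃ f', (f' = [] ↔ f = [] ∧ x <+: y) ∧
    Runs (iter (exec compareStep) x.length) (St [n, l, b, c, l1, w, k, l2, v, x, y, f, d])
      (St [n, l, b, c, l1, w, k, l2, v, [], y.drop x.length, f', d]) (x.length * 6) := by
  intro x
  induction x with
  | nil =>
    intro y f _
    exact ⟨f, by simp, by simpa using Runs.iter_zero _ _⟩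
  | cons s x ih =>
    intro y f hf
    have h1 : ∃ g, (g = [] ∨ ∃ g', g = Sym.one :: g') ∧ (g = [] ↔ f = [] ∧ y.head? = some s) ∧
        Runs (exec (.cases 9 fun o => .cases 10 fun o' =>
          if o = o' then .skip else .seq (.clear 11) (.push 11 .one)))
          (St [n, l, b, c, l1, w, k, l2, v, s :: x, y, f, d])
          (St [n, l, b, c, l1, w, k, l2, v, s :: x, y, g, d]) 4 := by
      by_cases h : some s = y.head?
      · refine ⟨f, hf, by simp [h], Spec.cases (T := 3) (Spec.cases (T := 2) ?_)⟩
        change Runs (exec (if some s = y.head? then _ else _)) _ _ _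
        rw [if_pos h]
        exact (Runs.skip _).mono (by omega)
      · refine ⟨[Sym.one], by simp, by simp [Ne.symm h], Spec.cases (T := 3)
          (Spec.cases (T := 2) ?_)⟩
        change Runs (exec (if some s = y.head? then _ else _)) _ _ _
        rw [if_neg h]
        exact (Runs.stClear _ _ (by simp)).seq (Runs.stPush _ _ _ (by simp))
    obtain ⟨g, hg, hg', h1⟩ := h1
    have h2 : Runs (exec BotPRG.compareStep) (St [n, l, b, c, l1, w, k, l2, v, s :: x, y, f, d])
        (St [n, l, b, c, l1, w, k, l2, v, x, y.tail, g, d]) 6 :=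
      h1.seq ((Runs.stPop _ _ (by simp)).seq (Runs.stPop _ _ (by simp)))
    obtain ⟨f', hf', h3⟩ := ih y.tail g hg
    refine ⟨f', ?_, ?_⟩
    · rw [hf', hg']
      cases y with
      | nil => simp
      | cons t y => simp [List.cons_prefix_cons, eq_comm, and_assoc]
    · refine Runs.conv (h2.iter_succ h3) (by simp; omega) ?_
      cases y <;> simp

theorem Runs.countIfEq (n l b c l1 w l2 v x y d : List Sym) (k : ℕ) :
    Runs (exec countIfEq)
      (St [n, l, b, c, l1, w, List.replicate k Sym.one, l2, v, x, y, [], d])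
      (St [n, l, b, c, l1, w, List.replicate (if x = y then k + 1 else k) Sym.one, l2, v,
        [], [], [], d]) (x.length * 6 + 7) := by
  obtain ⟨f, hf, h1⟩ := Runs.compareStep n l b c l1 w (List.replicate k Sym.one) l2 v d x y []
    (Or.inl rfl)
  have h2 : Runs (exec (.loop 9 BotPRG.compareStep))
      (St [n, l, b, c, l1, w, List.replicate k Sym.one, l2, v, x, y, [], d])
      (St [n, l, b, c, l1, w, List.replicate k Sym.one, l2, v, [], y.drop x.length, f, d])
      (1 + x.length * 6) := Spec.loop h1
  obtain ⟨g, hg, h3⟩ : ∃ g, (g = [] ↔ x = y) ∧ Runs (exec (.cases 10 fun o => match o with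
      | none => .skip
      | some _ => .push 11 .one))
      (St [n, l, b, c, l1, w, List.replicate k Sym.one, l2, v, [], y.drop x.length, f, d])
      (St [n, l, b, c, l1, w, List.replicate k Sym.one, l2, v, [], y.drop x.length, g, d]) 2 := by
    -- A nonempty remainder means that `y` is longer than `x`. Without a remainder, being a prefix
    -- forces equality by length.
    cases h : y.drop x.length with
    | nil =>
      refine ⟨f, ?_, Spec.cases (T := 1) (Runs.skip _)⟩
      rw [hf]
      rw [List.drop_eq_nil_iff] at h
      constructor
      · rintro ⟨-, h'⟩
        exact h'.eq_of_length_le h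
      · rintro rfl
        simp
    | cons s y' =>
      refine ⟨Sym.one :: f, ?_, Spec.cases (T := 1) (Runs.stPush _ 11 _ (by simp))⟩
      simp only [reduceCtorEq, false_iff]
      rintro rfl
      simp at h
  have h4 : Runs (exec (.cases 11 fun o => match o with
      | none => .push 6 .one
      | some _ => .skip))
      (St [n, l, b, c, l1, w, List.replicate k Sym.one, l2, v, [], [], g, d])
      (St [n, l, b, c, l1, w, List.replicate (if x = y then k + 1 else k) Sym.one, l2, v,
        [], [], g, d]) 2 := by
    cases g with
    | nil =>
      rw [if_pos (hg.1 rfl)]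
      exact Spec.cases (T := 1) (Runs.stPush _ 6 _ (by simp))
    | cons s g =>
      rw [if_neg (by rw [← hg]; simp)]
      exact Spec.cases (T := 1) (Runs.skip _)
  exact Spec.mono (h2.seq (h3.seq ((Runs.stClear _ 10 (by simp)).seq
    (h4.seq (Runs.stClear _ 11 (by simp)))))) (by omega)

/-- Count the occurrences of the word in register 5 in the list in register 1. -/
def countWord : Prog :=
  .seq (.copy 7 1) (foldWords 7 8 (.seq (.copy 9 5) (.seq (.copy 10 8) countIfEq)))

theorem foldl_count {X : Type} [DecidableEq X] [BEq X] [LawfulBEq X] (w : X) (ws : List X) (k : ℕ) :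
    ws.foldl (fun k u => if w = u then k + 1 else k) k = k + ws.count w := by
  induction ws generalizing k with
  | nil => simp
  | cons u ws ih =>
    rw [List.foldl_cons, ih, List.count_cons]
    by_cases h : w = u
    · simp [h]; omega
    · simp [h, Ne.symm h]

theorem Runs.countWord (n b c l1 w : List Sym) (ws : List (List Sym))
    (hws : ∀ u ∈ ws, Sym.sep ∉ u) (hw : w ∈ ws) :
    Runs (exec countWord) (St [n, encW ws, b, c, l1, w.reverse, [], [], [], [], [], [], []])
      (St [n, encW ws, b, c, l1, w.reverse, List.replicate (ws.count w) Sym.one,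
        [], [], [], [], [], []])
      (2 + (encW ws).length + (encW ws).length * (12 + 8 * (encW ws).length)) := by
  have hw' := length_mem_le_encW hw
  have h := Runs.foldWords (a := 7) (w := 8)
    (body := .seq (.copy 9 5) (.seq (.copy 10 8) BotPRG.countIfEq))
    (fun k : ℕ => [n, encW ws, b, c, l1, w.reverse, List.replicate k Sym.one,
      [], [], [], [], [], []])
    (fun k u => if w = u then k + 1 else k) (fun _ => True) (T := 9 + 8 * (encW ws).length)
    (by simp) (by simp) ws (by simp) hws (fun k _ u hu rest => by
      refine ⟨u.reverse, ?_⟩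
      have hu' := length_mem_le_encW hu
      have h2 := Runs.countIfEq n (encW ws) b c l1 w.reverse rest u.reverse w.reverse u.reverse []
        k
      -- The outer and the inner scan both deliver their words reversed, so it suffices to compare
      -- reversals.
      have e : (if w.reverse = u.reverse then k + 1 else k) = if w = u then k + 1 else k := by
        simp [List.reverse_inj]
      rw [e] at h2
      have h3 := (Runs.stCopy [n, encW ws, b, c, l1, w.reverse, List.replicate k Sym.one,
        rest, u.reverse, [], [], [], []] 9 5 (by simp)).seq ((Runs.stCopy _ 10 8 (by simp)).seq h2)
      refine Spec.mono h3 ?_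
      simp
      omega) 0 trivial
  rw [foldl_count, zero_add] at h
  change Runs _ (St [n, encW ws, b, c, l1, w.reverse, [], encW ws, [], [], [], [], []]) _ _ at h
  refine Spec.mono ((Runs.stCopy _ 7 1 (by simp)).seq h) ?_
  simp
  nlinarith

/-- The first most common word of a list (empty if there is none). -/
def voteW (ws : List (List Sym)) : List Sym :=
  (ws.foldl (fun (p : List Sym × ℕ) w => if p.2 < ws.count w then (w, ws.count w) else p)
    ([], 0)).1

/-- Replace the best word and its count (registers 2 and 3) by a more frequent word. -/
def voteUpdate : Prog :=
  .seq (.copy 12 6) (.seq (.copy 9 3) (.seq (.loop 9 (.pop 12)) (.seq (.cases 12 fun o =>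
    match o with
    | none => .skip
    | some _ => .seq (.copy 2 5) (.copy 3 6)) (.seq (.clear 12) (.seq (.clear 9) (.clear 6))))))

theorem Runs.popLoop (f : List Sym → List (List Sym)) (r : ℕ)
    (hr : ∀ w, r < (f w).length) (hf : ∀ w, (f w).getD r [] = w) (hs : ∀ w v, (f w).set r v = f v)
    (k : ℕ) (w : List Sym) :
    Runs (iter (exec (.pop r)) k) (St (f w)) (St (f (w.drop k))) k := by
  have := Runs.iterate (f := exec (.pop r)) (fun w => St (f w)) List.tail (T := 1) (fun _ => True)
    (by simp) (fun w _ => by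
      have := Runs.stPop (f w) r (hr w)
      rwa [hf, hs] at this) k w trivial
  rw [mul_one] at this
  have e : ∀ k (w : List Sym), List.tail^[k] w = w.drop k := by
    intro k
    induction k with
    | zero => simp
    | succ k ih => intro w; rw [Function.iterate_succ_apply, ih, List.drop_tail]
  rwa [e] at this

/-- Unary comparison: popping the new count k once for each symbol of the old count c leaves k - c
symbols (truncated), a nonempty word exactly if c < k. The strict inequality lets the earlier word
win ties. -/
theorem Runs.voteUpdate (n l b l1 w : List Sym) (c k Λ : ℕ) (hc : c ≤ Λ) (hk : k ≤ Λ)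
    (hw : w.length ≤ Λ) :
    Runs (exec voteUpdate) (St [n, l, b, List.replicate c Sym.one, l1, w,
        List.replicate k Sym.one, [], [], [], [], [], []])
      (St [n, l, if c < k then w else b, List.replicate (if c < k then k else c) Sym.one, l1, w,
        [], [], [], [], [], [], []]) (9 + 5 * Λ) := by
  have h1 := Runs.popLoop (fun d => [n, l, b, List.replicate c Sym.one, l1, w,
    List.replicate k Sym.one, [], [], List.replicate c Sym.one, [], [], d]) 12 (by simp) (by simp)
    (by simp) c (List.replicate k Sym.one)
  have h2 : Runs (exec (.loop 9 (.pop 12))) (St [n, l, b, List.replicate c Sym.one, l1, w,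
    List.replicate k Sym.one, [], [], List.replicate c Sym.one, [], [], List.replicate k Sym.one])
    _ (1 + c) := Spec.loop (by simpa using h1)
  have h3 : Runs (exec (.cases 12 fun o =>
      match o with
      | none => .skip
      | some _ => .seq (.copy 2 5) (.copy 3 6))) (St [n, l, b, List.replicate c Sym.one, l1, w,
      List.replicate k Sym.one, [], [], List.replicate c Sym.one, [], [],
        List.replicate (k - c) Sym.one])
      (St [n, l, if c < k then w else b, List.replicate (if c < k then k else c) Sym.one, l1, w,
      List.replicate k Sym.one, [], [], List.replicate c Sym.one, [], [],
        List.replicate (k - c) Sym.one]) (3 + 2 * Λ) := by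
    by_cases h : c < k
    · simp only [if_pos h]
      obtain ⟨j, hj⟩ : ∃ j, k - c = j + 1 := ⟨k - c - 1, by omega⟩
      rw [hj]
      refine Spec.mono (Spec.cases ((Runs.stCopy _ 2 5 (by simp)).seq
        (Runs.stCopy _ 3 6 (by simp)))) ?_
      simp
      omega
    · simp only [if_neg h]
      rw [show k - c = 0 by omega]
      exact Spec.mono (Spec.cases (T := 1) (Runs.skip _)) (by omega)
  refine Spec.mono ((Runs.stCopy _ 12 6 (by simp)).seq ((Runs.stCopy _ 9 3 (by simp)).seq
    (h2.seq (h3.seq ((Runs.stClear _ 12 (by simp)).seq ((Runs.stClear _ 9 (by simp)).seq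
    (Runs.stClear _ 6 (by simp)))))))) ?_
  simp
  omega

/-- The first most common word of the list of words in register 1. -/
def voteProg : Prog :=
  .seq (.copy 4 1) (.seq (foldWords 4 5 (.seq countWord voteUpdate))
    (.seq (moveRev 2 9) (.copy 2 9)))

/-- The running time of the vote. -/
def voteTime (Λ : ℕ) : ℕ := 4 + 5 * Λ + Λ * (14 + 18 * Λ + 8 * Λ * Λ)

theorem voteProg_impl (n : ℕ) (ws : List (List Sym)) (hws : ∀ u ∈ ws, Sym.sep ∉ u) :
    Impl voteProg n (encW ws) (PMF.pure (voteW ws)) (voteTime (encW ws).length) := by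
  set Λ := (encW ws).length with hΛ
  set g : List Sym × ℕ → List Sym → List Sym × ℕ :=
    fun p w => if p.2 < ws.count w then (w, ws.count w) else p with hg
  have hI : ∀ x : List Sym × ℕ, x.1.length ≤ Λ ∧ x.2 ≤ Λ → ∀ u ∈ ws,
      (g x u).1.length ≤ Λ ∧ (g x u).2 ≤ Λ := by
    intro x hx u hu
    have := length_mem_le_encW hu
    have := List.count_le_length (a := u) (l := ws)
    have := length_le_encW ws
    simp only [hg]
    split_ifs
    · exact ⟨by omega, by omega⟩
    · exact hx
  -- The best word so far is stored reversed, as the scan delivers it. `T` is the cost 2 + Λ + Λ(12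
  -- + 8Λ) of `countWord` plus 9 + 5Λ for `voteUpdate`.
  have hfold := Runs.foldWords (a := 4) (w := 5) (body := .seq countWord BotPRG.voteUpdate)
    (fun x : List Sym × ℕ => [List.replicate n Sym.one, encW ws, x.1.reverse,
      List.replicate x.2 Sym.one, [], [], [], [], [], [], [], [], []])
    g (fun x => x.1.length ≤ Λ ∧ x.2 ≤ Λ) (T := 11 + 18 * Λ + 8 * Λ * Λ)
    (by simp) (by simp) ws hI hws (fun x hx u hu rest => by
      refine ⟨u.reverse, ?_⟩
      have h1 := Runs.countWord (List.replicate n Sym.one) x.1.reverse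
        (List.replicate x.2 Sym.one) rest u ws hws hu
      have h2 := Runs.voteUpdate (List.replicate n Sym.one) (encW ws) x.1.reverse rest u.reverse
        x.2 (ws.count u) Λ hx.2 (List.count_le_length.trans (length_le_encW ws))
        (by simpa using length_mem_le_encW hu)
      refine Runs.conv (h1.seq h2) ?_ ?_
      · nlinarith
      · simp only [hg]
        split_ifs <;> rfl) ([], 0) (by simp)
  -- The length of the winner is needed to bound the final reversal and copy, which restore its
  -- reading direction.
  have hI' : ∀ ws' : List (List Sym), (∀ u ∈ ws', u ∈ ws) → ∀ x : List Sym × ℕ, x.1.length ≤ Λ ∧ x.2 ≤ Λ →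
      (ws'.foldl g x).1.length ≤ Λ := by
    intro ws'
    induction ws' with
    | nil => exact fun _ x hx => hx.1
    | cons u ws' ih =>
      exact fun h x hx => ih (fun v hv => h v (by simp [hv])) _ (hI x hx u (h u (by simp)))
  have hlen := hI' ws (fun _ h => h) ([], 0) (by simp)
  have h1 := (Runs.stCopy [List.replicate n Sym.one, encW ws, [], [], [], [], [], [], [], [],
    [], [], []] 4 1 (by simp)).seq (hfold.seq ((Runs.moveRev _ 2 9 (by simp) (by simp)
      (by simp)).seq (Runs.stCopy _ 2 9 (by simp))))
  have h2 : Spec (exec voteProg) (St (List.replicate n Sym.one :: encW ws ::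
    List.replicate 11 [])) _ _ := h1
  have h3 := h2.impl
  rw [PMF.pure_map] at h3
  refine ⟨h3.1.trans ?_, fun s hs => (h3.2 s hs).trans ?_⟩
  · simp [voteW, hg]
  · simp [voteTime, ← hΛ]
    nlinarith

/-! ### Selecting words from a list -/

/-- Append the word whose reversal is in register 3 to the list in register 5. -/
def keepWord : Prog := .seq (moveRev 3 4) (.seq (moveRev 4 5) (.push 5 .sep))

/-- The list in register 5 is kept reversed, so that appending a word becomes pushing it. The detour
through register 4 leaves the word itself reversed there as well. -/
theorem Runs.keepWord (n l o u c : List Sym) (ws : List (List Sym)) :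
    Runs (exec keepWord) (St [n, l, o, u.reverse, [], (encW ws).reverse, c])
      (St [n, l, o, [], [], (encW (ws ++ [u])).reverse, c]) (3 + 6 * u.length) := by
  refine Runs.conv ((Runs.moveRev _ 3 4 (by simp) (by simp) (by simp)).seq
    ((Runs.moveRev _ 4 5 (by simp) (by simp) (by simp)).seq (Runs.stPush _ 5 _ (by simp)))) ?_ ?_
  · simp
    omega
  · simp

/-- Go through the list of words in register 1, deciding with `body` whether to keep them; return
the list of words kept. -/
def selectProg (body : Prog) : Prog :=
  .seq (.copy 6 0) (.seq (foldWords 1 3 body) (moveRev 5 2))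

/-- The state carried by the scan is a unary counter in register 6, starting at n, together with the
words kept so far. `hg` keeps the output no longer than the input, which bounds the concluding
reversal. -/
theorem selectProg_impl {body : Prog} (g : ℕ × List (List Sym) → List Sym → ℕ × List (List Sym))
    (n : ℕ) (ws : List (List Sym)) (hws : ∀ u ∈ ws, Sym.sep ∉ u)
    (hg : ∀ x, ∀ u, (encW (g x u).2).length ≤ (encW x.2).length + u.length + 1)
    (hbody : ∀ x, ∀ u ∈ ws, ∀ rest, ∃ u', Runs (exec body)
      (St [List.replicate n Sym.one, rest, [], u.reverse, [], (encW x.2).reverse,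
        List.replicate x.1 Sym.one])
      (St [List.replicate n Sym.one, rest, [], u', [], (encW (g x u).2).reverse,
        List.replicate (g x u).1 Sym.one]) (6 + 6 * u.length)) :
    Impl (selectProg body) n (encW ws) (PMF.pure (encW (ws.foldl g (n, [])).2))
      (3 + n + (encW ws).length * (12 + 6 * (encW ws).length)) := by
  have h := Runs.foldWords (a := 1) (w := 3) (body := body)
    (fun x : ℕ × List (List Sym) => [List.replicate n Sym.one, [], [], [], [],
      (encW x.2).reverse, List.replicate x.1 Sym.one]) g (fun _ => True)
      (T := 6 + 6 * (encW ws).length) (by simp) (by simp) ws (by simp) hws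
      (fun x _ u hu rest => by
        obtain ⟨u', h⟩ := hbody x u hu rest
        exact ⟨u', Spec.mono h (by have := length_mem_le_encW hu; omega)⟩) (n, []) trivial
  have hlen : ∀ ws' x, (encW (ws'.foldl g x).2).length ≤ (encW x.2).length + (encW ws').length := by
    intro ws'
    induction ws' with
    | nil => simp
    | cons u ws' ih =>
      intro x
      have h1 := ih (g x u)
      have h2 := hg x u
      rw [encW_cons, List.length_append, List.length_cons, List.foldl_cons]
      omega
  have h1 := (Runs.stCopy [List.replicate n Sym.one, encW ws, [], [], [], [], []] 6 0
    (by simp)).seq (h.seq (Runs.moveRev _ 5 2 (by simp) (by simp) (by simp)))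
  have h2 : Spec (exec (selectProg body)) (St (List.replicate n Sym.one :: encW ws ::
    List.replicate 5 [])) _ _ := h1
  have h3 := h2.impl
  rw [PMF.pure_map] at h3
  refine ⟨h3.1.trans (by simp), fun s hs => (h3.2 s hs).trans ?_⟩
  have := hlen ws (n, [])
  simp at this ⊢
  nlinarith

/-- Remove the words ending in `⊥`. -/
def filterProg : Prog := selectProg (.cases 3 fun o => match o with
  | some .bot => .skip
  | _ => keepWord)

theorem filterProg_impl (n : ℕ) (ws : List (List Sym)) (hws : ∀ u ∈ ws, Sym.sep ∉ u) :
    Impl filterProg n (encW ws)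
      (PMF.pure (encW (ws.filter fun u => u.reverse.head? ≠ some Sym.bot)))
      (3 + n + (encW ws).length * (12 + 6 * (encW ws).length)) := by
  have h := selectProg_impl (body := .cases 3 fun o => match o with
      | some .bot => .skip
      | _ => keepWord)
    (fun x u => (x.1, if u.reverse.head? = some Sym.bot then x.2 else x.2 ++ [u])) n ws hws
    (by
      intro x u
      dsimp only
      split_ifs <;> (try simp) <;> omega)
    (by
      intro x u _ rest
      dsimp only
      by_cases h : u.reverse.head? = some Sym.bot
      · refine ⟨u.reverse, Spec.mono (Spec.cases (T := 1) ?_) (by omega)⟩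
        rw [if_pos h]
        change Runs (exec (match u.reverse.head? with
          | some .bot => .skip
          | _ => keepWord)) _ _ _
        rw [h]
        exact Runs.skip _
      · refine ⟨[], Spec.mono (Spec.cases (T := 3 + 6 * u.length) ?_) (by omega)⟩
        rw [if_neg h]
        change Runs (exec (match u.reverse.head? with
          | some .bot => .skip
          | _ => keepWord)) _ _ _
        have := Runs.keepWord (List.replicate n Sym.one) rest [] u (List.replicate x.1 Sym.one) x.2
        rcases h' : u.reverse.head? with _ | _ | _ | _ | _ <;>
          first | exact absurd h' h | exact this)
  have e : ∀ (ws' : List (List Sym)) (x : ℕ × List (List Sym)), (List.foldl (fun (x : ℕ × List (List Sym)) u =>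
      (x.1, if u.reverse.head? = some Sym.bot then x.2 else x.2 ++ [u])) x ws').2 =
      x.2 ++ ws'.filter fun u => u.reverse.head? ≠ some Sym.bot := by
    intro ws'
    induction ws' with
    | nil => simp
    | cons u ws' ih =>
      intro x
      rw [List.foldl_cons, ih, List.filter_cons]
      dsimp only
      by_cases h : u.reverse.head? = some Sym.bot
      · rw [if_pos h, if_neg (by simp [h])]
      · rw [if_neg h, if_pos (by simpa using h)]
        simp
  rw [e] at h
  exact h

/-- The first `n` words. -/
def takeProg : Prog := selectProg (.cases 6 fun o => match o with
  | none => .skip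
  | some _ => .seq (.pop 6) keepWord)

theorem takeProg_impl (n : ℕ) (ws : List (List Sym)) (hws : ∀ u ∈ ws, Sym.sep ∉ u) :
    Impl takeProg n (encW ws) (PMF.pure (encW (ws.take n)))
      (3 + n + (encW ws).length * (12 + 6 * (encW ws).length)) := by
  have h := selectProg_impl (body := .cases 6 fun o => match o with
      | none => .skip
      | some _ => .seq (.pop 6) keepWord)
    (fun x u => (x.1 - 1, if x.1 = 0 then x.2 else x.2 ++ [u])) n ws hws
    (by
      intro x u
      dsimp only
      split_ifs <;> (try simp) <;> omega)
    (by
      rintro ⟨k, r⟩ u _ rest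
      dsimp only
      cases k with
      | zero => exact ⟨u.reverse, Spec.mono (Spec.cases (T := 1) (Runs.skip _)) (by omega)⟩
      | succ k =>
        refine ⟨[], Spec.mono (Spec.cases ((Runs.stPop _ 6 (by simp)).seq
          (Runs.keepWord _ _ _ _ _ _))) (by omega)⟩)
  have e : ∀ (ws' : List (List Sym)) (x : ℕ × List (List Sym)), (List.foldl (fun (x : ℕ × List (List Sym)) u =>
      (x.1 - 1, if x.1 = 0 then x.2 else x.2 ++ [u])) x ws').2 = x.2 ++ ws'.take x.1 := by
    intro ws'
    induction ws' with
    | nil => simp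
    | cons u ws' ih =>
      rintro ⟨k, r⟩
      rw [List.foldl_cons, ih]
      cases k <;> simp
  rw [e] at h
  exact h

/-- All but the first `n` words. -/
def dropProg : Prog := selectProg (.cases 6 fun o => match o with
  | none => keepWord
  | some _ => .pop 6)

theorem dropProg_impl (n : ℕ) (ws : List (List Sym)) (hws : ∀ u ∈ ws, Sym.sep ∉ u) :
    Impl dropProg n (encW ws) (PMF.pure (encW (ws.drop n)))
      (3 + n + (encW ws).length * (12 + 6 * (encW ws).length)) := by
  have h := selectProg_impl (body := .cases 6 fun o => match o with
      | none => keepWord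
      | some _ => .pop 6)
    (fun x u => (x.1 - 1, if x.1 = 0 then x.2 ++ [u] else x.2)) n ws hws
    (by
      intro x u
      dsimp only
      split_ifs <;> (try simp) <;> omega)
    (by
      rintro ⟨k, r⟩ u _ rest
      dsimp only
      cases k with
      | zero =>
        exact ⟨[], Spec.mono (Spec.cases (Runs.keepWord _ _ _ _ [] _)) (by omega)⟩
      | succ k =>
        exact ⟨u.reverse, Spec.mono (Spec.cases (T := 1) (Runs.stPop _ 6 (by simp))) (by omega)⟩)
  have e : ∀ (ws' : List (List Sym)) (x : ℕ × List (List Sym)), (List.foldl (fun (x : ℕ × List (List Sym)) u =>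
      (x.1 - 1, if x.1 = 0 then x.2 ++ [u] else x.2)) x ws').2 = x.2 ++ ws'.drop x.1 := by
    intro ws'
    induction ws' with
    | nil => simp
    | cons u ws' ih =>
      rintro ⟨k, r⟩
      rw [List.foldl_cons, ih]
      cases k <;> simp
  rw [e] at h
  exact h

section

/-! ### Polynomial bounds -/

/-- Bounded by a polynomial. -/
def PolyBdd (T : ℕ → ℕ) : Prop := ∃ p : Polynomial ℕ, ∀ n, T n ≤ p.eval n

theorem PolyBdd.mono {S T : ℕ → ℕ} (hT : PolyBdd T) (h : ∀ n, S n ≤ T n) : PolyBdd S := by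
  obtain ⟨p, hp⟩ := hT
  exact ⟨p, fun n => (h n).trans (hp n)⟩

theorem PolyBdd.const (c : ℕ) : PolyBdd fun _ => c := ⟨Polynomial.C c, by simp⟩

theorem PolyBdd.id : PolyBdd fun n => n := ⟨Polynomial.X, by simp⟩

theorem PolyBdd.eval (p : Polynomial ℕ) : PolyBdd fun n => p.eval n := ⟨p, fun _ => le_rfl⟩

theorem PolyBdd.add {S T : ℕ → ℕ} (hS : PolyBdd S) (hT : PolyBdd T) :
    PolyBdd fun n => S n + T n := by
  obtain ⟨p, hp⟩ := hS
  obtain ⟨q, hq⟩ := hT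
  exact ⟨p + q, fun n => by rw [Polynomial.eval_add]; exact add_le_add (hp n) (hq n)⟩

theorem PolyBdd.mul {S T : ℕ → ℕ} (hS : PolyBdd S) (hT : PolyBdd T) :
    PolyBdd fun n => S n * T n := by
  obtain ⟨p, hp⟩ := hS
  obtain ⟨q, hq⟩ := hT
  exact ⟨p * q, fun n => by rw [Polynomial.eval_mul]; exact Nat.mul_le_mul (hp n) (hq n)⟩

theorem Impl.mono {P : Prog} {n : ℕ} {w : List Sym} {D : PMF (List Sym)} {T T' : ℕ}
    (h : Impl P n w D T) (hT : T ≤ T') : Impl P n w D T' :=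
  ⟨h.1, fun s hs => (h.2 s hs).trans hT⟩

open Enc in
-- Running times may now be arbitrary functions with a polynomial upper bound, so programs can be
-- combined without exhibiting a polynomial each time.
theorem isQPT_iff {X Y : ℕ → Type} [∀ n, Enc (X n)] [∀ n, Enc (Y n)]
    {f : ∀ n, X n → PMF (Y n)} : IsQPT f ↔ ∃ (P : Prog) (T : ℕ → ℕ), PolyBdd T ∧
      ∀ n x, Impl P n (enc x) ((f n x).map enc) (T n) := by
  constructor
  · rintro ⟨P, p, h⟩
    exact ⟨P, _, PolyBdd.eval p, h⟩
  · rintro ⟨P, T, ⟨p, hp⟩, h⟩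
    exact ⟨P, p, fun n x => (h n x).mono (hp n)⟩

/-! ### Encodings -/

open Enc

theorem bitSym_ne_bot (b : Bool) : bitSym b ≠ Sym.bot := by cases b <;> simp [bitSym]

theorem bitSym_ne_sep (b : Bool) : bitSym b ≠ Sym.sep := by cases b <;> simp [bitSym]

theorem bitSym_injective : Function.Injective bitSym := by
  intro a b
  cases a <;> cases b <;> simp [bitSym]

theorem enc_bits {n : ℕ} (x : Bits n) : enc x = (List.ofFn x).map bitSym := rfl

theorem enc_none {n : ℕ} : enc (none : Option (Bits n)) = [Sym.bot] := rfl

theorem enc_some {n : ℕ} (x : Bits n) : enc (some x) = enc x := rfl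

theorem enc_zero (n : ℕ) : enc (fun _ => false : Bits n) = List.replicate n Sym.zero := by
  simp [enc_bits, List.ofFn_const, bitSym]

@[simp] theorem length_enc_bits {n : ℕ} (x : Bits n) : (enc x).length = n := by simp [enc_bits]

theorem length_enc_option {n : ℕ} (x : Option (Bits n)) : (enc x).length ≤ n + 1 := by
  cases x
  · simp [enc_none]
  · simp [enc_some]

theorem enc_bits_injective (n : ℕ) : Function.Injective (enc : Bits n → List Sym) :=
  (List.map_injective_iff.2 bitSym_injective).comp List.ofFn_injective

theorem bot_notMem_enc {n : ℕ} (x : Bits n) : Sym.bot ∉ enc x := by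
  simp [enc_bits, bitSym_ne_bot]

theorem enc_option_injective (n : ℕ) : Function.Injective (enc : Option (Bits n) → List Sym) := by
  rintro (_ | x) (_ | y) h
  · rfl
  · rw [enc_none, enc_some] at h
    exact absurd (h ▸ List.mem_singleton_self _) (bot_notMem_enc y)
  · rw [enc_none, enc_some] at h
    exact absurd (h ▸ List.mem_singleton_self _) (bot_notMem_enc x)
  · rw [enc_some, enc_some] at h
    rw [enc_bits_injective n h]

theorem sep_notMem_enc {n : ℕ} (x : Option (Bits n)) : Sym.sep ∉ enc x := by
  cases x
  · simp [enc_none]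
  · simp [enc_some, enc_bits, bitSym_ne_sep]

theorem sep_notMem_map_enc {n : ℕ} (l : List (Option (Bits n))) : ∀ u ∈ l.map enc, Sym.sep ∉ u := by
  intro u hu
  obtain ⟨x, -, rfl⟩ := List.mem_map.1 hu
  exact sep_notMem_enc x

theorem enc_tuple {q n : ℕ} (y : Fin q → Option (Bits n)) :
    enc y = encW ((List.ofFn y).map enc) := by
  rw [encW, List.flatMap_map]
  rfl

theorem length_encW_enc {n : ℕ} (l : List (Option (Bits n))) :
    (encW (l.map enc)).length ≤ l.length * (n + 2) := by
  induction l with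
  | nil => simp
  | cons x l ih =>
    have := length_enc_option x
    simp only [List.map_cons, encW_cons, List.length_append, List.length_cons]
    nlinarith

theorem enc_head_bot {n : ℕ} (x : Option (Bits n)) : (enc x).head? = some Sym.bot ↔ x = none := by
  cases x with
  | none => simp [enc_none]
  | some x =>
    simp only [enc_some, reduceCtorEq, iff_false]
    intro h
    exact bot_notMem_enc x (List.mem_of_mem_head? h)

theorem enc_reverse_head_bot {n : ℕ} (x : Option (Bits n)) :
    (enc x).reverse.head? = some Sym.bot ↔ x = none := by
  cases x with
  | none => simp [enc_none]
  | some x =>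
    simp only [enc_some, reduceCtorEq, iff_false]
    intro h
    exact bot_notMem_enc x (List.mem_reverse.1 (List.mem_of_mem_head? h))

/-- Encoded bit strings never contain the symbol for ⊥, while ⊥ is encoded by this symbol alone; so
the last symbol tells them apart. -/
theorem filter_map_enc {n : ℕ} (l : List (Option (Bits n))) :
    (l.map enc).filter (fun u => u.reverse.head? ≠ some Sym.bot) = l.reduceOption.map enc := by
  induction l with
  | nil => rfl
  | cons x l ih =>
    rw [List.map_cons, List.filter_cons, ih]
    cases x with
    | none => simp [enc_none]
    | some x =>
      rw [if_pos (by
        rw [decide_eq_true_iff]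
        exact fun h => nomatch (enc_reverse_head_bot (some x)).1 h)]
      rfl

/-- The folds behind `voteW` and `List.argmax` decide alike at every step: counts agree because `e`
is injective, and both replace the candidate only on a strict increase. The start value `([], 0)`
acts as `none`, since each word of the list has positive count and thus displaces it. -/
theorem voteW_map {X : Type} [DecidableEq X] {e : X → List Sym} (he : Function.Injective e)
    (l : List X) : voteW (l.map e) = (vote l).elim [] e := by
  have hc : ∀ x, (l.map e).count (e x) = l.count x := fun x => by
    rw [List.count_map_of_injective _ _ he]
  set f : Option X → List Sym × ℕ := fun o => o.elim ([], 0) fun x => (e x, l.count x) with hf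
  have key : ∀ l' : List X, (∀ x ∈ l', x ∈ l) → ∀ o,
      (l'.map e).foldl (fun (p : List Sym × ℕ) w =>
        if p.2 < (l.map e).count w then (w, (l.map e).count w) else p) (f o) =
      f (l'.foldl (List.argAux fun b c => l.count c < l.count b) o) := by
    intro l'
    induction l' with
    | nil => intro _ o; rfl
    | cons x l' ih =>
      intro h o
      rw [List.map_cons, List.foldl_cons, List.foldl_cons,
        ← ih (fun y hy => h y (List.mem_cons_of_mem _ hy))]
      congr 1
      rw [hc]
      have hx : 0 < l.count x := List.count_pos_iff.2 (h x (by simp))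
      cases o with
      | none => simp [hf, List.argAux, hx]
      | some c =>
        simp only [hf, List.argAux, Option.elim_some]
        split_ifs <;> rfl
  have := key l (fun _ h => h) none
  have h1 : vote l = l.foldl (List.argAux fun b c => l.count c < l.count b) none := rfl
  have h2 : voteW (l.map e) = _ := congrArg Prod.fst this
  rw [h2, h1]
  generalize List.foldl _ none l = o
  cases o <;> rfl

theorem voteW_enc_head_bot {n : ℕ} (l : List (Option (Bits n))) :
    (voteW (l.map enc)).head? = some Sym.bot ↔ vote l = some none := by
  rw [voteW_map (enc_option_injective n)]
  cases vote l with
  | none => simp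
  | some x => simp [enc_head_bot]

/-! ### Independent samples -/

theorem iter_append_iid {X : Type} (p : PMF X) (k : ℕ) (l : List X) :
    iter (fun l => p.map fun a => l ++ [a]) k l = (iid p k).map fun y => l ++ List.ofFn y := by
  induction k generalizing l with
  | zero => simp [iter, iid, PMF.pure_map]
  | succ k ih =>
    simp only [iter, iid, PMF.bind_map, PMF.map_bind, PMF.map_comp]
    congr 1
    funext a
    simp only [Function.comp_apply, ih]
    congr 1
    funext y
    simp [List.ofFn_succ]

theorem iter_cons_iid {X : Type} (p : PMF X) (k : ℕ) (l : List X) :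
    iter (fun l => p.map fun a => a :: l) k l =
      (iid p k).map fun y => (List.ofFn y).reverse ++ l := by
  induction k generalizing l with
  | zero => simp [iter, iid, PMF.pure_map]
  | succ k ih =>
    simp only [iter, iid, PMF.bind_map, PMF.map_bind, PMF.map_comp]
    congr 1
    funext a
    simp only [Function.comp_apply, ih]
    congr 1
    funext y
    simp [List.ofFn_succ]

theorem iid_apply {X : Type} (p : PMF X) (k : ℕ) (y : Fin k → X) : iid p k y = ∏ i, p (y i) := by
  induction k with
  | zero => simp [iid, Subsingleton.elim y Fin.elim0]
  | succ k ih =>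
    rw [Fin.prod_univ_succ, iid, PMF.bind_apply, tsum_eq_single (y 0)]
    · congr 1
      rw [PMF.map_apply, tsum_eq_single (Fin.tail y)]
      · rw [if_pos (Fin.cons_self_tail y).symm, ih]
        rfl
      · intro z hz
        rw [if_neg]
        intro h
        exact hz (by rw [h, Fin.tail_cons])
    · intro a ha
      rw [PMF.map_apply, ENNReal.tsum_eq_zero.2, mul_zero]
      intro z
      rw [if_neg]
      intro h
      exact ha (by rw [h, Fin.cons_zero])

theorem mem_support_iid {X : Type} {p : PMF X} {k : ℕ} {y : Fin k → X}
    (hy : y ∈ (iid p k).support) (i : Fin k) : y i ∈ p.support := by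
  rw [PMF.mem_support_iff, iid_apply, Finset.prod_ne_zero_iff] at hy
  exact (PMF.mem_support_iff _ _).2 (hy i (Finset.mem_univ i))

theorem iid_uniform (n : ℕ) : iid (PMF.uniformOfFintype Bool) n = uniform n := by
  ext y
  rw [iid_apply]
  simp [uniform, ENNReal.inv_pow]

end

section

open Enc

/-! ### Composite programs -/

theorem Runs.pushLoop (f : List Sym → List (List Sym)) (r : ℕ) (a : Sym)
    (hr : ∀ w, r < (f w).length) (hf : ∀ w, (f w).getD r [] = w) (hs : ∀ w v, (f w).set r v = f v)
    (k : ℕ) (w : List Sym) :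
    Runs (iter (exec (.push r a)) k) (St (f w)) (St (f (List.replicate k a ++ w))) k := by
  have := Runs.iterate (f := exec (.push r a)) (fun w => St (f w)) (List.cons a) (T := 1)
    (fun _ => True) (by simp) (fun w _ => by
      have := Runs.stPush (f w) r a (hr w)
      rwa [hf, hs] at this) k w trivial
  rw [mul_one] at this
  have e : ∀ k (w : List Sym), (List.cons a)^[k] w = List.replicate k a ++ w := by
    intro k
    induction k with
    | zero => simp
    | succ k ih => intro w; rw [Function.iterate_succ_apply', ih]; rfl
  rwa [e] at this

/-- The intermediate string has length at most n + |w| + T by `Impl.length_le`; this is what the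
second call has to copy. -/
theorem exists_comp (P P' : Prog) : ∃ (Q : Prog) (c : ℕ), ∀ (n : ℕ) (w : List Sym) {α : Type}
    (p : PMF α) (e : α → List Sym) (F : α → PMF (List Sym)) (T T' : ℕ), Impl P n w (p.map e) T →
    (∀ a ∈ p.support, Impl P' n (e a) (F a) T') →
    Impl Q n w (p.bind F) (c + 6 * (n + w.length + T + T')) := by
  obtain ⟨N, hN⟩ := exists_call P
  obtain ⟨N', hN'⟩ := exists_call P'
  refine ⟨.seq (call 4 N P 1 3) (call 4 N' P' 3 2), 10 + N + N', ?_⟩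
  intro n w α p e F T T' h h'
  have h1 := hN 4 1 3 [List.replicate n Sym.one, w, [], []] n _ T rfl rfl (by simp) (by simp) h
  rw [PMF.map_comp] at h1
  have h2 := Spec.seqMap (T' := 5 + N' + 2 * (n + (n + w.length + T) + T')) h1
    (fun a ha => (hN' 4 3 2 [List.replicate n Sym.one, w, [], e a] n _ T' rfl rfl (by simp)
      (by simp) (h' a ha)).mono (by
        have := h.length_le (e a) ((PMF.mem_support_map_iff _ _ _).2 ⟨a, ha, rfl⟩)
        simp only [List.getD_cons_succ, List.getD_cons_zero]
        omega))
  have h3 := Spec.impl (j := 2) h2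
  simp only [PMF.map_bind, PMF.map_comp, Function.comp_def] at h3
  have h4 : (p.bind fun a => PMF.map
      (fun x => St ([List.replicate n Sym.one, w, [], e a].set 2 x) 2) (F a)) = p.bind F :=
    PMF.bind_congr fun a _ => PMF.map_id (F a)
  rw [h4] at h3
  refine h3.mono ?_
  simp only [List.getD_cons_succ, List.getD_cons_zero]
  omega

/-- Each of the n calls starts with an empty work area and fresh qubits, so the samples are
independent. The program `Q` is fixed before the bounds `ℓ` and `T`. -/
theorem exists_collect (P : Prog) : ∃ Q : Prog, ∀ ℓ T : ℕ → ℕ, PolyBdd ℓ → PolyBdd T →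
    ∃ T' : ℕ → ℕ, PolyBdd T' ∧ ∀ (n : ℕ) (w : List Sym) {α : Type} (p : PMF α) (e : α → List Sym),
      w.length ≤ ℓ n → Impl P n w (p.map e) (T n) →
      Impl Q n w ((iid p n).map fun y => encW ((List.ofFn y).map e)) (T' n) := by
  obtain ⟨N, hN⟩ := exists_call P
  refine ⟨.seq (.loop 0 (.seq (call 5 N P 1 3) (.seq (moveRev 3 4) (.push 4 .sep))))
    (moveRev 4 2), fun ℓ T hℓ hT => ?_⟩
  refine ⟨fun n => (1 + n * (7 + N + 5 * (n + ℓ n + T n))) +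
    (1 + n * (n + ℓ n + T n + 1) * 3), ?_, ?_⟩
  · repeat' first
      | assumption
      | exact PolyBdd.id
      | exact PolyBdd.const _
      | refine PolyBdd.add ?_ ?_
      | refine PolyBdd.mul ?_ ?_
  intro n w α p e hw h
  have hlen : ∀ a ∈ p.support, (e a).length ≤ n + ℓ n + T n := fun a ha =>
    (h.length_le (e a) ((PMF.mem_support_map_iff _ _ _).2 ⟨a, ha, rfl⟩)).trans (by omega)
  have hbody : ∀ l : List α,
      Spec (exec (.seq (call 5 N P 1 3) (.seq (moveRev 3 4) (.push 4 .sep))))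
        (St [List.replicate n Sym.one, w, [], [], (encW (l.map e)).reverse])
        ((p.map fun a => l ++ [a]).map fun l =>
          St [List.replicate n Sym.one, w, [], [], (encW (l.map e)).reverse])
        (7 + N + 5 * (n + ℓ n + T n)) := by
    intro l
    have h1 := hN 5 1 3 [List.replicate n Sym.one, w, [], [], (encW (l.map e)).reverse] n _ (T n)
      rfl rfl (by simp) (by simp) h
    rw [PMF.map_comp] at h1
    have h2 := Spec.seqMap (T' := 2 + 3 * (n + ℓ n + T n)) (Q := .seq (moveRev 3 4) (.push 4 .sep))
      (F := fun a => PMF.pure (St [List.replicate n Sym.one, w, [], [],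
        (encW ((l ++ [a]).map e)).reverse])) h1 (fun a ha => by
        refine Runs.conv ((Runs.moveRev [List.replicate n Sym.one, w, [], e a,
          (encW (l.map e)).reverse] 3 4 (by simp) (by simp) (by simp)).seq
          (Runs.stPush _ 4 _ (by simp))) ?_ ?_
        · have := hlen a ha
          simp
          omega
        · simp)
    rw [PMF.map_comp]
    exact h2.mono (by
      simp only [List.getD_cons_succ, List.getD_cons_zero]
      omega)
  have h1 := Spec.loop (r := 0) (σ := St [List.replicate n Sym.one, w, [], [], []]) (Spec.iterate (fun l : List α =>
    St [List.replicate n Sym.one, w, [], [], (encW (l.map e)).reverse]) _ hbody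
    (List.replicate n Sym.one).length [])
  rw [iter_append_iid, PMF.map_comp, List.length_replicate] at h1
  have h2 := Spec.seqMap (T' := 1 + n * (n + ℓ n + T n + 1) * 3) (Q := moveRev 4 2) h1
    (F := fun y => PMF.pure (St [List.replicate n Sym.one, w, encW ((List.ofFn y).map e), [], []]))
    (fun y hy => by
      refine Runs.conv (Runs.moveRev [List.replicate n Sym.one, w, [], [],
        (encW ((List.ofFn y).map e)).reverse] 4 2 (by simp) (by simp) (by simp)) ?_ (by simp)
      have : (encW ((List.ofFn y).map e)).length ≤ n * (n + ℓ n + T n + 1) := by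
        have h5 : ∀ l : List α, (∀ a ∈ l, a ∈ p.support) →
            (encW (l.map e)).length ≤ l.length * (n + ℓ n + T n + 1) := by
          intro l
          induction l with
          | nil => simp
          | cons a l ih =>
            intro hl
            have := ih fun b hb => hl b (List.mem_cons_of_mem _ hb)
            have := hlen a (hl a (by simp))
            simp only [List.map_cons, encW_cons, List.length_append, List.length_cons]
            nlinarith
        have h6 := h5 (List.ofFn y) (by
          intro a ha
          obtain ⟨i, rfl⟩ := (List.mem_ofFn' _ _).1 ha
          exact mem_support_iid hy i)
        rwa [List.length_ofFn] at h6
      simp only [List.getD_cons_succ, List.getD_cons_zero, List.length_reverse]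
      omega)
  have h3 := Spec.impl (j := 3) h2
  refine ⟨h3.1.trans ?_, h3.2⟩
  rw [PMF.map_bind]
  simp only [PMF.pure_map]
  rfl

theorem IsPolyLength.impl {m : ℕ → ℕ} (hm : IsPolyLength m) : ∃ (M : Prog) (T : ℕ → ℕ),
    PolyBdd T ∧ ∀ n, Impl M n [] (PMF.pure (List.replicate (m n) Sym.one)) (T n) := by
  obtain ⟨M, T, hT, h⟩ := isQPT_iff.1 hm
  refine ⟨M, T, hT, fun n => ?_⟩
  have := h n ()
  rwa [PMF.pure_map] at this

theorem IsPolyLength.polyBdd {m : ℕ → ℕ} (hm : IsPolyLength m) : PolyBdd m := by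
  obtain ⟨M, T, hT, h⟩ := hm.impl
  refine (PolyBdd.id.add hT).mono fun n => ?_
  have := (h n).length_le _ ((PMF.mem_support_pure_iff _ _).2 rfl)
  simpa using this

theorem voteTime_mono {a b : ℕ} (h : a ≤ b) : voteTime a ≤ voteTime b := by
  unfold voteTime
  gcongr

theorem length_reduceOption_encW {n : ℕ} (l : List (Option (Bits n))) :
    (encW (l.reduceOption.map enc)).length ≤ l.length * (n + 2) := by
  have h := length_encW_enc (l.reduceOption.map some)
  rw [List.map_map] at h
  refine h.trans (Nat.mul_le_mul_right _ ?_)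
  rw [List.length_map]
  exact List.reduceOption_length_le l

/-- An empty vote register signals that all samples were ⊥; this is unambiguous because `hpos` makes
every encoded value nonempty. In that case 1^m is computed and traded for m zeros, the default
output. -/
theorem exists_pick {m : ℕ → ℕ} (hm : IsPolyLength m) (hpos : ∀ n, 0 < m n) :
    ∃ Q : Prog, ∀ ℓ, PolyBdd ℓ → ∃ T, PolyBdd T ∧ ∀ n (l : List (Option (Bits (m n)))),
      l.length ≤ ℓ n → Impl Q n (encW (l.map enc))
        (PMF.pure (enc ((vote l.reduceOption).getD fun _ => false))) (T n) := by
  have hmP := hm.polyBdd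
  obtain ⟨M, S, hS, hM⟩ := hm.impl
  obtain ⟨N, hN⟩ := exists_call filterProg
  obtain ⟨N', hN'⟩ := exists_call voteProg
  obtain ⟨N'', hN''⟩ := exists_call M
  refine ⟨.seq (call 7 N filterProg 1 3) (.seq (call 7 N' voteProg 3 4)
    (.cases 4 fun o => match o with
      | none => .seq (call 7 N'' M 5 6) (.loop 6 (.push 2 .zero))
      | some _ => .copy 2 4)), fun ℓ hℓ => ?_⟩
  let Λ : ℕ → ℕ := fun n => ℓ n * (m n + 2)
  have hΛ : PolyBdd Λ := hℓ.mul (hmP.add (PolyBdd.const 2))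
  refine ⟨fun n => (5 + N + 2 * (n + Λ n + (3 + n + Λ n * (12 + 6 * Λ n)))) +
    ((5 + N' + 2 * (n + Λ n + (4 + 5 * Λ n + Λ n * (14 + 18 * Λ n + 8 * Λ n * Λ n)))) +
    (1 + ((5 + N'' + 2 * (n + S n)) + (1 + m n)))), ?_, ?_⟩
  · repeat' first
      | assumption
      | exact PolyBdd.id
      | exact PolyBdd.const _
      | refine PolyBdd.add ?_ ?_
      | refine PolyBdd.mul ?_ ?_
  intro n l hl
  have hl1 : (encW (l.map enc)).length ≤ Λ n :=
    (length_encW_enc l).trans (Nat.mul_le_mul_right _ hl)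
  have hl2 : (encW (l.reduceOption.map enc)).length ≤ Λ n :=
    (length_reduceOption_encW l).trans (Nat.mul_le_mul_right _ hl)
  have hsep := sep_notMem_map_enc l
  have hsep' : ∀ u ∈ l.reduceOption.map enc, Sym.sep ∉ u := by
    intro u hu
    rw [← filter_map_enc] at hu
    exact hsep u (List.mem_of_mem_filter hu)
  have i1 := filterProg_impl n _ hsep
  rw [filter_map_enc] at i1
  have h1 := hN 7 1 3 [List.replicate n Sym.one, encW (l.map enc), [], [], [], [], []] n _ _ rfl rfl
    (by simp) (by simp) i1
  have i2 := voteProg_impl n _ hsep'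
  have h2 := hN' 7 3 4 [List.replicate n Sym.one, encW (l.map enc), [],
    encW (l.reduceOption.map enc), [], [], []] n _ _ rfl rfl (by simp) (by simp) i2
  rw [PMF.pure_map] at h1 h2
  have h3 : ∃ v, Runs (exec (.cases 4 fun o => match o with
      | none => .seq (call 7 N'' M 5 6) (.loop 6 (.push 2 .zero))
      | some _ => .copy 2 4))
      (St [List.replicate n Sym.one, encW (l.map enc), [],
        encW (l.reduceOption.map enc), voteW (l.reduceOption.map enc), [], []])
      (St [List.replicate n Sym.one, encW (l.map enc),
        enc ((vote l.reduceOption).getD fun _ => false),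
        encW (l.reduceOption.map enc), voteW (l.reduceOption.map enc), [], v])
      (1 + ((5 + N'' + 2 * (n + S n)) + (1 + m n))) := by
    rw [voteW_map (enc_bits_injective (m n))]
    cases hv : vote l.reduceOption with
    | none =>
      simp only [Option.elim_none, Option.getD_none]
      refine ⟨List.replicate (m n) Sym.one, Spec.cases ?_⟩
      have h4 := hN'' 7 5 6 [List.replicate n Sym.one, encW (l.map enc), [],
        encW (l.reduceOption.map enc), [], [], []] n _ _ rfl rfl (by simp) (by simp) (hM n)
      rw [PMF.pure_map] at h4
      refine Spec.mono (Runs.seq h4 (Spec.loop (T := m n) ?_)) (by simp)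
      have h5 := Runs.pushLoop (fun x => [List.replicate n Sym.one, encW (l.map enc), x,
        encW (l.reduceOption.map enc), [], [], List.replicate (m n) Sym.one]) 2 Sym.zero
        (by simp) (by simp) (by simp) (List.replicate (m n) Sym.one).length []
      rw [List.append_nil, List.length_replicate] at h5
      rw [enc_zero]
      simpa using h5
    | some y =>
      simp only [Option.elim_some, Option.getD_some]
      refine ⟨[], Spec.mono (Spec.cases (T := 1 + m n) ?_) (by omega)⟩
      have hne : ∃ s u, enc y = s :: u := by
        cases h : enc y with
        | nil =>
          have := length_enc_bits y
          have := hpos n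
          simp_all
        | cons s u => exact ⟨s, u, rfl⟩
      obtain ⟨s, u, hsu⟩ := hne
      have hc := Runs.stCopy [List.replicate n Sym.one, encW (l.map enc), [],
        encW (l.reduceOption.map enc), enc y, [], []] 2 4 (by simp)
      have hlen : 1 + m n = 1 + (enc y).length := by rw [length_enc_bits]
      rw [hlen]
      rw [hsu] at hc ⊢
      exact hc
  obtain ⟨v, h3⟩ := h3
  have h4 := Spec.impl (j := 5) (Runs.seq h1 (Runs.seq h2 h3))
  rw [PMF.pure_map] at h4
  refine h4.mono ?_
  have := voteTime_mono hl2
  unfold voteTime at this ⊢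
  simp only [List.getD_cons_succ, List.getD_cons_zero]
  have := Nat.mul_le_mul hl1 (Nat.add_le_add_left (Nat.mul_le_mul_left 6 hl1) 12)
  gcongr

/-! ### The construction is efficient -/

variable {m : ℕ → ℕ} {G : ∀ n, Bits n → PMF (Option (Bits (m n)))}

theorem isQPT_botEval (hm : IsPolyLength m) (hpos : ∀ n, 0 < m n)
    (hG : IsQPT (X := fun n => Bits n) (Y := fun n => Option (Bits (m n))) G) :
    IsQPT (X := fun n => Bits n) (Y := fun n => Bits (m n)) (botEval G) := by
  obtain ⟨P, T, hT, hP⟩ := isQPT_iff.1 hG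
  obtain ⟨C, hC⟩ := exists_collect P
  obtain ⟨T1, hT1, hC⟩ := hC (fun n => n) T PolyBdd.id hT
  obtain ⟨Q, hQ⟩ := exists_pick hm hpos
  obtain ⟨T2, hT2, hQ⟩ := hQ (fun n => n) PolyBdd.id
  obtain ⟨R, c, hR⟩ := exists_comp C Q
  refine isQPT_iff.2 ⟨R, fun n => c + 6 * (n + n + T1 n + T2 n), ?_, fun n x => ?_⟩
  · repeat' first
      | assumption
      | exact PolyBdd.id
      | exact PolyBdd.const _
      | refine PolyBdd.add ?_ ?_
      | refine PolyBdd.mul ?_ ?_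
  have h1 := hC n (enc x) (G n x) enc (by simp) (hP n x)
  have h2 := hR n (enc x) _ _ _ (T1 n) (T2 n) h1 (fun y _ => hQ n (List.ofFn y) (by simp))
  rw [length_enc_bits] at h2
  have e : (botEval G n x).map enc = (iid (G n x) n).bind fun y =>
      PMF.pure (enc ((vote (List.ofFn y).reduceOption).getD fun _ => false)) := by
    rw [botEval, PMF.map_comp]
    rfl
  rw [e]
  exact h2

end

/-! ### The sampler as a program -/

section

open Enc

variable {m : ℕ → ℕ} {G : ∀ n, Bits n → PMF (Option (Bits (m n)))}

/-- One attempt of the sampler, given the outcome of the previous ones. -/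
def attempt (G : ∀ n, Bits n → PMF (Option (Bits (m n)))) (n : ℕ) :
    Option (Bits n) → PMF (Option (Bits n))
  | some k => PMF.pure (some k)
  | none => (uniform n).bind fun k => (iid (G n k) n).map fun y =>
      if vote (List.ofFn y) = some none then none else some k

/-- A loop of the machine cannot be left early. Success is therefore an absorbing state, in which
the remaining attempts do nothing. -/
theorem iter_attempt (n t : ℕ) :
    (iter (attempt G n) t none).map (fun o => o.getD fun _ => false) = sampleLoop G n t := by
  have hsome : ∀ t k, iter (attempt G n) t (some k) = PMF.pure (some k) := by
    intro t k
    induction t with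
    | zero => rfl
    | succ t ih => simp [iter, attempt, ih]
  induction t with
  | zero => simp [iter, sampleLoop, PMF.pure_map]
  | succ t ih =>
    simp only [iter, attempt, sampleLoop, PMF.bind_bind, PMF.bind_map, PMF.map_bind]
    congr 1
    funext k
    congr 1
    funext y
    simp only [Function.comp_apply]
    split_ifs
    · exact ih
    · rw [hsome, PMF.pure_map]
      rfl

/-- The registers of the sampler between two attempts. -/
def sampleState (n : ℕ) (o : Option (Bits n)) : Regs :=
  St [List.replicate n Sym.one, [], enc (o.getD fun _ => false),
    o.elim [] fun _ => [Sym.one], [], [], []]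

/-- Sample a uniformly random string into register 4. -/
def sampleBits : Prog := .seq (.loop 0 (flip 6)) (moveRev 6 4)

theorem Spec.sampleBits (n : ℕ) (a b c : List Sym) :
    Spec (exec sampleBits) (St [List.replicate n Sym.one, a, b, c, [], [], []])
      ((uniform n).map fun k => St [List.replicate n Sym.one, a, b, c, enc k, [], []])
      (2 + 6 * n) := by
  have hflip : ∀ l : List Bool,
      Spec (exec (BotPRG.flip 6)) (St [List.replicate n Sym.one, a, b, c, [], [], l.map bitSym])
        (((PMF.uniformOfFintype Bool).map fun a => a :: l).map fun l =>
          St [List.replicate n Sym.one, a, b, c, [], [], l.map bitSym]) 3 := by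
    intro l
    have := Spec.flip 6 (St [List.replicate n Sym.one, a, b, c, [], [], l.map bitSym])
    simp only [update_St [List.replicate n Sym.one, a, b, c, [], [], l.map bitSym] 6 _
      (by simp)] at this
    rw [PMF.map_comp]
    exact this
  have h1 := Spec.loop (r := 0) (σ := St [List.replicate n Sym.one, a, b, c, [], [], []])
    (Spec.iterate (fun l : List Bool =>
      St [List.replicate n Sym.one, a, b, c, [], [], l.map bitSym]) _ hflip
    (List.replicate n Sym.one).length [])
  rw [iter_cons_iid, PMF.map_comp, List.length_replicate, iid_uniform] at h1
  have h2 := Spec.seqMap (T' := 1 + n * 3) (Q := moveRev 6 4) h1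
    (F := fun y => PMF.pure (St [List.replicate n Sym.one, a, b, c,
      ((List.ofFn y)).map bitSym, [], []])) (fun y _ => by
        change Runs _ (St [List.replicate n Sym.one, a, b, c, [], [],
          ((List.ofFn y).reverse ++ []).map bitSym]) _ _
        refine Runs.conv (Runs.moveRev [List.replicate n Sym.one, a, b, c, [], [],
          ((List.ofFn y).reverse ++ []).map bitSym] 6 4 (by simp) (by simp) (by simp)) ?_ ?_
        · simp
        · simp)
  exact h2.mono (by omega)

/-- Register 2 is filled with n zeros in advance, the output if every attempt fails. Register 3 is
the success flag that turns later passes into no-ops. -/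
theorem isQPT_botSample (hm : PolyBdd m)
    (hG : IsQPT (X := fun n => Bits n) (Y := fun n => Option (Bits (m n))) G) :
    IsQPT (X := fun _ => Unit) (Y := fun n => Bits n) (fun n _ => botSample G n) := by
  obtain ⟨P, T, hT, hP⟩ := isQPT_iff.1 hG
  obtain ⟨C, hC⟩ := exists_collect P
  obtain ⟨T1, hT1, hC⟩ := hC (fun n => n) T PolyBdd.id hT
  obtain ⟨N, hN⟩ := exists_call C
  obtain ⟨N', hN'⟩ := exists_call voteProg
  let Λ : ℕ → ℕ := fun n => n * (m n + 2)
  have hΛ : PolyBdd Λ := PolyBdd.id.mul (hm.add (PolyBdd.const 2))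
  let fin : Prog := .seq (.cases 6 fun o => match o with
      | some .bot => .skip
      | _ => .seq (.copy 2 4) (.push 3 .one)) (.seq (.clear 4) (.seq (.clear 5) (.clear 6)))
  let att : Prog := .cases 3 fun o => match o with
    | some _ => .skip
    | none => .seq sampleBits (.seq (call 7 N C 4 5) (.seq (call 7 N' voteProg 5 6) fin))
  let B : ℕ → ℕ := fun n => 1 + ((2 + 6 * n) + ((5 + N + 2 * (n + n + T1 n)) +
    ((5 + N' + 2 * (n + Λ n + (4 + 5 * Λ n + Λ n * (14 + 18 * Λ n + 8 * Λ n * Λ n)))) +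
      ((3 + n) + 3))))
  refine isQPT_iff.2 ⟨.seq (.loop 0 (.push 2 .zero)) (.loop 0 att),
    fun n => (1 + n) + (1 + n * B n), ?_, fun n x => ?_⟩
  · repeat' first
      | assumption
      | exact PolyBdd.id
      | exact PolyBdd.const _
      | refine PolyBdd.add ?_ ?_
      | refine PolyBdd.mul ?_ ?_
  have hfin : ∀ (k : Bits n) (l : List (Option (Bits (m n)))), Runs (exec fin)
      (St [List.replicate n Sym.one, [], List.replicate n Sym.zero, [], enc k, encW (l.map enc),
        voteW (l.map enc)])
      (sampleState n (if vote l = some none then none else some k)) ((3 + n) + 3) := by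
    intro k l
    have hclear : ∀ a b c d e f : List Sym, Runs (exec (.seq (.clear 4) (.seq (.clear 5)
        (.clear 6)))) (St [List.replicate n Sym.one, a, b, c, d, e, f])
        (St [List.replicate n Sym.one, a, b, c, [], [], []]) 3 := fun a b c d e f =>
      (Runs.stClear _ 4 (by simp)).seq ((Runs.stClear _ 5 (by simp)).seq
        (Runs.stClear _ 6 (by simp)))
    by_cases h : vote l = some none
    · rw [if_pos h]
      have h' := (voteW_enc_head_bot l).2 h
      refine Runs.seq (τ := St [List.replicate n Sym.one, [], List.replicate n Sym.zero, [], enc k,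
        encW (l.map enc), voteW (l.map enc)]) (Spec.mono (Spec.cases (T := 1) ?_) (by omega)) ?_
      · change Runs (exec (match (voteW (l.map enc)).head? with
          | some .bot => .skip
          | _ => .seq (.copy 2 4) (.push 3 .one))) _ _ _
        rw [h']
        exact Runs.skip _
      · have := hclear [] (List.replicate n Sym.zero) [] (enc k) (encW (l.map enc))
          (voteW (l.map enc))
        rw [← enc_zero] at this ⊢
        exact this
    · rw [if_neg h]
      have h' := mt (voteW_enc_head_bot l).1 h
      refine Runs.seq (τ := St [List.replicate n Sym.one, [], enc k, [Sym.one], enc k,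
        encW (l.map enc), voteW (l.map enc)]) (Spec.mono (Spec.cases (T := 2 + n) ?_) (by omega)) ?_
      · change Runs (exec (match (voteW (l.map enc)).head? with
          | some .bot => .skip
          | _ => .seq (.copy 2 4) (.push 3 .one))) _ _ _
        have h5 := (Runs.stCopy [List.replicate n Sym.one, [], List.replicate n Sym.zero, [],
          enc k, encW (l.map enc), voteW (l.map enc)] 2 4 (by simp)).seq
          (Runs.stPush _ 3 Sym.one (by simp))
        have h6 : 1 + ([List.replicate n Sym.one, [], List.replicate n Sym.zero, [],
          enc k, encW (l.map enc), voteW (l.map enc)].getD 4 []).length + 1 ≤ 2 + n := by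
          simp
        have h7 := Spec.mono h5 h6
        rcases hv : (voteW (l.map enc)).head? with _ | _ | _ | _ | _ <;>
          first | exact absurd hv h' | exact h7
      · exact hclear [] (enc k) [Sym.one] (enc k) (encW (l.map enc)) (voteW (l.map enc))
  have hatt : ∀ o, Spec (exec att) (sampleState n o) ((attempt G n o).map (sampleState n)) (B n) := by
    rintro (_ | k)
    · refine Spec.cases ?_
      have h1 : Spec (exec sampleBits) (sampleState n none) ((uniform n).map fun k =>
          St [List.replicate n Sym.one, [], List.replicate n Sym.zero, [], enc k, [], []])
          (2 + 6 * n) := by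
        rw [sampleState, Option.getD_none, enc_zero]
        exact Spec.sampleBits n [] (List.replicate n Sym.zero) []
      have h2 : ∀ k : Bits n, Spec (exec (call 7 N C 4 5))
          (St [List.replicate n Sym.one, [], List.replicate n Sym.zero, [], enc k, [], []])
          ((iid (G n k) n).map fun y => St [List.replicate n Sym.one, [],
            List.replicate n Sym.zero, [], enc k, encW ((List.ofFn y).map enc), []])
          (5 + N + 2 * (n + n + T1 n)) := by
        intro k
        have := hN 7 4 5 [List.replicate n Sym.one, [], List.replicate n Sym.zero, [], enc k,
          [], []] n _ _ rfl rfl (by simp) (by simp) (hC n (enc k) (G n k) enc (by simp) (hP n k))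
        rw [PMF.map_comp] at this
        refine Spec.mono this (by simp)
      have h3 : ∀ (k : Bits n) (y : Fin n → Option (Bits (m n))),
          Runs (exec (call 7 N' voteProg 5 6))
          (St [List.replicate n Sym.one, [], List.replicate n Sym.zero, [], enc k,
            encW ((List.ofFn y).map enc), []])
          (St [List.replicate n Sym.one, [], List.replicate n Sym.zero, [], enc k,
            encW ((List.ofFn y).map enc), voteW ((List.ofFn y).map enc)])
          (5 + N' + 2 * (n + Λ n + (4 + 5 * Λ n + Λ n * (14 + 18 * Λ n + 8 * Λ n * Λ n)))) := by
        intro k y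
        have := hN' 7 5 6 [List.replicate n Sym.one, [], List.replicate n Sym.zero, [], enc k,
          encW ((List.ofFn y).map enc), []] n _ _ rfl rfl (by simp) (by simp)
          (voteProg_impl n _ (sep_notMem_map_enc _))
        rw [PMF.pure_map] at this
        refine Spec.mono this ?_
        have h5 := length_encW_enc (List.ofFn y)
        rw [List.length_ofFn] at h5
        have h6 := voteTime_mono h5
        unfold voteTime at h6 ⊢
        simp only [List.getD_cons_succ, List.getD_cons_zero]
        gcongr
      have h4 := Spec.seqMap h1 (fun k _ => Spec.seqMap (h2 k) fun y _ =>
        Runs.seq (h3 k y) (hfin k (List.ofFn y)))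
      have e : (attempt G n none).map (sampleState n) = (uniform n).bind fun k =>
          (iid (G n k) n).bind fun y => PMF.pure (sampleState n
            (if vote (List.ofFn y) = some none then none else some k)) := by
        simp only [attempt, PMF.map_bind, PMF.map_comp]
        rfl
      rw [e]
      exact h4
    · simp only [attempt, PMF.pure_map]
      exact Spec.mono (Spec.cases (T := 1) (Runs.skip _)) (by simp only [B]; omega)
  have h1 := Runs.pushLoop (fun w => [List.replicate n Sym.one, [], w, [], [], [], []]) 2 Sym.zero
    (by simp) (by simp) (by simp) (List.replicate n Sym.one).length []
  have h2 : Runs (exec (.loop 0 (.push 2 .zero)))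
      (St [List.replicate n Sym.one, [], [], [], [], [], []]) (sampleState n none) (1 + n) := by
    rw [sampleState, Option.getD_none, enc_zero]
    rw [List.length_replicate, List.append_nil] at h1
    refine Spec.loop ?_
    simpa using h1
  have h3 : Spec (exec (.loop 0 att)) (sampleState n none)
      ((iter (attempt G n) n none).map (sampleState n)) (1 + n * B n) :=
    Spec.loop (by
      have := Spec.iterate (sampleState n) (attempt G n) hatt (List.replicate n Sym.one).length none
      rw [List.length_replicate] at this
      simpa [sampleState] using this)
  have h4 := Spec.impl (j := 5) (Runs.seq h2 h3)
  rw [PMF.map_comp] at h4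
  have e : (botSample G n).map enc =
      (iter (attempt G n) n none).map ((fun τ => τ 2) ∘ sampleState n) := by
    rw [botSample, ← iter_attempt, PMF.map_comp]
    rfl
  rw [e]
  exact h4

end

section

open Enc

variable {m : ℕ → ℕ}

/-! ### Padding -/

theorem Runs.pushSquare (f : List Sym → List (List Sym)) (r : ℕ) (a : Sym) (n : ℕ)
    (hr : ∀ w, r < (f w).length) (hf : ∀ w, (f w).getD r [] = w) (hs : ∀ w v, (f w).set r v = f v)
    (h0 : ∀ w, ((f w).getD 0 []).length = n) :
    Runs (exec (.loop 0 (.loop 0 (.push r a)))) (St (f [])) (St (f (List.replicate (n * n) a)))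
      (1 + n * (1 + n)) := by
  have h := Runs.iterate (f := exec (.loop 0 (.push r a))) (fun w => St (f w))
    (fun w => List.replicate n a ++ w) (T := 1 + n) (fun _ => True) (by simp) (fun w _ => by
      refine Spec.loop ?_
      rw [St_apply, h0]
      exact Runs.pushLoop f r a hr hf hs n w) n [] trivial
  have e : ∀ k, (fun w => List.replicate n a ++ w)^[k] [] = List.replicate (k * n) a := by
    intro k
    induction k with
    | zero => simp
    | succ k ih =>
      rw [Function.iterate_succ_apply', ih, ← List.replicate_add]
      congr 1
      ring
  rw [e] at h
  refine Spec.loop ?_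
  rw [St_apply, h0]
  exact h

theorem isPolyLength_id : IsPolyLength fun n => n := by
  refine isQPT_iff.2 ⟨.copy 2 0, fun n => 1 + n, (PolyBdd.const 1).add PolyBdd.id, fun n x => ?_⟩
  have h := Spec.impl (j := 1) (Runs.stCopy [List.replicate n Sym.one, [], []] 2 0 (by simp))
  rw [PMF.pure_map] at h ⊢
  exact h.mono (by simp)

theorem isPolyLength_sq : IsPolyLength fun n => n ^ 2 := by
  refine isQPT_iff.2 ⟨.loop 0 (.loop 0 (.push 2 .one)), fun n => 1 + n * (1 + n),
    (PolyBdd.const 1).add (PolyBdd.id.mul ((PolyBdd.const 1).add PolyBdd.id)), fun n x => ?_⟩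
  have h := Spec.impl (j := 1) (Runs.pushSquare (fun w => [List.replicate n Sym.one, [], w]) 2
    Sym.one n (by simp) (by simp) (by simp) (by simp))
  rw [PMF.pure_map] at h ⊢
  change Impl _ n [] (PMF.pure (List.replicate (n ^ 2) Sym.one)) _
  rw [sq]
  exact h

/-- Append zeros to a string of length `n` to get one of length `n ^ 2`. -/
def padBits {n : ℕ} (k : Bits n) : Bits (n ^ 2) := fun i => if h : i < n then k ⟨i, h⟩ else false

/-- The first `n` bits of a string of length `n ^ 2`. -/
def truncBits {n : ℕ} (k : Bits (n ^ 2)) : Bits n :=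
  fun i => k ⟨i, i.2.trans_le (Nat.le_self_pow two_ne_zero n)⟩

theorem truncBits_padBits {n : ℕ} (k : Bits n) : truncBits (padBits k) = k := by
  funext i
  simp [truncBits, padBits]

theorem enc_padBits {n : ℕ} (k : Bits n) :
    enc (padBits k) = enc k ++ List.replicate (n * n - n) Sym.zero := by
  have hn := Nat.le_mul_self n
  refine List.ext_getElem (by simp; rw [sq]; omega) fun i h1 h2 => ?_
  simp only [enc_bits, List.getElem_map, List.getElem_ofFn, padBits, List.getElem_append,
    List.length_map, List.length_ofFn, List.getElem_replicate]
  split_ifs <;> rfl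

theorem enc_truncBits {n : ℕ} (k : Bits (n ^ 2)) : enc (truncBits k) = (enc k).take n := by
  have hn := Nat.le_self_pow two_ne_zero n
  refine List.ext_getElem (by simp [hn]) fun i h1 h2 => ?_
  simp [enc_bits, truncBits]

/-- From n² zeros n are removed, possible since n ≤ n² also for n = 0; two reversals then put the
input in front in its original order. -/
theorem isQPT_padBits : IsQPT (X := fun n => Bits n) (Y := fun n => Bits (n ^ 2))
    fun _ k => PMF.pure (padBits k) := by
  refine isQPT_iff.2 ⟨.seq (.loop 0 (.loop 0 (.push 3 .zero))) (.seq (.loop 0 (.pop 3))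
    (.seq (moveRev 1 4) (.seq (moveRev 4 3) (.copy 2 3)))),
    fun n => (1 + n * (1 + n)) + ((1 + n) + ((1 + n * 3) + ((1 + n * 3) + (1 + n * n)))), ?_,
    fun n k => ?_⟩
  · repeat' first
      | exact PolyBdd.id
      | exact PolyBdd.const _
      | refine PolyBdd.add ?_ ?_
      | refine PolyBdd.mul ?_ ?_
  have h1 := Runs.pushSquare (fun w => [List.replicate n Sym.one, enc k, [], w, []]) 3
    Sym.zero n (by simp) (by simp) (by simp) (by simp)
  have h2 := Runs.popLoop (fun w => [List.replicate n Sym.one, enc k, [], w, []]) 3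
    (by simp) (by simp) (by simp) n (List.replicate (n * n) Sym.zero)
  rw [List.drop_replicate] at h2
  have h3 : Runs (exec (.loop 0 (.pop 3)))
      (St [List.replicate n Sym.one, enc k, [], List.replicate (n * n) Sym.zero, []])
      (St [List.replicate n Sym.one, enc k, [], List.replicate (n * n - n) Sym.zero, []])
      (1 + n) := Spec.loop (by simpa using h2)
  have h4 := Spec.impl (j := 3) (Runs.seq h1 (Runs.seq h3 (Runs.seq (Runs.moveRev _ 1 4 (by simp)
    (by simp) (by simp)) (Runs.seq (Runs.moveRev _ 4 3 (by simp) (by simp) (by simp))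
      (Runs.stCopy _ 2 3 (by simp))))))
  rw [PMF.pure_map] at h4 ⊢
  rw [enc_padBits]
  have hn := Nat.le_mul_self n
  refine ⟨h4.1.trans (by simp), fun s hs => (h4.2 s hs).trans ?_⟩
  simp
  omega

theorem isQPT_truncBits : IsQPT (X := fun n => Bits (n ^ 2)) (Y := fun n => Bits n)
    fun _ k => PMF.pure (truncBits k) := by
  refine isQPT_iff.2 ⟨.seq (.loop 0 (.cases 1 fun o => match o with
      | some x => .seq (.push 3 x) (.pop 1)
      | none => .skip)) (moveRev 3 2),
    fun n => (1 + n * 3) + (1 + n * 3), ?_, fun n k => ?_⟩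
  · repeat' first
      | exact PolyBdd.id
      | exact PolyBdd.const _
      | refine PolyBdd.add ?_ ?_
  have hloop : ∀ (j : ℕ) (w v : List Sym), Runs (iter (exec (.cases 1 fun o => match o with
      | some x => .seq (.push 3 x) (.pop 1)
      | none => .skip)) j) (St [List.replicate n Sym.one, w, [], v])
      (St [List.replicate n Sym.one, w.drop j, [], (w.take j).reverse ++ v]) (j * 3) := by
    intro j
    induction j with
    | zero => intro w v; simpa using Runs.iter_zero _ _
    | succ j ih =>
      intro w v
      cases w with
      | nil =>
        have h1 : Runs (exec (.cases 1 fun o => match o with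
          | some x => .seq (.push 3 x) (.pop 1)
          | none => .skip)) (St [List.replicate n Sym.one, [], [], v])
          (St [List.replicate n Sym.one, [], [], v]) 2 := Spec.cases (T := 1) (Runs.skip _)
        refine Runs.conv (Runs.iter_succ h1 (ih [] v)) (by omega) (by simp)
      | cons x w =>
        have h1 : Runs (exec (.cases 1 fun o => match o with
          | some x => .seq (.push 3 x) (.pop 1)
          | none => .skip)) (St [List.replicate n Sym.one, x :: w, [], v])
          (St [List.replicate n Sym.one, w, [], x :: v]) 3 := Spec.cases (T := 2)
            ((Runs.stPush _ 3 x (by simp)).seq (Runs.stPop _ 1 (by simp)))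
        refine Runs.conv (Runs.iter_succ h1 (ih w (x :: v))) (by omega) (by simp)
  have h1 : Runs (exec (.loop 0 (.cases 1 fun o => match o with
      | some x => .seq (.push 3 x) (.pop 1)
      | none => .skip))) (St [List.replicate n Sym.one, enc k, [], []])
      (St [List.replicate n Sym.one, (enc k).drop n, [], ((enc k).take n).reverse]) (1 + n * 3) :=
    Spec.loop (by simpa using hloop n (enc k) [])
  have h2 := Spec.impl (j := 2) (Runs.seq h1 (Runs.moveRev _ 3 2 (by simp) (by simp) (by simp)))
  rw [PMF.pure_map] at h2 ⊢
  rw [enc_truncBits]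
  have hn := Nat.le_self_pow two_ne_zero n
  refine ⟨h2.1.trans (by simp), fun s hs => (h2.2 s hs).trans ?_⟩
  simp

/-- A bound on the encoded input is required because calling a subroutine copies its input. -/
theorem IsQPT.comp {X Y Z : ℕ → Type} [∀ n, Enc (X n)] [∀ n, Enc (Y n)] [∀ n, Enc (Z n)]
    {f : ∀ n, X n → PMF (Y n)} {g : ∀ n, Y n → PMF (Z n)} {ℓ : ℕ → ℕ} (hℓ : PolyBdd ℓ)
    (hX : ∀ n (x : X n), (enc x).length ≤ ℓ n) (hf : IsQPT f) (hg : IsQPT g) :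
    IsQPT fun n x => (f n x).bind (g n) := by
  obtain ⟨P, T, hT, hP⟩ := isQPT_iff.1 hf
  obtain ⟨P', T', hT', hP'⟩ := isQPT_iff.1 hg
  obtain ⟨Q, c, hQ⟩ := exists_comp P P'
  refine isQPT_iff.2 ⟨Q, fun n => c + 6 * (n + ℓ n + T n + T' n), ?_, fun n x => ?_⟩
  · repeat' first
      | assumption
      | exact PolyBdd.id
      | exact PolyBdd.const _
      | refine PolyBdd.add ?_ ?_
      | refine PolyBdd.mul ?_ ?_
  rw [PMF.map_bind]
  refine (hQ n (enc x) (f n x) enc _ _ _ (hP n x) fun y _ => hP' n y).mono ?_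
  have := hX n x
  dsimp only
  omega

/-! ### The reduction -/

theorem isQPT_true : IsQPT (X := fun n => Bits (m n)) (Y := fun _ => Bool)
    fun _ _ => PMF.pure true := by
  refine isQPT_iff.2 ⟨.push 2 .one, fun n => 1, PolyBdd.const 1, fun n x => ?_⟩
  have h := Spec.impl (j := 1) (Runs.stPush [List.replicate n Sym.one, enc x, []] 2 .one (by simp))
  rw [PMF.pure_map] at h ⊢
  exact h

/-- The reduction: reject if the first `n` samples vote for `⊥`, otherwise run the distinguisher
`A` on the first most common value different from `⊥` of the remaining samples. -/
def reduction (A : ∀ n, Bits (m n) → PMF Bool) (n : ℕ) (l : List (Option (Bits (m n)))) :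
    PMF Bool :=
  if vote (l.take n) = some none then PMF.pure false
  else A n ((vote (l.drop n).reduceOption).getD fun _ => false)

theorem isQPT_reduction (hm : IsPolyLength m) (hpos : ∀ n, 0 < m n) (q : Polynomial ℕ)
    {A : ∀ n, Bits (m n) → PMF Bool}
    (hA : IsQPT (X := fun n => Bits (m n)) (Y := fun _ => Bool) A) :
    IsQPT (X := fun n => Fin (q.eval n) → Option (Bits (m n))) (Y := fun _ => Bool)
      fun n y => reduction A n (List.ofFn y) := by
  have hmP := hm.polyBdd
  obtain ⟨P, T, hT, hP⟩ := isQPT_iff.1 hA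
  obtain ⟨Q, hQ⟩ := exists_pick hm hpos
  obtain ⟨T1, hT1, hQ⟩ := hQ (fun n => q.eval n) (PolyBdd.eval q)
  obtain ⟨N1, hN1⟩ := exists_call takeProg
  obtain ⟨N2, hN2⟩ := exists_call voteProg
  obtain ⟨N3, hN3⟩ := exists_call dropProg
  obtain ⟨N4, hN4⟩ := exists_call Q
  obtain ⟨N5, hN5⟩ := exists_call P
  let Λ : ℕ → ℕ := fun n => q.eval n * (m n + 2)
  have hΛ : PolyBdd Λ := (PolyBdd.eval q).mul (hmP.add (PolyBdd.const 2))
  let S : ℕ → ℕ := fun n => 3 + n + Λ n * (12 + 6 * Λ n)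
  have hS : PolyBdd S := by
    repeat' first
      | assumption
      | exact PolyBdd.id
      | exact PolyBdd.const _
      | refine PolyBdd.add ?_ ?_
      | refine PolyBdd.mul ?_ ?_
  let V : ℕ → ℕ := fun n => 4 + 5 * Λ n + Λ n * (14 + 18 * Λ n + 8 * Λ n * Λ n)
  have hV : PolyBdd V := by
    repeat' first
      | assumption
      | exact PolyBdd.id
      | exact PolyBdd.const _
      | refine PolyBdd.add ?_ ?_
      | refine PolyBdd.mul ?_ ?_
  let rest : Prog := .seq (call 7 N3 dropProg 1 5) (.seq (call 7 N4 Q 5 6) (call 7 N5 P 6 2))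
  let R : ℕ → ℕ := fun n => (5 + N3 + 2 * (n + Λ n + S n)) +
    ((5 + N4 + 2 * (n + Λ n + T1 n)) + (5 + N5 + 2 * (n + m n + T n)))
  have hR : PolyBdd R := by
    repeat' first
      | assumption
      | exact PolyBdd.id
      | exact PolyBdd.const _
      | refine PolyBdd.add ?_ ?_
      | refine PolyBdd.mul ?_ ?_
  refine isQPT_iff.2 ⟨.seq (call 7 N1 takeProg 1 3) (.seq (call 7 N2 voteProg 3 4)
    (.cases 4 fun o => match o with
      | some .bot => .push 2 .zero
      | _ => rest)),
    fun n => (5 + N1 + 2 * (n + Λ n + S n)) + ((5 + N2 + 2 * (n + Λ n + V n)) + (1 + (1 + R n))),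
    ?_, fun n y => ?_⟩
  · repeat' first
      | assumption
      | exact PolyBdd.id
      | exact PolyBdd.const _
      | refine PolyBdd.add ?_ ?_
      | refine PolyBdd.mul ?_ ?_
  rw [enc_tuple]
  have hlen : (List.ofFn y).length = q.eval n := List.length_ofFn
  generalize List.ofFn y = l at hlen ⊢
  have hl1 : ∀ l' : List (Option (Bits (m n))), l'.length ≤ l.length →
      (encW (l'.map enc)).length ≤ Λ n :=
    fun l' h => (length_encW_enc l').trans (Nat.mul_le_mul_right _ (h.trans hlen.le))
  have hsel : 3 + n + (encW (l.map enc)).length * (12 + 6 * (encW (l.map enc)).length) ≤ S n := by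
    have := hl1 l le_rfl
    simp only [S]
    gcongr
  have i1 := (takeProg_impl n _ (sep_notMem_map_enc l)).mono hsel
  have i3 := (dropProg_impl n _ (sep_notMem_map_enc l)).mono hsel
  rw [← List.map_take] at i1
  rw [← List.map_drop] at i3
  have i2 := (voteProg_impl n _ (sep_notMem_map_enc (l.take n))).mono
    (voteTime_mono (hl1 _ (List.length_take_le' n l)))
  have h1 := hN1 7 1 3 [List.replicate n Sym.one, encW (l.map enc), [], [], [], [], []] n _ _ rfl
    rfl (by simp) (by simp) i1
  have h2 := hN2 7 3 4 [List.replicate n Sym.one, encW (l.map enc), [],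
    encW ((l.take n).map enc), [], [], []] n _ _ rfl rfl (by simp) (by simp) i2
  rw [PMF.pure_map] at h1 h2
  have b1 := hl1 l le_rfl
  have b2 := hl1 (l.take n) (List.length_take_le' n l)
  have b3 := hl1 (l.drop n) (by simp)
  have h1' := Spec.mono (T' := 5 + N1 + 2 * (n + Λ n + S n)) h1 (by
    simp only [List.getD_cons_succ, List.getD_cons_zero]
    gcongr)
  have h2' := Spec.mono (T' := 5 + N2 + 2 * (n + Λ n + V n)) h2 (by
    simp only [List.getD_cons_succ, List.getD_cons_zero]
    change _ ≤ 5 + N2 + 2 * (n + Λ n + voteTime (Λ n))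
    gcongr)
  -- The two branches leave different rubbish in the other registers; only the law of register 2 has
  -- to be known.
  have h3 : ∃ D : PMF Regs, Spec (exec (.cases 4 fun o => match o with
      | some .bot => .push 2 .zero
      | _ => rest)) (St [List.replicate n Sym.one, encW (l.map enc), [],
        encW ((l.take n).map enc), voteW ((l.take n).map enc), [], []]) D (1 + (1 + R n)) ∧
      D.map (fun τ => τ 2) = (reduction A n l).map enc := by
    by_cases h : vote (l.take n) = some none
    · have h' := (voteW_enc_head_bot (l.take n)).2 h
      refine ⟨_, Spec.mono (Spec.cases (T := 1) (D := PMF.pure (St [List.replicate n Sym.one,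
        encW (l.map enc), [Sym.zero], encW ((l.take n).map enc), voteW ((l.take n).map enc),
        [], []])) ?_) (by omega), ?_⟩
      · change Runs (exec (match (voteW ((l.take n).map enc)).head? with
          | some .bot => .push 2 .zero
          | _ => rest)) _ _ _
        rw [h']
        exact Runs.stPush _ 2 Sym.zero (by simp)
      · rw [reduction, if_pos h, PMF.pure_map, PMF.pure_map]
        rfl
    · have h' := mt (voteW_enc_head_bot (l.take n)).1 h
      have h4 := hN3 7 1 5 [List.replicate n Sym.one, encW (l.map enc), [],
        encW ((l.take n).map enc), voteW ((l.take n).map enc), [], []] n _ _ rfl rfl (by simp)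
        (by simp) i3
      have h5 := hN4 7 5 6 [List.replicate n Sym.one, encW (l.map enc), [],
        encW ((l.take n).map enc), voteW ((l.take n).map enc), encW ((l.drop n).map enc), []]
        n _ _ rfl rfl (by simp) (by simp) (hQ n (l.drop n) (by simp; omega))
      have h6 := hN5 7 6 2 [List.replicate n Sym.one, encW (l.map enc), [],
        encW ((l.take n).map enc), voteW ((l.take n).map enc), encW ((l.drop n).map enc),
        enc ((vote (l.drop n).reduceOption).getD fun _ => false)]
        n _ _ rfl rfl (by simp) (by simp) (hP n _)
      rw [PMF.pure_map] at h4 h5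
      have h7 := Spec.mono (T' := R n) (Runs.seq h4 (Runs.seq h5 h6)) (by
        simp only [List.getD_cons_succ, List.getD_cons_zero, length_enc_bits, R]
        gcongr)
      refine ⟨((A n ((vote (l.drop n).reduceOption).getD fun _ => false)).map enc).map fun z =>
          St ([List.replicate n Sym.one, encW (l.map enc), [],
          encW ((l.take n).map enc), voteW ((l.take n).map enc), encW ((l.drop n).map enc),
          enc ((vote (l.drop n).reduceOption).getD fun _ => false)].set 2 z),
        Spec.mono (Spec.cases (T := R n) ?_) (by omega), ?_⟩
      · change Spec (exec (match (voteW ((l.take n).map enc)).head? with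
          | some .bot => .push 2 .zero
          | _ => rest)) _ _ _
        rcases hv : (voteW ((l.take n).map enc)).head? with _ | _ | _ | _ | _ <;>
          first | exact absurd hv h' | exact h7
      · rw [reduction, if_neg h, PMF.map_comp]
        exact PMF.map_id _
  obtain ⟨D, h3, hD⟩ := h3
  have h4 := Spec.impl (j := 5) (Runs.seq h1' (Runs.seq h2' h3))
  rw [hD] at h4
  exact h4

end

section

/-! ### Expectations -/

/-- Expectation of a function on a finite type. -/
def ex {X : Type} [Fintype X] (p : PMF X) (h : X → ℝ) : ℝ := ∑ x, (p x).toReal * h x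

section ex

variable {X Y : Type} [Fintype X] [Fintype Y]

theorem sum_toReal (p : PMF X) : ∑ x, (p x).toReal = 1 := by
  have h : ∑ x, p x = 1 := by rw [← p.tsum_coe, tsum_fintype]
  rw [← ENNReal.toReal_sum fun x _ => p.apply_ne_top x, h, ENNReal.toReal_one]

theorem ex_const (p : PMF X) (c : ℝ) : ex p (fun _ => c) = c := by
  rw [ex, ← Finset.sum_mul, sum_toReal, one_mul]

theorem ex_pure (a : X) (h : X → ℝ) : ex (PMF.pure a) h = h a := by
  classical
  rw [ex, Finset.sum_eq_single a]
  · simp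
  · intro b _ hb
    simp [hb]
  · simp

theorem ex_bind (p : PMF X) (f : X → PMF Y) (h : Y → ℝ) :
    ex (p.bind f) h = ex p fun x => ex (f x) h := by
  simp only [ex, PMF.bind_apply, tsum_fintype]
  rw [Finset.sum_congr rfl fun y _ => by
    rw [ENNReal.toReal_sum fun x _ => ENNReal.mul_ne_top (p.apply_ne_top x) ((f x).apply_ne_top y)]]
  simp only [ENNReal.toReal_mul, Finset.sum_mul, Finset.mul_sum]
  rw [Finset.sum_comm]
  simp only [mul_assoc]

theorem ex_map (p : PMF X) (f : X → Y) (h : Y → ℝ) : ex (p.map f) h = ex p fun x => h (f x) := by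
  have : p.map f = p.bind fun x => PMF.pure (f x) := rfl
  rw [this, ex_bind]
  simp only [ex_pure]

theorem ex_mono (p : PMF X) {h h' : X → ℝ} (hh : ∀ x, h x ≤ h' x) : ex p h ≤ ex p h' :=
  Finset.sum_le_sum fun x _ => mul_le_mul_of_nonneg_left (hh x) ENNReal.toReal_nonneg

theorem ex_nonneg (p : PMF X) {h : X → ℝ} (hh : ∀ x, 0 ≤ h x) : 0 ≤ ex p h :=
  Finset.sum_nonneg fun x _ => mul_nonneg ENNReal.toReal_nonneg (hh x)

theorem ex_le (p : PMF X) {h : X → ℝ} {c : ℝ} (hh : ∀ x, h x ≤ c) : ex p h ≤ c :=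
  (ex_mono p hh).trans_eq (ex_const p c)

theorem ex_add (p : PMF X) (h h' : X → ℝ) : ex p (fun x => h x + h' x) = ex p h + ex p h' := by
  simp only [ex, mul_add, Finset.sum_add_distrib]

theorem ex_sub (p : PMF X) (h h' : X → ℝ) : ex p (fun x => h x - h' x) = ex p h - ex p h' := by
  simp only [ex, mul_sub, Finset.sum_sub_distrib]

theorem ex_mul_const (p : PMF X) (h : X → ℝ) (c : ℝ) : ex p (fun x => h x * c) = ex p h * c := by
  simp only [ex, Finset.sum_mul, mul_assoc]

theorem ex_const_mul (p : PMF X) (h : X → ℝ) (c : ℝ) : ex p (fun x => c * h x) = c * ex p h := by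
  simp only [ex, Finset.mul_sum, mul_left_comm]

theorem abs_ex_le (p : PMF X) {h : X → ℝ} {c : ℝ} (hh : ∀ x, |h x| ≤ c) : |ex p h| ≤ c := by
  rw [abs_le]
  constructor
  · rw [← ex_const p (-c)]
    exact ex_mono p fun x => (abs_le.1 (hh x)).1
  · exact ex_le p fun x => (abs_le.1 (hh x)).2

theorem ex_indicator [DecidableEq X] (p : PMF X) (a : X) :
    ex p (fun x => if x = a then 1 else 0) = (p a).toReal := by
  simp [ex]

theorem pr_eq_ex (p : PMF Bool) : pr p = ex p fun b => if b then 1 else 0 := by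
  simp [pr, ex]

theorem pr_bind (p : PMF X) (f : X → PMF Bool) : pr (p.bind f) = ex p fun x => pr (f x) := by
  simp only [pr_eq_ex, ex_bind]

theorem pr_nonneg (p : PMF Bool) : 0 ≤ pr p := ENNReal.toReal_nonneg

theorem pr_le_one (p : PMF Bool) : pr p ≤ 1 := by
  rw [pr_eq_ex]
  exact ex_le p fun b => by split_ifs <;> norm_num

theorem ex_iid_succ (p : PMF X) (q : ℕ) (h : (Fin (q + 1) → X) → ℝ) :
    ex (iid p (q + 1)) h = ex p fun x => ex (iid p q) fun xs => h (Fin.cons x xs) := by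
  rw [iid, ex_bind]
  simp only [ex_map]

theorem ex_iid_prod (p : PMF X) (h : X → ℝ) (q : ℕ) :
    ex (iid p q) (fun y => ∏ i, h (y i)) = ex p h ^ q := by
  induction q with
  | zero => simp [ex_const]
  | succ q ih =>
    rw [ex_iid_succ]
    simp only [Fin.prod_univ_succ, Fin.cons_zero, Fin.cons_succ, ex_const_mul, ih, ex_mul_const]
    ring

theorem ex_iid_sum (p : PMF X) (h : X → ℝ) (q : ℕ) :
    ex (iid p q) (fun y => ∑ i, h (y i)) = q * ex p h := by
  induction q with
  | zero => simp [ex_const]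
  | succ q ih =>
    rw [ex_iid_succ]
    simp only [Fin.sum_univ_succ, Fin.cons_zero, Fin.cons_succ, ex_add, ih, ex_const]
    push_cast
    ring

/-- Consecutive blocks of samples are independent. This separates the acceptance test of the
reduction from its evaluation. -/
theorem ex_iid_split (p : PMF X) (a b : ℕ) (h : List X → List X → ℝ) (q : ℕ) (hq : q = a + b) :
    ex (iid p q) (fun y => h ((List.ofFn y).take a) ((List.ofFn y).drop a)) =
      ex (iid p a) fun u => ex (iid p b) fun v => h (List.ofFn u) (List.ofFn v) := by
  induction a generalizing h q with
  | zero =>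
    obtain rfl : q = b := by omega
    rw [show iid p 0 = PMF.pure Fin.elim0 from rfl, ex_pure]
    simp
  | succ a ih =>
    obtain rfl : q = (a + b) + 1 := by omega
    rw [ex_iid_succ, ex_iid_succ]
    congr 1
    funext x
    simp only [List.ofFn_succ, Fin.cons_zero, Fin.cons_succ, List.take_succ_cons,
      List.drop_succ_cons]
    exact ih (fun u v => h (x :: u) v) (a + b) rfl

end ex

theorem iid_map {X Y : Type} (p : PMF X) (f : X → Y) (q : ℕ) :
    iid (p.map f) q = (iid p q).map fun y i => f (y i) := by
  induction q with
  | zero =>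
    rw [iid, iid, PMF.pure_map]
    congr 1
    exact Subsingleton.elim _ _
  | succ q ih =>
    simp only [iid, ih, PMF.bind_map, PMF.map_bind, PMF.map_comp]
    congr 1
    funext x
    refine congrArg (fun g => (iid p q).map g) ?_
    funext y i
    refine Fin.cases ?_ (fun j => ?_) i <;> simp

/-! ### Votes -/

theorem vote_map {X Y : Type} [DecidableEq X] [DecidableEq Y] {e : X → Y}
    (he : Function.Injective e) (l : List X) : vote (l.map e) = (vote l).map e := by
  have key : ∀ (l' : List X) (o : Option X),
      (l'.map e).foldl (List.argAux fun b c => (l.map e).count c < (l.map e).count b) (o.map e) =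
      (l'.foldl (List.argAux fun b c => l.count c < l.count b) o).map e := by
    intro l'
    induction l' with
    | nil => intro o; rfl
    | cons x l' ih =>
      intro o
      rw [List.map_cons, List.foldl_cons, List.foldl_cons, ← ih]
      congr 1
      cases o with
      | none => rfl
      | some c =>
        simp only [List.argAux, Option.map_some, List.count_map_of_injective _ _ he]
        split_ifs <;> rfl
  exact key l none

theorem vote_eq_some_of_forall {X : Type} [DecidableEq X] {l : List X} {y : X} (hl : l ≠ [])
    (h : ∀ x ∈ l, x = y) : vote l = some y := by
  cases hv : vote l with
  | none => exact absurd (List.argmax_eq_none.1 hv) hl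
  | some x => rw [h x (List.argmax_mem hv)]

theorem count_none_le {X : Type} [DecidableEq X] {l : List (Option X)}
    (h : vote l ≠ some none) : l.count none ≤ l.countP Option.isSome := by
  rcases hv : vote l with _ | _ | z
  · rw [List.argmax_eq_none.1 hv]
    simp
  · exact absurd hv h
  · by_cases hn : none ∈ l
    · have h1 : l.count none ≤ l.count (some z) := by
        have := List.le_of_mem_argmax hn hv
        -- `vote` counts with the equality test derived from `DecidableEq`, the statement with the
        -- one of `Option`; lawful tests coincide.
        rwa [show (instBEqOfDecidableEq : BEq (Option X)) = Option.instBEq from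
          lawful_beq_subsingleton _ _] at this
      refine h1.trans ?_
      rw [List.count]
      refine List.countP_mono_left fun x _ hx => ?_
      rw [beq_iff_eq] at hx
      rw [hx]
      rfl
    · rw [List.count_eq_zero_of_not_mem hn]
      exact Nat.zero_le _

/-- The product is 2 to the power of the number of values minus the number of ⊥, and acceptance
makes this exponent nonnegative: a winning value is at least as frequent as ⊥. The product form lets
expectations factor by independence. -/
theorem one_le_prod_of_vote {X : Type} [DecidableEq X] {l : List (Option X)} (h : vote l ≠ some none) :
    (1 : ℝ) ≤ (l.map fun a => if a = none then (1 / 2 : ℝ) else 2).prod := by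
  have key : ∀ l : List (Option X), (l.map fun a => if a = none then (1 / 2 : ℝ) else 2).prod =
      2 ^ l.countP Option.isSome / 2 ^ l.count none := by
    intro l
    induction l with
    | nil => simp
    | cons a l ih =>
      rw [List.map_cons, List.prod_cons, ih]
      cases a with
      | none =>
        rw [if_pos rfl, List.count_cons_self, List.countP_cons_of_neg (by simp), pow_succ]
        field_simp
      | some a =>
        rw [if_neg (by simp), List.count_cons_of_ne (by simp), List.countP_cons_of_pos (by simp),
          pow_succ]
        field_simp
  rw [key, one_le_div (by positivity)]
  exact pow_le_pow_right₀ (by norm_num) (count_none_le h)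

/-- The first most common value different from `⊥`. -/
def pick {X : Type} [DecidableEq X] (d : X) (l : List (Option X)) : X := (vote l.reduceOption).getD d

theorem pick_eq {X : Type} [DecidableEq X] {d y : X} {l : List (Option X)} (h : ∀ a ∈ l, a = none ∨ a = some y)
    (h' : ¬ ∀ a ∈ l, a = none) : pick d l = y := by
  rw [pick, vote_eq_some_of_forall (y := y)]
  · rfl
  · intro h0
    refine h' fun a ha => ?_
    cases a with
    | none => rfl
    | some x =>
      have := List.reduceOption_mem_iff.2 ha
      rw [h0] at this
      simp at this
  · intro x hx
    simpa using h _ (List.reduceOption_mem_iff.1 hx)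

theorem toReal_le_one {X : Type} (p : PMF X) (a : X) : (p a).toReal ≤ 1 :=
  ENNReal.toReal_mono ENNReal.one_ne_top (p.coe_le_one a)

/-! ### Tail estimates for votes -/

section key

variable {X : Type} [Fintype X] [DecidableEq X]

/-- Probability that the first most common of `n` samples is not `⊥`. -/
def acceptProb (p : PMF (Option X)) (n : ℕ) : ℝ :=
  ex (iid p n) fun y => if vote (List.ofFn y) = some none then 0 else 1

theorem acceptProb_nonneg (p : PMF (Option X)) (n : ℕ) : 0 ≤ acceptProb p n :=
  ex_nonneg _ fun y => by split_ifs <;> norm_num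

theorem acceptProb_le_one (p : PMF (Option X)) (n : ℕ) : acceptProb p n ≤ 1 :=
  ex_le _ fun y => by split_ifs <;> norm_num

/-- A Chernoff bound: the indicator of acceptance is at most a product of weights, 1/2 for ⊥ and 2
for a value, and a single weight has mean 2 - (3/2)·Pr[⊥]. -/
theorem acceptProb_le (p : PMF (Option X)) (n : ℕ) :
    acceptProb p n ≤ (2 - 3 / 2 * (p none).toReal) ^ n := by
  have h1 : acceptProb p n ≤
      ex (iid p n) fun y => ∏ i, if y i = none then (1 / 2 : ℝ) else 2 := by
    refine ex_mono _ fun y => ?_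
    have h2 : (∏ i, if y i = none then (1 / 2 : ℝ) else 2) =
        ((List.ofFn y).map fun a => if a = none then (1 / 2 : ℝ) else 2).prod := by
      rw [List.map_ofFn, List.prod_ofFn]
      rfl
    split_ifs with h
    · exact Finset.prod_nonneg fun i _ => by split_ifs <;> norm_num
    · rw [h2]
      exact one_le_prod_of_vote h
  refine h1.trans_eq ?_
  rw [ex_iid_prod p (fun a => if a = none then (1 / 2 : ℝ) else 2)]
  congr 1
  have h3 : (fun a : Option X => if a = none then (1 / 2 : ℝ) else 2) =
      fun a => 2 - 3 / 2 * (if a = none then 1 else 0) := by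
    funext a
    split_ifs <;> norm_num
  rw [h3, ex_sub, ex_const, ex_const_mul, ex_indicator]

/-- A key that is accepted rarely yields only `⊥`. -/
theorem acceptProb_mul_le (p : PMF (Option X)) (n : ℕ) :
    acceptProb p n * (p none).toReal ^ n ≤ (15 / 16) ^ n := by
  have h0 : 0 ≤ (p none).toReal := ENNReal.toReal_nonneg
  have h1 := toReal_le_one p none
  -- Below the threshold the second factor is small; above it the Chernoff base is at most 19/32.
  -- Any threshold in [4/5, 1) would serve.
  rcases le_total (p none).toReal (15 / 16) with h | h
  · calc _ ≤ 1 * (p none).toReal ^ n :=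
        mul_le_mul_of_nonneg_right (acceptProb_le_one p n) (pow_nonneg h0 n)
      _ ≤ _ := by rw [one_mul]; exact pow_le_pow_left₀ h0 h n
  · calc _ ≤ (2 - 3 / 2 * (p none).toReal) ^ n * 1 :=
        mul_le_mul (acceptProb_le p n) (pow_le_one₀ h0 h1) (pow_nonneg h0 n)
          (pow_nonneg (by linarith) n)
      _ ≤ _ := by rw [mul_one]; exact pow_le_pow_left₀ (by linarith) (by linarith) n

/-- Probability that `n` samples yield a value different from `y`. -/
theorem pick_ne_le (p : PMF (Option X)) (d y : X) (n : ℕ) :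
    ex (iid p n) (fun z => if pick d (List.ofFn z) = y then 0 else 1) ≤
      (p none).toReal ^ n + n * (1 - ((p (some y)).toReal + (p none).toReal)) := by
  -- A wrong value requires either that all samples are ⊥ (the product) or that some sample lies
  -- outside {y, ⊥} (the sum).
  have h1 : ex (iid p n) (fun z => if pick d (List.ofFn z) = y then 0 else 1) ≤
      ex (iid p n) fun z => (∏ i, if z i = none then (1 : ℝ) else 0) +
        ∑ i, (1 - ((if z i = some y then (1 : ℝ) else 0) + if z i = none then 1 else 0)) := by
    refine ex_mono _ fun z => ?_
    have hs : ∀ i, (0 : ℝ) ≤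
        1 - ((if z i = some y then (1 : ℝ) else 0) + if z i = none then 1 else 0) := by
      intro i
      rcases hz : z i with _ | x
      · simp
      · by_cases h : x = y <;> simp [h]
    have hp : (0 : ℝ) ≤ ∏ i, if z i = none then (1 : ℝ) else 0 :=
      Finset.prod_nonneg fun i _ => by split_ifs <;> norm_num
    have hS := Finset.sum_nonneg fun i (_ : i ∈ Finset.univ) => hs i
    split_ifs with h
    · linarith
    · by_cases ha : ∀ i, z i = none
      · rw [Finset.prod_congr rfl fun i _ => if_pos (ha i), Finset.prod_const_one]
        linarith
      · have : ∃ i, ¬ (z i = none ∨ z i = some y) := by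
          by_contra hcon
          push Not at hcon
          refine h (pick_eq (fun a ha => ?_) fun hall => ha fun i => hall _ ?_)
          · obtain ⟨i, rfl⟩ := (List.mem_ofFn' _ _).1 ha
            exact hcon i
          · exact (List.mem_ofFn' _ _).2 ⟨i, rfl⟩
        obtain ⟨i, hi⟩ := this
        push Not at hi
        have := Finset.single_le_sum (fun i _ => hs i) (Finset.mem_univ i)
        rw [if_neg hi.2, if_neg hi.1] at this
        linarith
  refine h1.trans_eq ?_
  rw [ex_add, ex_iid_prod p (fun a => if a = none then (1 : ℝ) else 0),
    ex_iid_sum p (fun a => 1 - ((if a = some y then (1 : ℝ) else 0) + if a = none then 1 else 0)),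
    ex_sub, ex_const, ex_add, ex_indicator, ex_indicator]

/-- If ⊥ wins the vote, it occurs among the samples, so some sample differs from `y`; a union bound
does the rest. -/
theorem one_sub_acceptProb_le (p : PMF (Option X)) (y : X) (n : ℕ) :
    1 - acceptProb p n ≤ n * (1 - (p (some y)).toReal) := by
  have h1 : 1 - acceptProb p n =
      ex (iid p n) fun z => 1 - if vote (List.ofFn z) = some none then (0 : ℝ) else 1 := by
    rw [ex_sub, ex_const, acceptProb]
  have h2 : 1 - acceptProb p n ≤
      ex (iid p n) fun z => ∑ i, (1 - if z i = some y then (1 : ℝ) else 0) := by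
    rw [h1]
    refine ex_mono _ fun z => ?_
    have hs : ∀ i, (0 : ℝ) ≤ 1 - if z i = some y then (1 : ℝ) else 0 := fun i => by
      split_ifs <;> norm_num
    have hS := Finset.sum_nonneg fun i (_ : i ∈ Finset.univ) => hs i
    split_ifs with h
    · have hmem := List.argmax_mem h
      obtain ⟨i, hi⟩ := (List.mem_ofFn' _ _).1 hmem
      have := Finset.single_le_sum (fun i _ => hs i) (Finset.mem_univ i)
      rw [if_neg (by rw [hi]; simp)] at this
      linarith
    · linarith
  refine h2.trans_eq ?_
  rw [ex_iid_sum p (fun a => 1 - if a = some y then (1 : ℝ) else 0), ex_sub, ex_const,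
    ex_indicator]

end key

end

section

open Filter Topology

/-! ### Negligible functions -/

theorem Negligible.of_le {f g : ℕ → ℝ} (hg : Negligible g) (h0 : ∀ n, 0 ≤ f n)
    (h : ∀ᶠ n in atTop, f n ≤ g n) : Negligible f :=
  hg.trans_eventually_abs_le (h.mono fun n hn => by
    simp only [Function.comp_apply]
    rw [abs_of_nonneg (h0 n)]
    exact hn.trans (le_abs_self _))

theorem Negligible.add {f g : ℕ → ℝ} (hf : Negligible f) (hg : Negligible g) :
    Negligible fun n => f n + g n :=
  Asymptotics.SuperpolynomialDecay.add hf hg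

theorem Negligible.nat_mul {f : ℕ → ℝ} (hf : Negligible f) : Negligible fun n => (n : ℝ) * f n :=
  Asymptotics.SuperpolynomialDecay.param_mul hf

theorem Negligible.abs {f : ℕ → ℝ} (hf : Negligible f) : Negligible fun n => |f n| :=
  hf.trans_eventually_abs_le (Eventually.of_forall fun n => by simp)

theorem Negligible.pow {r : ℝ} (h0 : 0 ≤ r) (h1 : r < 1) : Negligible fun n => r ^ n :=
  fun c => tendsto_pow_const_mul_const_pow_of_lt_one c h0 h1

theorem Negligible.tendsto {f : ℕ → ℝ} (hf : Negligible f) : Tendsto f atTop (𝓝 0) := by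
  simpa using hf 0

/-! ### Analysis of the construction -/

variable {m : ℕ → ℕ} {G : ∀ n, Bits n → PMF (Option (Bits (m n)))}

/-- Probability that an attempt of the sampler succeeds. -/
def successProb (G : ∀ n, Bits n → PMF (Option (Bits (m n)))) (n : ℕ) : ℝ :=
  ex (uniform n) fun k => acceptProb (G n k) n

theorem successProb_le_one (n : ℕ) : successProb G n ≤ 1 :=
  ex_le _ fun _ => acceptProb_le_one _ _

/-- Condition on the first attempt: given its seed, it succeeds with probability `acceptProb (G n k)
n`, and a failure restarts the shorter loop independently of that seed. -/
theorem ex_sampleLoop_succ (n t : ℕ) (v : Bits n → ℝ) :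
    ex (sampleLoop G n (t + 1)) v =
      ex (uniform n) (fun k => acceptProb (G n k) n * v k) +
        (1 - successProb G n) * ex (sampleLoop G n t) v := by
  have h1 : ∀ k, (ex (iid (G n k) n) fun y => ex (if vote (List.ofFn y) = some none then
      sampleLoop G n t else PMF.pure k) v) =
      acceptProb (G n k) n * v k + (1 - acceptProb (G n k) n) * ex (sampleLoop G n t) v := by
    intro k
    have h2 : (fun y : Fin n → Option (Bits (m n)) => ex (if vote (List.ofFn y) = some none then
        sampleLoop G n t else PMF.pure k) v) = fun y =>
        (if vote (List.ofFn y) = some none then 0 else 1) * (v k - ex (sampleLoop G n t) v) +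
          ex (sampleLoop G n t) v := by
      funext y
      split_ifs
      · simp
      · rw [ex_pure]; ring
    rw [h2, ex_add, ex_mul_const, ex_const]
    change acceptProb (G n k) n * _ + _ = _
    ring
  simp only [sampleLoop, ex_bind, h1]
  rw [ex_add, ex_mul_const, ex_sub, ex_const]
  rfl

/-- With e_t the deviation from u after t attempts, e_{t+1} = (E[a v] - s u) + (1 - s) e_t. As 0 ≤ 1
- s ≤ 1, each attempt adds at most η, and the deviation of the fallback seed, at most 1, decays
geometrically. -/
theorem abs_ex_sampleLoop_sub_le (n t : ℕ) (v : Bits n → ℝ) (u η : ℝ)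
    (hv : ∀ k, |v k - u| ≤ 1)
    (h : |ex (uniform n) (fun k => acceptProb (G n k) n * v k) - successProb G n * u| ≤ η) :
    |ex (sampleLoop G n t) v - u| ≤ t * η + (1 - successProb G n) ^ t := by
  induction t with
  | zero =>
    rw [sampleLoop, ex_pure]
    simpa using hv _
  | succ t ih =>
    have h0 : 0 ≤ 1 - successProb G n := sub_nonneg.2 (successProb_le_one n)
    have h1 : 1 - successProb G n ≤ 1 :=
      sub_le_self _ (ex_nonneg _ fun _ => acceptProb_nonneg _ _)
    have hη : 0 ≤ η := (abs_nonneg _).trans h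
    rw [ex_sampleLoop_succ]
    calc _ = |(ex (uniform n) (fun k => acceptProb (G n k) n * v k) - successProb G n * u) +
          (1 - successProb G n) * (ex (sampleLoop G n t) v - u)| := by congr 1; ring
      _ ≤ η + (1 - successProb G n) * (t * η + (1 - successProb G n) ^ t) := by
        refine (abs_add_le _ _).trans (add_le_add h ?_)
        rw [abs_mul, abs_of_nonneg h0]
        exact mul_le_mul_of_nonneg_left ih h0
      _ ≤ _ := by
        have : (1 - successProb G n) * (t * η) ≤ t * η :=
          mul_le_of_le_one_left (by positivity) h1
        push_cast
        rw [pow_succ]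
        nlinarith

theorem ex_botEval (n : ℕ) (k : Bits n) (v : Bits (m n) → ℝ) :
    ex (botEval G n k) v = ex (iid (G n k) n) fun y => v (pick (fun _ => false) (List.ofFn y)) := by
  rw [botEval, ex_map]
  rfl

/-- An attempt fails with probability bounded away from 1. -/
theorem IsBotPRG.one_sub_successProb_le {μ : ℕ → ℝ} (hG : IsBotPRG μ m G) :
    ∀ᶠ n in atTop, 1 - successProb G n ≤ 1 / 2 := by
  obtain ⟨c, hc, hμ⟩ := hG.error
  obtain ⟨ε, hε, h⟩ := hG.pseudodeterminism
  have hμ0 : Tendsto μ atTop (𝓝 0) :=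
    hμ.trans_tendsto ((tendsto_rpow_neg_atTop hc).comp tendsto_natCast_atTop_atTop)
  have hε0 := hε.abs.nat_mul.tendsto
  have h4 : (0 : ℝ) < 1 / 4 := by norm_num
  filter_upwards [h, hμ0.eventually_lt_const h4, hε0.eventually_lt_const h4] with n hn hμn hεn
  obtain ⟨good, h1, h2, -⟩ := hn
  have h5 : 1 - successProb G n = ex (uniform n) fun k => 1 - acceptProb (G n k) n := by
    rw [ex_sub, ex_const, successProb]
  -- A good seed fails with probability at most n|ε|, and for any other seed the trivial bound 1 is
  -- used. Both contributions are eventually below 1/4.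
  have h6 : 1 - successProb G n ≤
      ex (uniform n) fun k => n * |ε n| + (1 - if k ∈ good then (1 : ℝ) else 0) := by
    rw [h5]
    refine ex_mono _ fun k => ?_
    have hp : 0 ≤ n * |ε n| := by positivity
    split_ifs with hk
    · obtain ⟨y, hy⟩ := h2 k hk
      have := one_sub_acceptProb_le (G n k) y n
      have h7 : (n : ℝ) * (1 - (G n k (some y)).toReal) ≤ n * |ε n| :=
        mul_le_mul_of_nonneg_left (by linarith [le_abs_self (ε n)]) (Nat.cast_nonneg n)
      linarith
    · have := acceptProb_nonneg (G n k) n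
      linarith
  have h7 : ex (uniform n) (fun k => if k ∈ good then (1 : ℝ) else 0) =
      (good.card : ℝ) / 2 ^ n := by
    simp [ex, uniform, div_eq_mul_inv]
  rw [ex_add, ex_const, ex_sub, ex_const, h7] at h6
  linarith

theorem IsBotPRG.botSample_determinism {μ : ℕ → ℝ} (hG : IsBotPRG μ m G) :
    ∃ Y : ∀ n, Bits n → Bits (m n), ∃ ε : ℕ → ℝ, Negligible ε ∧ ∀ n,
      1 - ε n ≤ pr ((botSample G n).bind fun k =>
        (botEval G n k).map fun y => decide (y = Y n k)) := by
  obtain ⟨ε, hε, h⟩ := hG.pseudodeterminism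
  have hY : ∃ Y : ∀ n, Bits n → Bits (m n), ∀ᶠ n in atTop, ∀ x,
      1 - ε n ≤ (G n x (some (Y n x))).toReal + (G n x none).toReal := by
    classical
    let C : ∀ n, Bits n → Bits (m n) → Prop := fun n x y =>
      1 - ε n ≤ (G n x (some y)).toReal + (G n x none).toReal
    -- Pseudodeterminism holds only for large n; for the other n the value of `Y` is irrelevant and
    -- set to zero.
    refine ⟨fun n x => if hx : ∃ y, C n x y then hx.choose else fun _ => false, ?_⟩
    filter_upwards [h] with n hn x
    obtain ⟨_, -, -, h3⟩ := hn
    have hx : ∃ y, C n x y := h3 x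
    simp only [dif_pos hx]
    exact hx.choose_spec
  obtain ⟨Y, hY⟩ := hY
  -- Taking the exact error as ε makes the inequality true for all n; only its negligibility is
  -- left, an asymptotic question.
  refine ⟨Y, fun n => 1 - pr ((botSample G n).bind fun k =>
    (botEval G n k).map fun y => decide (y = Y n k)), ?_, fun n => by simp⟩
  have hg : Negligible fun n => n * ((15 / 16) ^ n + n * |ε n|) + (1 / 2) ^ n :=
    ((Negligible.pow (by norm_num) (by norm_num)).add hε.abs.nat_mul).nat_mul.add
      (Negligible.pow (by norm_num) (by norm_num))
  refine hg.of_le (fun n => sub_nonneg.2 (pr_le_one _)) ?_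
  filter_upwards [hY, hG.one_sub_successProb_le] with n hn hs
  set v : Bits n → ℝ := fun k => ex (botEval G n k) fun y => if y = Y n k then 0 else 1 with hv
  have e : 1 - pr ((botSample G n).bind fun k =>
      (botEval G n k).map fun y => decide (y = Y n k)) = ex (sampleLoop G n n) v := by
    rw [pr_bind, ← ex_const (botSample G n) 1, ← ex_sub]
    change ex (sampleLoop G n n) _ = _
    congr 1
    funext k
    have h1 := ex_sub (botEval G n k) (fun _ => 1)
      fun y => if decide (y = Y n k) then (1 : ℝ) else 0
    rw [ex_const] at h1
    rw [pr_eq_ex, ex_map, hv]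
    refine h1.symm.trans ?_
    dsimp only
    congr 1
    funext y
    by_cases hy : y = Y n k <;> simp [hy]
  have hv0 : ∀ k, 0 ≤ v k := fun k => ex_nonneg _ fun y => by split_ifs <;> norm_num
  have hv1 : ∀ k, v k ≤ 1 := fun k => ex_le _ fun y => by split_ifs <;> norm_num
  -- All seeds enter here, not only good ones: on those that often give ⊥ the evaluator may fail,
  -- but the weight `acceptProb` makes their contribution exponentially small.
  have hα : |ex (uniform n) (fun k => acceptProb (G n k) n * v k) - successProb G n * 0| ≤
      (15 / 16) ^ n + n * |ε n| := by
    rw [mul_zero, sub_zero]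
    refine abs_ex_le _ fun k => ?_
    have ha := acceptProb_nonneg (G n k) n
    rw [abs_of_nonneg (mul_nonneg ha (hv0 k))]
    have h1 := pick_ne_le (G n k) (fun _ => false) (Y n k) n
    have h2 : v k ≤ (G n k none).toReal ^ n + n * |ε n| := by
      rw [hv]
      dsimp only
      rw [ex_botEval]
      refine h1.trans (add_le_add le_rfl (mul_le_mul_of_nonneg_left ?_ (Nat.cast_nonneg n)))
      linarith [hn k, le_abs_self (ε n)]
    calc _ ≤ acceptProb (G n k) n * ((G n k none).toReal ^ n + n * |ε n|) :=
          mul_le_mul_of_nonneg_left h2 ha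
      _ = acceptProb (G n k) n * (G n k none).toReal ^ n + acceptProb (G n k) n * (n * |ε n|) := by
        ring
      _ ≤ _ := add_le_add (acceptProb_mul_le _ _)
        (mul_le_of_le_one_left (by positivity) (acceptProb_le_one _ _))
  -- The loop estimate with target u = 0, applied to the error probability of the evaluator instead
  -- of a distinguisher.
  have h3 := abs_ex_sampleLoop_sub_le (G := G) n n v 0 _
    (fun k => by rw [sub_zero, abs_of_nonneg (hv0 k)]; exact hv1 k) hα
  rw [sub_zero] at h3
  rw [e]
  refine (le_abs_self _).trans (h3.trans (add_le_add le_rfl ?_))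
  exact pow_le_pow_left₀ (sub_nonneg.2 (successProb_le_one n)) hs n

/-! ### Security -/

/-- The two halves of the samples are independent and rejection counts as 0, so the reduction
computes exactly the product by which the sampler weights a seed. -/
theorem ex_reduction (A : ∀ n, Bits (m n) → PMF Bool) (n q : ℕ) (hq : q = n + n)
    (p : PMF (Option (Bits (m n)))) :
    ex (iid p q) (fun y => pr (reduction A n (List.ofFn y))) =
      acceptProb p n * ex (iid p n) fun z => pr (A n (pick (fun _ => false) (List.ofFn z))) := by
  have h := ex_iid_split p n n (fun u v => if vote u = some none then (0 : ℝ)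
    else pr (A n (pick (fun _ => false) v))) q hq
  have e : (fun y : Fin q → Option (Bits (m n)) => pr (reduction A n (List.ofFn y))) = fun y =>
      if vote ((List.ofFn y).take n) = some none then (0 : ℝ)
      else pr (A n (pick (fun _ => false) ((List.ofFn y).drop n))) := by
    funext y
    rw [reduction]
    split_ifs
    · simp [pr]
    · rfl
  rw [e, h, acceptProb, ← ex_mul_const]
  congr 1
  funext u
  split_ifs
  · rw [ex_const, zero_mul]
  · rw [one_mul]

/-- Masking leaves only the pattern of ⊥, a list over `Option Unit`. Sending the unit to `y` is
injective and thus compatible with votes, so `y` drops out. -/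
theorem acceptProb_isBot {X : Type} [Fintype X] [DecidableEq X] (p : PMF (Option X)) (n : ℕ)
    (y y' : X) :
    acceptProb (p.map fun a => isBot a y) n = acceptProb (p.map fun a => isBot a y') n := by
  have key : ∀ y : X, acceptProb (p.map fun a => isBot a y) n =
      ex (iid p n) fun z => if vote ((List.ofFn z).map fun a => a.map fun _ => ()) = some none
        then 0 else 1 := by
    intro y
    rw [acceptProb, iid_map, ex_map]
    congr 1
    funext z
    have h1 : List.ofFn (fun i => isBot (z i) y) =
        ((List.ofFn z).map fun a => a.map fun _ => ()).map (Option.map fun _ => y) := by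
      rw [List.map_map, List.map_ofFn]
      congr 1
      funext i
      simp only [isBot, Function.comp_apply]
      cases z i <;> rfl
    rw [h1, vote_map (Option.map_injective fun _ _ _ => rfl)]
    rcases vote ((List.ofFn z).map fun a => a.map fun _ => ()) with _ | _ | _ <;> simp
  rw [key, key]

/-- Experiment with an ideal value: the reduction answers like the distinguisher. -/
theorem abs_ex_ideal_le {X : Type} [Fintype X] [DecidableEq X] (p : PMF (Option X)) (n : ℕ)
    (d y : X) (a : X → ℝ) (ha : ∀ x, 0 ≤ a x) (ha' : ∀ x, a x ≤ 1) :
    |acceptProb (p.map fun b => isBot b y) n *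
        ex (iid (p.map fun b => isBot b y) n) (fun z => a (pick d (List.ofFn z))) -
      acceptProb (p.map fun b => isBot b y) n * a y| ≤ (15 / 16) ^ n := by
  set r := p.map fun b => isBot b y with hr
  -- A masked sample is `y` or ⊥, so the additive error in `pick_ne_le` vanishes and all samples
  -- being ⊥ is the only way to miss `y`.
  have h1 : (r (some y)).toReal + (r none).toReal = 1 := by
    rw [← ex_indicator, ← ex_indicator, ← ex_add, hr, ex_map]
    refine Eq.trans ?_ (ex_const p 1)
    congr 1
    funext b
    cases b <;> simp [isBot]
  have h2 : |ex (iid r n) (fun z => a (pick d (List.ofFn z))) - a y| ≤ (r none).toReal ^ n := by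
    rw [← ex_const (iid r n) (a y), ← ex_sub]
    have h3 := pick_ne_le r d y n
    rw [h1, sub_self, mul_zero, add_zero] at h3
    have h4 : ∀ z : Fin n → Option X, |a (pick d (List.ofFn z)) - a y| ≤
        if pick d (List.ofFn z) = y then (0 : ℝ) else 1 := by
      intro z
      split_ifs with h
      · rw [h, sub_self, abs_zero]
      · rw [abs_le]
        constructor <;> linarith [ha (pick d (List.ofFn z)), ha' (pick d (List.ofFn z)), ha y,
          ha' y]
    refine le_trans ?_ h3
    rw [abs_le, ← neg_one_mul, ← ex_const_mul]
    exact ⟨ex_mono _ fun z => by linarith [(abs_le.1 (h4 z)).1],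
      ex_mono _ fun z => (abs_le.1 (h4 z)).2⟩
  rw [← mul_sub, abs_mul, abs_of_nonneg (acceptProb_nonneg _ _)]
  exact (mul_le_mul_of_nonneg_left h2 (acceptProb_nonneg _ _)).trans (acceptProb_mul_le _ _)

/-- Multi-sample security is used twice, for the reduction built from `A` and for the one built from
the constant `true`. The first relates E[a v] to κ'u, the second s to κ', so acceptance and
distinguishing become uncorrelated and the loop estimate applies. -/
theorem IsBotPRG.negligible_advantage {μ : ℕ → ℝ} (hG : IsBotPRG μ m G)
    {A : ∀ n, Bits (m n) → PMF Bool}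
    (hA : IsQPT (X := fun n => Bits (m n)) (Y := fun _ => Bool) A) :
    Negligible (advantage (ℓ := fun n => n) (botSample G) (botEval G) A) := by
  have hpos : ∀ n, 0 < m n := fun n => (Nat.zero_le n).trans_lt (hG.expansion n)
  -- 2n samples: n for the acceptance test and n fresh ones for the evaluator.
  set q : Polynomial ℕ := Polynomial.X + Polynomial.X with hq
  have hqn : ∀ n, q.eval n = n + n := fun n => by simp [hq]
  obtain ⟨ε₁, hε₁, h₁⟩ := hG.security q _ (isQPT_reduction hG.length hpos q hA)
  obtain ⟨ε₂, hε₂, h₂⟩ := hG.security q _ (isQPT_reduction hG.length hpos q isQPT_true)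
  have hg : Negligible fun n => n * (ε₁ n + (15 / 16) ^ n + ε₂ n) + (1 / 2) ^ n :=
    ((hε₁.add (Negligible.pow (by norm_num) (by norm_num))).add hε₂).nat_mul.add
      (Negligible.pow (by norm_num) (by norm_num))
  refine hg.of_le (fun n => abs_nonneg _) ?_
  filter_upwards [hG.one_sub_successProb_le] with n hs
  have h₁ := h₁ n
  have h₂ := h₂ n
  simp only [pr_bind, ex_reduction _ n _ (hqn n)] at h₁ h₂
  have hpr : pr (PMF.pure true) = 1 := by simp [pr]
  simp only [hpr, ex_const, mul_one] at h₂
  set d : Bits (m n) := fun _ => false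
  set a : Bits (m n) → ℝ := fun y => pr (A n y) with ha
  have ha0 : ∀ y, 0 ≤ a y := fun y => pr_nonneg _
  have ha1 : ∀ y, a y ≤ 1 := fun y => pr_le_one _
  set v : Bits n → ℝ := fun k => ex (botEval G n k) a with hv
  set u : ℝ := ex (uniform (m n)) a with hu
  have hu0 : 0 ≤ u := ex_nonneg _ ha0
  have hu1 : u ≤ 1 := ex_le _ ha1
  have hv0 : ∀ k, 0 ≤ v k := fun k => ex_nonneg _ ha0
  have hv1 : ∀ k, v k ≤ 1 := fun k => ex_le _ ha1
  -- The acceptance probability of the ideal experiment; the masking value is immaterial, so `d`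
  -- stands in for the random string.
  set κ' : ℝ := ex (uniform n) fun k => acceptProb ((G n k).map fun b => isBot b d) n
  have e₁ : (ex (uniform n) fun k => acceptProb (G n k) n * ex (iid (G n k) n) fun z =>
      a (pick d (List.ofFn z))) = ex (uniform n) fun k => acceptProb (G n k) n * v k := by
    simp only [hv, ex_botEval]
    rfl
  have e₂ : (ex (uniform n) fun k => ex (uniform (m n)) fun y =>
      acceptProb ((G n k).map fun b => isBot b y) n) = κ' := by
    simp only [κ', acceptProb_isBot (G n _) n _ d, ex_const]
  have h₃ : |(ex (uniform n) fun k => ex (uniform (m n)) fun y =>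
      acceptProb ((G n k).map fun b => isBot b y) n *
        ex (iid ((G n k).map fun b => isBot b y) n) fun z => a (pick d (List.ofFn z))) -
      κ' * u| ≤ (15 / 16) ^ n := by
    have e₃ : κ' * u = ex (uniform n) fun k => ex (uniform (m n)) fun y =>
        acceptProb ((G n k).map fun b => isBot b y) n * a y := by
      simp only [acceptProb_isBot (G n _) n _ d, ex_const_mul, ex_mul_const, κ', u]
    rw [e₃, ← ex_sub]
    refine abs_ex_le _ fun k => ?_
    rw [← ex_sub]
    exact abs_ex_le _ fun y => abs_ex_ideal_le (G n k) n d y a ha0 ha1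
  change |(ex (uniform n) fun k => acceptProb (G n k) n * ex (iid (G n k) n) fun z =>
      a (pick d (List.ofFn z))) - _| ≤ _ at h₁
  rw [e₁] at h₁
  rw [e₂] at h₂
  change |successProb G n - κ'| ≤ _ at h₂
  have hα : |ex (uniform n) (fun k => acceptProb (G n k) n * v k) - successProb G n * u| ≤
      ε₁ n + (15 / 16) ^ n + ε₂ n := by
    have h₄ : |κ' * u - successProb G n * u| ≤ ε₂ n := by
      rw [← sub_mul, abs_mul, abs_sub_comm, abs_of_nonneg hu0]
      exact (mul_le_of_le_one_right (abs_nonneg _) hu1).trans h₂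
    calc _ ≤ _ := abs_sub_le _ (κ' * u) _
      _ ≤ _ := add_le_add ((abs_sub_le _ _ _).trans (add_le_add h₁ h₃)) h₄
  have h₅ := abs_ex_sampleLoop_sub_le (G := G) n n v u _ (fun k => by
    rw [abs_le]
    constructor <;> linarith [hv0 k, hv1 k]) hα
  have e : advantage (ℓ := fun n => n) (botSample G) (botEval G) A n =
      |ex (sampleLoop G n n) v - u| := by
    simp only [advantage, pr_bind]
    rfl
  rw [e]
  exact h₅.trans (add_le_add le_rfl
    (pow_le_pow_left₀ (sub_nonneg.2 (successProb_le_one n)) hs n))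

/-! ### The generators -/

theorem IsBotPRG.isQSGenerator {μ : ℕ → ℝ} (hG : IsBotPRG μ m G) :
    IsQSGenerator (fun n => n) m (botSample G) (botEval G) where
  length_in := isPolyLength_id
  length_out := hG.length
  qpt_sample := isQPT_botSample hG.length.polyBdd hG.qpt
  qpt_eval := isQPT_botEval hG.length (fun n => (Nat.zero_le n).trans_lt (hG.expansion n)) hG.qpt
  expansion := hG.expansion
  determinism := hG.botSample_determinism

theorem IsBotPRG.isWeakPRGqs {μ : ℕ → ℝ} (hG : IsBotPRG μ m G) :
    IsWeakPRGqs (fun n => n) m (botSample G) (botEval G) where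
  toIsQSGenerator := hG.isQSGenerator
  security := by
    -- Since n times a negligible advantage tends to 0, the linear polynomial already suffices.
    refine ⟨Polynomial.X, by simp, fun A hA => ?_⟩
    have h := (hG.negligible_advantage hA).nat_mul.tendsto
    filter_upwards [h.eventually_lt_const one_pos, eventually_gt_atTop 0] with n hn hn0
    rw [Polynomial.eval_X, le_div_iff₀ (by exact_mod_cast hn0), mul_comm]
    exact hn.le

/-- All sampled seeds lie in the range of `padBits`, where truncation undoes padding. The joint law
of the original seed and the output is therefore unchanged, and determinism and advantage carry over
exactly. -/
theorem IsBotPRG.isPRGqs_pad {μ : ℕ → ℝ} (hG : IsBotPRG μ m G) (hm : ∀ n, n ^ 2 < m n) :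
    IsPRGqs (fun n => n ^ 2) m (fun n => (botSample G n).map padBits)
      (fun n k => botEval G n (truncBits k)) where
  length_in := isPolyLength_sq
  length_out := hG.length
  qpt_sample := IsQPT.comp (Y := fun n => Bits n) (PolyBdd.const 0) (fun _ _ => le_rfl)
    hG.isQSGenerator.qpt_sample isQPT_padBits
  qpt_eval := by
    have := IsQPT.comp (ℓ := fun n => n ^ 2) isPolyLength_sq.polyBdd (fun n x => by simp)
      isQPT_truncBits hG.isQSGenerator.qpt_eval
    simpa only [PMF.pure_bind] using this
  expansion := hm
  determinism := by
    obtain ⟨Y, ε, hε, h⟩ := hG.botSample_determinism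
    refine ⟨fun n k => Y n (truncBits k), ε, hε, fun n => (h n).trans_eq ?_⟩
    rw [PMF.bind_map]
    simp only [Function.comp_def, truncBits_padBits]
  security := by
    intro A hA
    refine ⟨_, hG.negligible_advantage hA, fun n => le_of_eq ?_⟩
    simp only [advantage, PMF.bind_map, Function.comp_def, truncBits_padBits]

end

end BotPRG

end

theorem mainTheorem7 (μ : ℕ → ℝ) (m : ℕ → ℕ) :
    (∀ G : ∀ n, BotPRG.Bits n → PMF (Option (BotPRG.Bits (m n))),
      BotPRG.IsBotPRG μ m G →
        BotPRG.IsWeakPRGqs (fun n => n) m (BotPRG.botSample G) (BotPRG.botEval G)) ∧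
    ((∀ n, n ^ 2 < m n) →
      (∃ G : ∀ n, BotPRG.Bits n → PMF (Option (BotPRG.Bits (m n))), BotPRG.IsBotPRG μ m G) →
        ∃ (S : ∀ n, PMF (BotPRG.Bits (n ^ 2)))
          (E : ∀ n, BotPRG.Bits (n ^ 2) → PMF (BotPRG.Bits (m n))),
          BotPRG.IsPRGqs (fun n => n ^ 2) m S E) :=
  ⟨fun _ hG => hG.isWeakPRGqs, fun hm ⟨_, hG⟩ => ⟨_, _, hG.isPRGqs_pad hm⟩⟩
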